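/- **Conventions.** Let $n\ge 2$. A *time-oriented Lorentzian manifold with boundary* is a smooth $n$-manifold $\overline M$ with boundary $\partial\overline M$ (Hausdorff), with a smooth metric $g$ of signature $(-,+,\dots,+)$ and a time orientation. Let $\partial T\overline M=T\overline M|_{\partial\overline M}$. Geodesics are those of the Levi-Civita connection, lie in $\overline M$, are defined on intervals, and may meet $\partial\overline M$ any number of times; a one-point parameter interval is allowed. $\overline M$ is *strongly causal* if every neighbourhood of every point contains a neighbourhood of that point which no causal curve leaves and then re-enters. The *broken timelike lens data* $L(\overline M)$ is the set of triples $(\xi,t,\eta)\in\partial T\overline M\times\mathbb R\times\partial T\overline M$ with $\xi,\eta$ future-directed timelike such that, for some $\tau,s\ge 0$, there are a geodesic on $[0,\tau]$ with initial velocity $\xi$ and a geodesic on $[-s,0]$ with final velocity $\eta$ at parameter $0$, the first ending at the point where the second starts, and the total length is $\tau\sqrt{-g(\xi,\xi)}+s\sqrt{-g(\eta,\eta)}=t$. The *time-probe data* $D(\overline M)$ is the set of triples defined in the same way, with $\xi$ future-directed timelike, $\eta$ future-directed lightlike and $\tau\sqrt{-g(\xi,\xi)}=t$. Two manifolds have *isomorphic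 time-probe data* if there is an isomorphism of smooth fibre bundles $F$ from $\partial T\overline M_1\to\partial\overline M_1$ to $\partial T\overline M_2\to\partial\overline M_2$ (a diffeomorphism of total spaces covering a diffeomorphism of bases, not necessarily linear on fibres) with $(F\times\mathrm{id}\times F)(D(\overline M_1))=D(\overline M_2)$. They have *isomorphic broken timelike lens data* if there is such an $F$ with $(F\times\mathrm{id}\times F)(L(\overline M_1))=L(\overline M_2)$ which also maps the zero section of $\partial T\overline M_1$ onto that of $\partial T\overline M_2$. **Statement.** Let $(\overline M_1,g_1)$ and $(\overline M_2,g_2)$ be strongly causal, compact, time-oriented Lorentzian manifolds with boundary, of dimension $n\ge 2$. Suppose that, in each $\overline M_i$, every lightlike geodesic which is tangent to $\partial\overline M_i$ somewhere is completely contained in $\partial\overline M_i$. If $\overline M_1$ and $\overline M_2$ have isomorphic broken timelike lens data, then they have isomorphic time-probe data. Moreover, for $\overline M=\overline M_1$ and $\overline M=\overline M_2$, let $\Lambda(\overline M)$ be the set of triples $(\xi,t,\eta)\in\partial T\overline M\times\mathbb R\times\partial T\overline M$ with $\eta\neq 0$ and $(\xi,t,\eta)\notin L(\overline M)$ for which there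 are sequences $t_i\to t$ and $\eta_i\to\eta$ with $(\xi,t_i,\eta_i)\in L(\overline M)$. Then $\Lambda(\overline M)\subseteq D(\overline M)$, and $\Lambda(\overline M)$ contains every triple of $D(\overline M)$ that is realized by a broken geodesic whose lightlike piece is constant ($s=0$) or not contained in $\partial\overline M$. (So $D(\overline M)=\Lambda(\overline M)$ if $\partial\overline M$ contains no non-constant lightlike geodesic of $\overline M$.) -/

import Mathlib

open Set Filter Topology
open scoped Manifold ContDiff Bundle

noncomputable section

namespace BrokenLens

section Defs

variable (n : ℕ) [NeZero n] (M : Type*) [TopologicalSpace M]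
  [ChartedSpace (EuclideanHalfSpace n) M] [IsManifold (𝓡∂ n) ∞ M]

/-- A smooth Lorentzian metric of signature `(-, +, ..., +)` on the `n`-manifold with boundary `M`,
together with a time orientation, represented by a smooth timelike vector field which is declared
to be future-directed. -/
structure TimeOrientedLorentzianMetric where
  /-- The scalar product on each tangent space. -/
  inner (x : M) : TangentSpace (𝓡∂ n) x →L[ℝ] TangentSpace (𝓡∂ n) x →L[ℝ] ℝ
  symm (x : M) (v w : TangentSpace (𝓡∂ n) x) : inner x v w = inner x w v
  /-- Signature `(-, +, ..., +)`: each tangent space has a timelike vector, and the scalar product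
  is positive definite on the orthogonal complement of that vector. -/
  signature (x : M) : ∃ v : TangentSpace (𝓡∂ n) x, inner x v v < 0 ∧
    ∀ w : TangentSpace (𝓡∂ n) x, inner x v w = 0 → w ≠ 0 → 0 < inner x w w
  contMDiff : ContMDiff (𝓡∂ n)
    ((𝓡∂ n).prod 𝓘(ℝ, EuclideanSpace ℝ (Fin n) →L[ℝ] EuclideanSpace ℝ (Fin n) →L[ℝ] ℝ)) ∞
    (fun x : M ↦ Bundle.TotalSpace.mk'
      (EuclideanSpace ℝ (Fin n) →L[ℝ] EuclideanSpace ℝ (Fin n) →L[ℝ] ℝ)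
      (E := fun x : M ↦ TangentSpace (𝓡∂ n) x →L[ℝ] TangentSpace (𝓡∂ n) x →L[ℝ] ℝ)
      x (inner x))
  /-- The vector field representing the time orientation. -/
  timeField (x : M) : TangentSpace (𝓡∂ n) x
  timeField_contMDiff : ContMDiff (𝓡∂ n) (𝓡∂ n).tangent ∞
    (fun x : M ↦ (⟨x, timeField x⟩ : TangentBundle (𝓡∂ n) M))
  timeField_timelike (x : M) : inner x (timeField x) (timeField x) < 0

/-- The restriction `∂TM` of the tangent bundle of `M` to the boundary of `M`. -/
def boundaryTangentBundle : Set (TangentBundle (𝓡∂ n) M) :=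
  {v | v.proj ∈ (𝓡∂ n).boundary M}

variable {n M}

/-- The components, in the fibre coordinates induced by the chart around `x₀`, of a tangent
vector. -/
def tangentCoord (x₀ : M) (v : TangentBundle (𝓡∂ n) M) : EuclideanSpace ℝ (Fin n) :=
  (trivializationAt (EuclideanSpace ℝ (Fin n)) (TangentSpace (𝓡∂ n) (M := M)) x₀ v).2

/-- The vector `v`, based at a boundary point, is tangent to the boundary: in a boundary chart, in
which the boundary is given by the vanishing of the coordinate number `0`, the component number `0`
of `v` vanishes. -/
def IsTangentToBoundary (v : TangentBundle (𝓡∂ n) M) : Prop :=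
  v.proj ∈ (𝓡∂ n).boundary M ∧ tangentCoord v.proj v 0 = 0

namespace TimeOrientedLorentzianMetric

variable (g : TimeOrientedLorentzianMetric n M)

/-- The value `g(v, v)`. -/
def normSq (v : TangentBundle (𝓡∂ n) M) : ℝ := g.inner v.proj v.2 v.2

/-- The norm `√(-g(v, v))` of a causal vector. -/
def causalNorm (v : TangentBundle (𝓡∂ n) M) : ℝ := √(-g.normSq v)

def IsTimelike (v : TangentBundle (𝓡∂ n) M) : Prop := g.normSq v < 0

def IsLightlike (v : TangentBundle (𝓡∂ n) M) : Prop := v.2 ≠ 0 ∧ g.normSq v = 0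

def IsCausal (v : TangentBundle (𝓡∂ n) M) : Prop := g.IsTimelike v ∨ g.IsLightlike v

/-- A causal vector `v` is future-directed if `g(T, v) < 0`, where `T` is the timelike vector field
that represents the time orientation. (To be used for causal vectors only.) -/
def IsFutureDirected (v : TangentBundle (𝓡∂ n) M) : Prop :=
  g.inner v.proj (g.timeField v.proj) v.2 < 0

/-- The metric coefficients `g(a, b)` at the point with coordinates `y` in the chart around `x₀`,
for coordinate vectors `a` and `b`. -/
def metricInChart (x₀ : M) (y a b : EuclideanSpace ℝ (Fin n)) : ℝ :=
  let x := (extChartAt (𝓡∂ n) x₀).symm y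
  let e := trivializationAt (EuclideanSpace ℝ (Fin n)) (TangentSpace (𝓡∂ n) (M := M)) x₀
  g.inner x (e.symm x a) (e.symm x b)

/-- The derivative, in direction `w`, of the metric coefficient `g(a, b)` in the chart around `x₀`.
(One-sided at boundary points.) -/
def metricDerivInChart (x₀ : M) (y w a b : EuclideanSpace ℝ (Fin n)) : ℝ :=
  fderivWithin ℝ (fun z ↦ g.metricInChart x₀ z a b) (range (𝓡∂ n)) y w

/-- The Christoffel symbol of the first kind of the Levi-Civita connection in the chart
around `x₀`: the value `g(∇_a b, w)` for constant coordinate vector fields `a`, `b`, `w`. -/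
def christoffelInChart (x₀ : M) (y a b w : EuclideanSpace ℝ (Fin n)) : ℝ :=
  (g.metricDerivInChart x₀ y a b w + g.metricDerivInChart x₀ y b a w
    - g.metricDerivInChart x₀ y w a b) / 2

/-- `V` is the velocity field of a geodesic of `M` with domain the interval `J`: a continuous curve
`V` in the tangent bundle such that, in a chart around the point `(V t).proj`, the base curve
has velocity `V`, and `V` satisfies the geodesic equation `∇_V V = 0`, that is
`g(V', w) + Γ(V, V, w) = 0` for all `w`. Derivatives at endpoints of `J` are one-sided; the geodesic
may touch the boundary at any number of parameters; an interval consisting of one point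
is allowed, and gives a constant geodesic which is a point together with a vector. -/
def IsGeodesicOn (V : ℝ → TangentBundle (𝓡∂ n) M) (J : Set ℝ) : Prop :=
  J.OrdConnected ∧ ContinuousOn V J ∧
    ∀ t ∈ J,
      HasDerivWithinAt (fun s ↦ extChartAt (𝓡∂ n) (V t).proj (V s).proj)
        (tangentCoord (V t).proj (V t)) J t ∧
      ∃ a : EuclideanSpace ℝ (Fin n),
        HasDerivWithinAt (fun s ↦ tangentCoord (V t).proj (V s)) a J t ∧
        ∀ w : EuclideanSpace ℝ (Fin n),
          g.metricInChart (V t).proj (extChartAt (𝓡∂ n) (V t).proj (V t).proj) a w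
            + g.christoffelInChart (V t).proj (extChartAt (𝓡∂ n) (V t).proj (V t).proj)
              (tangentCoord (V t).proj (V t)) (tangentCoord (V t).proj (V t)) w = 0

/-- A future-directed causal curve, parametrized by `[a, b]`: a piecewise smooth curve whose
(one-sided) velocities on each of the finitely many pieces are causal and future-directed. -/
def IsFutureCausalCurve (γ : ℝ → M) (a b : ℝ) : Prop :=
  ∃ (N : ℕ) (σ : ℕ → ℝ), StrictMono σ ∧ σ 0 = a ∧ σ N = b ∧
    ∀ i < N, ContMDiffOn 𝓘(ℝ, ℝ) (𝓡∂ n) ∞ γ (Icc (σ i) (σ (i + 1))) ∧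
      ∀ t ∈ Icc (σ i) (σ (i + 1)),
        g.IsCausal ⟨γ t, mfderivWithin 𝓘(ℝ, ℝ) (𝓡∂ n) γ (Icc (σ i) (σ (i + 1))) t (1 : ℝ)⟩ ∧
        g.IsFutureDirected
          ⟨γ t, mfderivWithin 𝓘(ℝ, ℝ) (𝓡∂ n) γ (Icc (σ i) (σ (i + 1))) t (1 : ℝ)⟩

/-- No causal curve intersects the set `U` twice, that is, no causal curve leaves `U` and
then returns to `U`. (Past-directed curves are future-directed curves traversed backwards.) -/
def IsCausallyConvex (U : Set M) : Prop :=
  ∀ (γ : ℝ → M) (a b : ℝ), g.IsFutureCausalCurve γ a b → γ a ∈ U → γ b ∈ U →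
    ∀ t ∈ Icc a b, γ t ∈ U

/-- Every neighbourhood of every point contains a causally convex neighbourhood of the point. -/
def IsStronglyCausal : Prop :=
  ∀ p : M, ∀ U ∈ 𝓝 p, ∃ V ∈ 𝓝 p, V ⊆ U ∧ g.IsCausallyConvex V

/-- Any lightlike geodesic which is tangent to the boundary somewhere is completely contained in
the boundary. -/
def LightlikeTangentGeodesicsStayInBoundary : Prop :=
  ∀ (V : ℝ → TangentBundle (𝓡∂ n) M) (J : Set ℝ), g.IsGeodesicOn V J →
    (∀ t ∈ J, g.IsLightlike (V t)) → (∃ t ∈ J, IsTangentToBoundary (V t)) →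
      ∀ t ∈ J, (V t).proj ∈ (𝓡∂ n).boundary M

/-- `V` on `[0, τ]` is a geodesic starting with `ξ`, `W` on `[-s, 0]` is a geodesic ending with
`η`, and the endpoint of the first is the starting point of the second. -/
def IsBrokenGeodesic (ξ η : TangentBundle (𝓡∂ n) M) (τ s : ℝ)
    (V W : ℝ → TangentBundle (𝓡∂ n) M) : Prop :=
  0 ≤ τ ∧ 0 ≤ s ∧ g.IsGeodesicOn V (Icc 0 τ) ∧ V 0 = ξ ∧
    g.IsGeodesicOn W (Icc (-s) 0) ∧ W 0 = η ∧ (V τ).proj = (W (-s)).proj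

/-- The time-probe data: triples `(ξ, t, η)` with `ξ`, `η` based at the boundary and
future-directed, `ξ` timelike, `η` lightlike, such that after distance `t` the geodesic starting
with `ξ` intersects the geodesic ending with `η`. (Geodesics have constant speed, so the
distance travelled after parameter time `τ` is `τ * √(-g(ξ, ξ))`.) -/
def timeProbeData : Set (TangentBundle (𝓡∂ n) M × ℝ × TangentBundle (𝓡∂ n) M) :=
  {x | ∃ ξ t η, x = (ξ, t, η) ∧
    ξ ∈ boundaryTangentBundle n M ∧ η ∈ boundaryTangentBundle n M ∧
    g.IsTimelike ξ ∧ g.IsFutureDirected ξ ∧ g.IsLightlike η ∧ g.IsFutureDirected η ∧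
    ∃ τ s V W, g.IsBrokenGeodesic ξ η τ s V W ∧ τ * g.causalNorm ξ = t}

/-- The broken timelike lens data: triples `(ξ, t, η)` with `ξ`, `η` based at the boundary,
future-directed and timelike, such that the geodesic starting with `ξ` intersects the geodesic
ending with `η`, and the broken geodesic thus formed has total length `t`. -/
def brokenTimelikeLensData : Set (TangentBundle (𝓡∂ n) M × ℝ × TangentBundle (𝓡∂ n) M) :=
  {x | ∃ ξ t η, x = (ξ, t, η) ∧
    ξ ∈ boundaryTangentBundle n M ∧ η ∈ boundaryTangentBundle n M ∧
    g.IsTimelike ξ ∧ g.IsFutureDirected ξ ∧ g.IsTimelike η ∧ g.IsFutureDirected η ∧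
    ∃ τ s V W, g.IsBrokenGeodesic ξ η τ s V W ∧ τ * g.causalNorm ξ + s * g.causalNorm η = t}

/-- The elements of the time-probe data for which the lightlike piece, ending with `η`, can be taken
to be constant or not contained in the boundary. -/
def properTimeProbeData : Set (TangentBundle (𝓡∂ n) M × ℝ × TangentBundle (𝓡∂ n) M) :=
  {x | ∃ ξ t η, x = (ξ, t, η) ∧ x ∈ g.timeProbeData ∧
    ∃ τ s V W, g.IsBrokenGeodesic ξ η τ s V W ∧ τ * g.causalNorm ξ = t ∧
      (s = 0 ∨ ∃ r ∈ Icc (-s) 0, (W r).proj ∉ (𝓡∂ n).boundary M)}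

/-- The triples `(ξ, t, η)` over the boundary with `η ≠ 0`, outside of the broken timelike
lens data, for which there are sequences `tᵢ → t` and `ηᵢ → η` with `(ξ, tᵢ, ηᵢ)` in the broken
timelike lens data. -/
def lensDataLimits : Set (TangentBundle (𝓡∂ n) M × ℝ × TangentBundle (𝓡∂ n) M) :=
  {x | ∃ ξ t η, x = (ξ, t, η) ∧
    ξ ∈ boundaryTangentBundle n M ∧ η ∈ boundaryTangentBundle n M ∧ η.2 ≠ 0 ∧
    (ξ, t, η) ∉ g.brokenTimelikeLensData ∧
    ∃ (u : ℕ → ℝ) (ζ : ℕ → TangentBundle (𝓡∂ n) M),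
      Tendsto u atTop (𝓝 t) ∧ Tendsto ζ atTop (𝓝 η) ∧
      ∀ i, (ξ, u i, ζ i) ∈ g.brokenTimelikeLensData}

end TimeOrientedLorentzianMetric

end Defs

section Iso

variable (n : ℕ) [NeZero n]
  (M₁ : Type*) [TopologicalSpace M₁] [ChartedSpace (EuclideanHalfSpace n) M₁]
  [IsManifold (𝓡∂ n) ∞ M₁]
  (M₂ : Type*) [TopologicalSpace M₂] [ChartedSpace (EuclideanHalfSpace n) M₂]
  [IsManifold (𝓡∂ n) ∞ M₂]

/-- An isomorphism of smooth fibre bundles from `∂TM₁ → ∂M₁` to `∂TM₂ → ∂M₂`: a diffeomorphism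
of the total spaces covering a diffeomorphism of the base spaces (not assumed linear on fibres).
Total and base spaces are submanifolds, locally given by the vanishing of one coordinate, of `TMᵢ`
and `Mᵢ`, and maps between them are smooth exactly if they are smooth on these subsets in the
sense of `ContMDiffOn`. The values of the maps outside of these subsets play no role. -/
structure BoundaryBundleIso where
  total : PartialEquiv (TangentBundle (𝓡∂ n) M₁) (TangentBundle (𝓡∂ n) M₂)
  base : PartialEquiv M₁ M₂
  total_source : total.source = boundaryTangentBundle n M₁
  total_target : total.target = boundaryTangentBundle n M₂
  base_source : base.source = (𝓡∂ n).boundary M₁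
  base_target : base.target = (𝓡∂ n).boundary M₂
  total_smooth : ContMDiffOn (𝓡∂ n).tangent (𝓡∂ n).tangent ∞ total total.source
  total_symm_smooth : ContMDiffOn (𝓡∂ n).tangent (𝓡∂ n).tangent ∞ total.symm total.target
  base_smooth : ContMDiffOn (𝓡∂ n) (𝓡∂ n) ∞ base base.source
  base_symm_smooth : ContMDiffOn (𝓡∂ n) (𝓡∂ n) ∞ base.symm base.target
  proj_total : ∀ v ∈ boundaryTangentBundle n M₁, (total v).proj = base v.proj

variable {n M₁ M₂}

/-- The bundle isomorphism identifies the set `A` of triples with the set `B`. -/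
def BoundaryBundleIso.Identifies (Φ : BoundaryBundleIso n M₁ M₂)
    (A : Set (TangentBundle (𝓡∂ n) M₁ × ℝ × TangentBundle (𝓡∂ n) M₁))
    (B : Set (TangentBundle (𝓡∂ n) M₂ × ℝ × TangentBundle (𝓡∂ n) M₂)) : Prop :=
  ∀ ξ ∈ boundaryTangentBundle n M₁, ∀ t : ℝ, ∀ η ∈ boundaryTangentBundle n M₁,
    (ξ, t, η) ∈ A ↔ (Φ.total ξ, t, Φ.total η) ∈ B

/-- The bundle isomorphism identifies the zero section of `∂TM₁` with that of `∂TM₂`. -/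
def BoundaryBundleIso.IdentifiesZeroSections (Φ : BoundaryBundleIso n M₁ M₂) : Prop :=
  ∀ v ∈ boundaryTangentBundle n M₁, v.2 = 0 ↔ (Φ.total v).2 = 0

def HaveIsomorphicTimeProbeData (g₁ : TimeOrientedLorentzianMetric n M₁)
    (g₂ : TimeOrientedLorentzianMetric n M₂) : Prop :=
  ∃ Φ : BoundaryBundleIso n M₁ M₂, Φ.Identifies g₁.timeProbeData g₂.timeProbeData

def HaveIsomorphicBrokenTimelikeLensData (g₁ : TimeOrientedLorentzianMetric n M₁)
    (g₂ : TimeOrientedLorentzianMetric n M₂) : Prop :=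
  ∃ Φ : BoundaryBundleIso n M₁ M₂,
    Φ.Identifies g₁.brokenTimelikeLensData g₂.brokenTimelikeLensData ∧ Φ.IdentifiesZeroSections

end Iso

end BrokenLens

end

set_option linter.unusedSectionVars false

noncomputable section

namespace BrokenLens

/-- The model space of the charts. -/
abbrev Model (n : ℕ) := EuclideanSpace ℝ (Fin n)

/-- The model space of the charts of the tangent bundle: positions and velocities. -/
abbrev Phase (n : ℕ) := Model n × Model n

section Charts

variable {n : ℕ} [NeZero n] {M : Type*} [TopologicalSpace M]
  [ChartedSpace (EuclideanHalfSpace n) M] [IsManifold (𝓡∂ n) ∞ M]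

instance isManifold_one : IsManifold (𝓡∂ n) 1 M :=
  IsManifold.of_le (n := ∞) (by norm_num)

/-- The chart of the tangent bundle induced by the chart around `x₀`. -/
def bundleChart (x₀ : M) : PartialEquiv (TangentBundle (𝓡∂ n) M) (Phase n) :=
  extChartAt (𝓡∂ n).tangent (⟨x₀, 0⟩ : TangentBundle (𝓡∂ n) M)

theorem bundleChart_apply (x₀ : M) (v : TangentBundle (𝓡∂ n) M) :
    bundleChart x₀ v = (extChartAt (𝓡∂ n) x₀ v.proj, tangentCoord x₀ v) := by
  rw [bundleChart, ModelWithCorners.tangent, FiberBundle.extChartAt]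
  rfl

theorem bundleChart_source (x₀ : M) :
    (bundleChart x₀ : PartialEquiv (TangentBundle (𝓡∂ n) M) _).source =
      {v | v.proj ∈ (chartAt (EuclideanHalfSpace n) x₀).source} := by
  ext v
  rw [bundleChart, extChartAt_source]
  simp

theorem mem_bundleChart_source {x₀ : M} {v : TangentBundle (𝓡∂ n) M} :
    v ∈ (bundleChart x₀ : PartialEquiv (TangentBundle (𝓡∂ n) M) _).source ↔
      v.proj ∈ (extChartAt (𝓡∂ n) x₀).source := by
  rw [bundleChart_source, extChartAt_source]; rfl

theorem bundleChart_target (x₀ : M) :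
    (bundleChart x₀ : PartialEquiv (TangentBundle (𝓡∂ n) M) _).target =
      (extChartAt (𝓡∂ n) x₀).target ×ˢ univ := by
  rw [bundleChart, ModelWithCorners.tangent, FiberBundle.extChartAt_target]
  congr 1
  apply inter_eq_left.2
  intro y hy
  have := (extChartAt (𝓡∂ n) x₀).map_target hy
  rwa [extChartAt_source] at this

theorem isOpen_bundleChart_source (x₀ : M) :
    IsOpen (bundleChart x₀ : PartialEquiv (TangentBundle (𝓡∂ n) M) _).source :=
  isOpen_extChartAt_source _

theorem continuousOn_bundleChart (x₀ : M) :
    ContinuousOn (bundleChart x₀ : PartialEquiv (TangentBundle (𝓡∂ n) M) _)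
      (bundleChart x₀ : PartialEquiv (TangentBundle (𝓡∂ n) M) _).source :=
  continuousOn_extChartAt _

theorem continuousOn_bundleChart_symm (x₀ : M) :
    ContinuousOn (bundleChart x₀ : PartialEquiv (TangentBundle (𝓡∂ n) M) _).symm
      (bundleChart x₀ : PartialEquiv (TangentBundle (𝓡∂ n) M) _).target :=
  continuousOn_extChartAt_symm _

theorem continuousAt_bundleChart {x₀ : M} {v : TangentBundle (𝓡∂ n) M}
    (hv : v.proj ∈ (extChartAt (𝓡∂ n) x₀).source) :
    ContinuousAt (bundleChart x₀ : PartialEquiv (TangentBundle (𝓡∂ n) M) _) v :=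
  (continuousOn_bundleChart x₀).continuousAt
    ((isOpen_bundleChart_source x₀).mem_nhds (mem_bundleChart_source.2 hv))

theorem mem_bundleChart_source_self (v : TangentBundle (𝓡∂ n) M) :
    v ∈ (bundleChart v.proj : PartialEquiv (TangentBundle (𝓡∂ n) M) _).source :=
  mem_bundleChart_source.2 (mem_extChartAt_source _)

theorem continuous_proj : Continuous (fun v : TangentBundle (𝓡∂ n) M ↦ v.proj) :=
  FiberBundle.continuous_proj (Model n) (TangentSpace (𝓡∂ n) (M := M))

theorem bundleChart_symm_proj {x₀ : M} {p : Phase n} (hp : p.1 ∈ (extChartAt (𝓡∂ n) x₀).target) :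
    ((bundleChart x₀ : PartialEquiv (TangentBundle (𝓡∂ n) M) _).symm p).proj =
      (extChartAt (𝓡∂ n) x₀).symm p.1 := by
  have hpt : p ∈ (bundleChart x₀ : PartialEquiv (TangentBundle (𝓡∂ n) M) _).target := by
    rw [bundleChart_target]; exact ⟨hp, trivial⟩
  have h1 := (bundleChart x₀ : PartialEquiv (TangentBundle (𝓡∂ n) M) _).right_inv hpt
  have h2 := (bundleChart x₀ : PartialEquiv (TangentBundle (𝓡∂ n) M) _).map_target hpt
  rw [bundleChart_apply] at h1
  rw [← congrArg Prod.fst h1]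
  exact ((extChartAt (𝓡∂ n) x₀).left_inv (mem_bundleChart_source.1 h2)).symm

theorem coord_zero_nonneg {x₀ : M} {y : Model n} (hy : y ∈ (extChartAt (𝓡∂ n) x₀).target) :
    0 ≤ y 0 := by
  have h := extChartAt_target_subset_range x₀ hy
  rw [range_modelWithCornersEuclideanHalfSpace] at h
  exact h

theorem range_model : range (𝓡∂ n) = {y : Model n | 0 ≤ y 0} :=
  range_modelWithCornersEuclideanHalfSpace n

/-- The velocity of a tangent vector in another chart is obtained with the derivative of the
transition map. -/
theorem tangentCoord_change {x₀ x₁ : M} {v : TangentBundle (𝓡∂ n) M}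
    (h₀ : v.proj ∈ (extChartAt (𝓡∂ n) x₀).source) (h₁ : v.proj ∈ (extChartAt (𝓡∂ n) x₁).source) :
    tangentCoord x₁ v = fderivWithin ℝ (extChartAt (𝓡∂ n) x₁ ∘ (extChartAt (𝓡∂ n) x₀).symm)
      (range (𝓡∂ n)) (extChartAt (𝓡∂ n) x₀ v.proj) (tangentCoord x₀ v) := by
  have := tangentCoordChange_comp (I := 𝓡∂ n) (w := v.proj) (x := x₀) (y := x₁) (z := v.proj)
    (v := v.2) ⟨⟨mem_extChartAt_source _, h₀⟩, h₁⟩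
  exact this.symm

theorem tangentCoord_add (x₀ x : M) (h : x ∈ (extChartAt (𝓡∂ n) x₀).source)
    (a b : TangentSpace (𝓡∂ n) x) :
    tangentCoord x₀ ⟨x, a + b⟩ = tangentCoord x₀ ⟨x, a⟩ + tangentCoord x₀ ⟨x, b⟩ := by
  rw [extChartAt_source] at h
  exact ((trivializationAt (Model n) (TangentSpace (𝓡∂ n) (M := M)) x₀).linear ℝ h).1 a b

theorem tangentCoord_smul (x₀ x : M) (h : x ∈ (extChartAt (𝓡∂ n) x₀).source) (c : ℝ)
    (a : TangentSpace (𝓡∂ n) x) :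
    tangentCoord x₀ ⟨x, c • a⟩ = c • tangentCoord x₀ ⟨x, a⟩ := by
  rw [extChartAt_source] at h
  exact ((trivializationAt (Model n) (TangentSpace (𝓡∂ n) (M := M)) x₀).linear ℝ h).2 c a

theorem symm_tangentCoord {x₀ : M} {v : TangentBundle (𝓡∂ n) M}
    (h : v.proj ∈ (extChartAt (𝓡∂ n) x₀).source) :
    (trivializationAt (Model n) (TangentSpace (𝓡∂ n) (M := M)) x₀).symmL ℝ v.proj
      (tangentCoord x₀ v) = v.2 := by
  rw [extChartAt_source] at h
  rw [Bundle.Trivialization.symmL_apply _ h]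
  exact (trivializationAt (Model n) (TangentSpace (𝓡∂ n) (M := M)) x₀).symm_proj_apply v h

theorem tangentCoord_symm {x₀ x : M} (h : x ∈ (extChartAt (𝓡∂ n) x₀).source) (a : Model n) :
    tangentCoord x₀ (⟨x, (trivializationAt (Model n) (TangentSpace (𝓡∂ n) (M := M)) x₀).symmL ℝ x a⟩ :
      TangentBundle (𝓡∂ n) M) = a := by
  rw [extChartAt_source] at h
  rw [Bundle.Trivialization.symmL_apply _ h]
  have := (trivializationAt (Model n) (TangentSpace (𝓡∂ n) (M := M)) x₀).apply_mk_symm h a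
  exact congrArg Prod.snd this

theorem bundleChart_symm_apply {x₀ : M} {y : Model n} (hy : y ∈ (extChartAt (𝓡∂ n) x₀).target)
    (a : Model n) : (bundleChart x₀ : PartialEquiv (TangentBundle (𝓡∂ n) M) _).symm (y, a) =
      ⟨(extChartAt (𝓡∂ n) x₀).symm y,
        (trivializationAt (Model n) (TangentSpace (𝓡∂ n) (M := M)) x₀).symmL ℝ
          ((extChartAt (𝓡∂ n) x₀).symm y) a⟩ := by
  have hs := (extChartAt (𝓡∂ n) x₀).map_target hy
  have h := (bundleChart x₀ : PartialEquiv (TangentBundle (𝓡∂ n) M) _).left_inv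
    (mem_bundleChart_source (v := ⟨(extChartAt (𝓡∂ n) x₀).symm y,
        (trivializationAt (Model n) (TangentSpace (𝓡∂ n) (M := M)) x₀).symmL ℝ
          ((extChartAt (𝓡∂ n) x₀).symm y) a⟩) |>.2 hs)
  rw [bundleChart_apply, tangentCoord_symm hs] at h
  dsimp only at h
  rwa [(extChartAt (𝓡∂ n) x₀).right_inv hy] at h

end Charts

namespace TimeOrientedLorentzianMetric

variable {n : ℕ} [NeZero n] {M : Type*} [TopologicalSpace M]
  [ChartedSpace (EuclideanHalfSpace n) M] [IsManifold (𝓡∂ n) ∞ M]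
  (g : TimeOrientedLorentzianMetric n M)

/-- The matrix of the metric in the chart around `x₀`. -/
def metricCoeff (x₀ : M) (y : Model n) : Model n →L[ℝ] Model n →L[ℝ] ℝ :=
  LinearMap.toContinuousLinearMap
    { toFun a := (g.inner ((extChartAt (𝓡∂ n) x₀).symm y)
        ((trivializationAt (Model n) (TangentSpace (𝓡∂ n) (M := M)) x₀).symmL ℝ
          ((extChartAt (𝓡∂ n) x₀).symm y) a)).comp
        ((trivializationAt (Model n) (TangentSpace (𝓡∂ n) (M := M)) x₀).symmL ℝ
          ((extChartAt (𝓡∂ n) x₀).symm y))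
      map_add' a b := by
        rw [map_add, map_add]
        rfl
      map_smul' r a := by
        rw [map_smul, map_smul]
        rfl }

theorem metricCoeff_apply (x₀ : M) (y a b : Model n) :
    g.metricCoeff x₀ y a b = g.inner ((extChartAt (𝓡∂ n) x₀).symm y)
      ((trivializationAt (Model n) (TangentSpace (𝓡∂ n) (M := M)) x₀).symmL ℝ
        ((extChartAt (𝓡∂ n) x₀).symm y) a)
      ((trivializationAt (Model n) (TangentSpace (𝓡∂ n) (M := M)) x₀).symmL ℝ
        ((extChartAt (𝓡∂ n) x₀).symm y) b) := rfl

theorem metricCoeff_symm (x₀ : M) (y a b : Model n) :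
    g.metricCoeff x₀ y a b = g.metricCoeff x₀ y b a :=
  g.symm _ _ _

theorem metricInChart_eq {x₀ : M} {y : Model n} (hy : y ∈ (extChartAt (𝓡∂ n) x₀).target)
    (a b : Model n) : g.metricInChart x₀ y a b = g.metricCoeff x₀ y a b := by
  have h := (extChartAt (𝓡∂ n) x₀).map_target hy
  rw [extChartAt_source] at h
  simp only [metricInChart, metricCoeff_apply]
  rw [Bundle.Trivialization.symmL_apply _ h, Bundle.Trivialization.symmL_apply _ h]

theorem metricCoeff_tangentCoord {x₀ : M} {v w : TangentBundle (𝓡∂ n) M}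
    (h : v.proj ∈ (extChartAt (𝓡∂ n) x₀).source) (hvw : w.proj = v.proj) :
    g.metricCoeff x₀ (extChartAt (𝓡∂ n) x₀ v.proj) (tangentCoord x₀ v) (tangentCoord x₀ w) =
      g.inner v.proj v.2 (hvw ▸ w.2) := by
  obtain ⟨x, v⟩ := v
  obtain ⟨x', w⟩ := w
  dsimp only at h hvw
  subst hvw
  rw [metricCoeff_apply]
  rw [(extChartAt (𝓡∂ n) x₀).left_inv h]
  have h1 := symm_tangentCoord (x₀ := x₀) (v := (⟨x', v⟩ : TangentBundle (𝓡∂ n) M)) h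
  have h2 := symm_tangentCoord (x₀ := x₀) (v := (⟨x', w⟩ : TangentBundle (𝓡∂ n) M)) h
  dsimp only at h1 h2
  rw [h1, h2]

theorem contDiffOn_metricCoeff (x₀ : M) :
    ContDiffOn ℝ ∞ (g.metricCoeff x₀) (extChartAt (𝓡∂ n) x₀).target := by
  rw [contDiffOn_clm_apply]
  intro a
  rw [contDiffOn_clm_apply]
  intro b
  have hsymm : ContMDiffOn 𝓘(ℝ, Model n) (𝓡∂ n) ∞ (extChartAt (𝓡∂ n) x₀).symm
      (extChartAt (𝓡∂ n) x₀).target := contMDiffOn_extChartAt_symm x₀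
  have hsec : ∀ a : Model n, ContMDiffOn 𝓘(ℝ, Model n) (𝓡∂ n).tangent ∞
      (fun y ↦ (⟨(extChartAt (𝓡∂ n) x₀).symm y,
        (trivializationAt (Model n) (TangentSpace (𝓡∂ n) (M := M)) x₀).symmL ℝ
          ((extChartAt (𝓡∂ n) x₀).symm y) a⟩ : TangentBundle (𝓡∂ n) M))
      (extChartAt (𝓡∂ n) x₀).target := by
    intro a
    have h1 : ContMDiffOn 𝓘(ℝ, Model n) (𝓡∂ n).tangent ∞
        (fun y ↦ (bundleChart x₀ : PartialEquiv (TangentBundle (𝓡∂ n) M) _).symm (y, a))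
        (extChartAt (𝓡∂ n) x₀).target := by
      refine (contMDiffOn_extChartAt_symm (n := ∞) (I := (𝓡∂ n).tangent)
        (⟨x₀, 0⟩ : TangentBundle (𝓡∂ n) M)).comp (t := (bundleChart x₀ : PartialEquiv
          (TangentBundle (𝓡∂ n) M) _).target) (f := fun y ↦ (y, a)) ?_ ?_
      · exact (contDiff_id.prodMk contDiff_const).contMDiff.contMDiffOn
      · intro y hy
        rw [bundleChart_target]; exact ⟨hy, trivial⟩
    exact h1.congr fun y hy ↦ (bundleChart_symm_apply hy a).symm
  have := ContMDiffOn.clm_bundle_apply₂ (F₁ := Model n) (F₂ := Model n) (F₃ := ℝ)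
    (E₃ := Bundle.Trivial M ℝ) (b := (extChartAt (𝓡∂ n) x₀).symm)
    (ψ := fun y ↦ g.inner ((extChartAt (𝓡∂ n) x₀).symm y))
    (g.contMDiff.comp_contMDiffOn hsymm) (hsec a) (hsec b)
  intro y hy
  have h2 := this y hy
  simp only [Bundle.contMDiffWithinAt_totalSpace] at h2
  exact h2.2.contDiffWithinAt

end TimeOrientedLorentzianMetric

set_option synthInstance.maxHeartbeats 400000 in
instance (n : ℕ) : NormedAddCommGroup (Model n →L[ℝ] Model n →L[ℝ] ℝ) := inferInstance

set_option synthInstance.maxHeartbeats 400000 in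
instance (n : ℕ) : NormedSpace ℝ (Model n →L[ℝ] Model n →L[ℝ] ℝ) := inferInstance

instance (n : ℕ) : AddCommGroup (Model n →L[ℝ] Model n →L[ℝ] ℝ) :=
  NormedAddCommGroup.toAddCommGroup

namespace TimeOrientedLorentzianMetric

variable {n : ℕ} [NeZero n] {M : Type*} [TopologicalSpace M]
  [ChartedSpace (EuclideanHalfSpace n) M] [IsManifold (𝓡∂ n) ∞ M]
  (g : TimeOrientedLorentzianMetric n M)

theorem inner_nondegenerate {x : M} {a : TangentSpace (𝓡∂ n) x} (h : ∀ w, g.inner x a w = 0) :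
    a = 0 := by
  by_contra ha
  obtain ⟨v, -, hv⟩ := g.signature x
  have := hv a (by rw [g.symm, h]) ha
  rw [h] at this
  exact lt_irrefl _ this

theorem metricCoeff_injective {x₀ : M} {y : Model n} (hy : y ∈ (extChartAt (𝓡∂ n) x₀).target) :
    Function.Injective (g.metricCoeff x₀ y) := by
  rw [injective_iff_map_eq_zero]
  intro a ha
  have hs := (extChartAt (𝓡∂ n) x₀).map_target hy
  have h0 : (trivializationAt (Model n) (TangentSpace (𝓡∂ n) (M := M)) x₀).symmL ℝ
      ((extChartAt (𝓡∂ n) x₀).symm y) a = 0 := by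
    refine g.inner_nondegenerate fun w ↦ ?_
    have h1 := symm_tangentCoord (x₀ := x₀)
      (v := (⟨(extChartAt (𝓡∂ n) x₀).symm y, w⟩ : TangentBundle (𝓡∂ n) M)) hs
    dsimp only at h1
    rw [← h1, ← metricCoeff_apply, ha]
    rfl
  have h2 := tangentCoord_symm hs a
  rw [h0] at h2
  have h3 := tangentCoord_smul x₀ _ hs 0 (0 : TangentSpace (𝓡∂ n) ((extChartAt (𝓡∂ n) x₀).symm y))
  rw [zero_smul, zero_smul, h2] at h3
  exact h3

/-- The matrix of the metric as an isomorphism from vectors to covectors. -/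
theorem exists_metricCoeff_equiv {x₀ : M} {y : Model n} (hy : y ∈ (extChartAt (𝓡∂ n) x₀).target) :
    ∃ e : Model n ≃L[ℝ] (Model n →L[ℝ] ℝ), (e : Model n →L[ℝ] (Model n →L[ℝ] ℝ)) =
      g.metricCoeff x₀ y := by
  have hd : Module.finrank ℝ (Model n) = Module.finrank ℝ (Model n →L[ℝ] ℝ) := by
    rw [← (LinearMap.toContinuousLinearMap (𝕜 := ℝ) (E := Model n) (F' := ℝ)).finrank_eq]
    exact (Subspace.dual_finrank_eq (K := ℝ) (V := Model n)).symm
  refine ⟨(LinearMap.linearEquivOfInjective (g.metricCoeff x₀ y).toLinearMap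
    (g.metricCoeff_injective hy) hd).toContinuousLinearEquiv, ?_⟩
  ext a b
  rfl

/-- The derivative of the matrix of the metric in the chart around `x₀`. -/
def metricDeriv (x₀ : M) (y : Model n) : Model n →L[ℝ] Model n →L[ℝ] Model n →L[ℝ] ℝ :=
  fderivWithin ℝ (g.metricCoeff x₀) (range (𝓡∂ n)) y

theorem contDiffWithinAt_metricCoeff {x₀ : M} {y : Model n}
    (hy : y ∈ (extChartAt (𝓡∂ n) x₀).target) :
    ContDiffWithinAt ℝ ∞ (g.metricCoeff x₀) (range (𝓡∂ n)) y :=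
  (g.contDiffOn_metricCoeff x₀ y hy).mono_of_mem_nhdsWithin
    (extChartAt_target_mem_nhdsWithin_of_mem hy)

theorem hasFDerivWithinAt_metricCoeff {x₀ : M} {y : Model n}
    (hy : y ∈ (extChartAt (𝓡∂ n) x₀).target) :
    HasFDerivWithinAt (g.metricCoeff x₀) (g.metricDeriv x₀ y) (range (𝓡∂ n)) y :=
  ((g.contDiffWithinAt_metricCoeff hy).differentiableWithinAt (by simp)).hasFDerivWithinAt

theorem contDiffOn_metricDeriv (x₀ : M) :
    ContDiffOn ℝ ∞ (g.metricDeriv x₀) (extChartAt (𝓡∂ n) x₀).target := by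
  intro y hy
  have := (g.contDiffWithinAt_metricCoeff hy).fderivWithin_right (m := ∞) (𝓡∂ n).uniqueDiffOn
    (by simp) (extChartAt_target_subset_range x₀ hy)
  exact this.mono (extChartAt_target_subset_range x₀)

theorem metricDerivInChart_eq {x₀ : M} {y : Model n} (hy : y ∈ (extChartAt (𝓡∂ n) x₀).target)
    (w a b : Model n) : g.metricDerivInChart x₀ y w a b = g.metricDeriv x₀ y w a b := by
  have hev : (fun z ↦ g.metricInChart x₀ z a b) =ᶠ[𝓝[range (𝓡∂ n)] y]
      fun z ↦ g.metricCoeff x₀ z a b := by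
    filter_upwards [extChartAt_target_mem_nhdsWithin_of_mem hy] with z hz
    exact g.metricInChart_eq hz a b
  have hu : UniqueDiffWithinAt ℝ (range (𝓡∂ n)) y :=
    (𝓡∂ n).uniqueDiffOn _ (extChartAt_target_subset_range x₀ hy)
  have h := ((g.hasFDerivWithinAt_metricCoeff hy).clm_apply
    (hasFDerivWithinAt_const a y _)).clm_apply (hasFDerivWithinAt_const b y _)
  rw [metricDerivInChart, hev.fderivWithin_eq (g.metricInChart_eq hy a b), h.fderivWithin hu]
  simp

/-- The covector `w ↦ Γ(v, v, w)` at the position and velocity `p = (y, v)`. -/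
def christoffelForm (x₀ : M) (p : Phase n) : Model n →L[ℝ] ℝ :=
  g.metricDeriv x₀ p.1 p.2 p.2 - (1 / 2 : ℝ) • (((g.metricDeriv x₀ p.1).flip p.2).flip p.2)

theorem christoffelForm_apply (x₀ : M) (p : Phase n) (w : Model n) :
    g.christoffelForm x₀ p w =
      g.metricDeriv x₀ p.1 p.2 p.2 w - (1 / 2 : ℝ) * g.metricDeriv x₀ p.1 w p.2 p.2 := rfl

theorem christoffelInChart_eq {x₀ : M} {y : Model n} (hy : y ∈ (extChartAt (𝓡∂ n) x₀).target)
    (v w : Model n) : g.christoffelInChart x₀ y v v w = g.christoffelForm x₀ (y, v) w := by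
  rw [christoffelInChart, g.metricDerivInChart_eq hy, g.metricDerivInChart_eq hy,
    christoffelForm_apply]
  ring

theorem contDiffOn_christoffelForm (x₀ : M) :
    ContDiffOn ℝ ∞ (g.christoffelForm x₀) ((extChartAt (𝓡∂ n) x₀).target ×ˢ univ) := by
  rw [contDiffOn_clm_apply]
  intro w
  have h1 : ContDiffOn ℝ ∞ (fun p : Phase n ↦ g.metricDeriv x₀ p.1)
      ((extChartAt (𝓡∂ n) x₀).target ×ˢ univ) :=
    (g.contDiffOn_metricDeriv x₀).comp contDiff_fst.contDiffOn fun p hp ↦ hp.1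
  have h2 : ContDiffOn ℝ ∞ (fun p : Phase n ↦ p.2)
      ((extChartAt (𝓡∂ n) x₀).target ×ˢ univ) := contDiff_snd.contDiffOn
  simp only [christoffelForm_apply]
  exact (((h1.clm_apply h2).clm_apply h2).clm_apply contDiffOn_const).sub
    (contDiffOn_const.mul (((h1.clm_apply contDiffOn_const).clm_apply h2).clm_apply h2))

/-- The vector field on phase space, in the chart around `x₀`, whose integral curves are
the geodesics. -/
def geodesicField (x₀ : M) (p : Phase n) : Phase n :=
  (p.2, -(g.metricCoeff x₀ p.1).inverse (g.christoffelForm x₀ p))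

theorem contDiffOn_geodesicField (x₀ : M) :
    ContDiffOn ℝ ∞ (g.geodesicField x₀) ((extChartAt (𝓡∂ n) x₀).target ×ˢ univ) := by
  refine contDiff_snd.contDiffOn.prodMk (ContDiffOn.neg (ContDiffOn.clm_apply ?_
    (g.contDiffOn_christoffelForm x₀)))
  intro p hp
  obtain ⟨e, he⟩ := g.exists_metricCoeff_equiv hp.1
  have h1 : ContDiffAt ℝ ∞ ContinuousLinearMap.inverse (g.metricCoeff x₀ p.1) := by
    rw [← he]; exact contDiffAt_map_inverse e
  exact h1.comp_contDiffWithinAt p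
    ((g.contDiffOn_metricCoeff x₀).comp contDiff_fst.contDiffOn (fun p hp ↦ hp.1) p hp)

theorem geodesicField_snd_iff {x₀ : M} {p : Phase n} (hp : p.1 ∈ (extChartAt (𝓡∂ n) x₀).target)
    {a : Model n} : a = (g.geodesicField x₀ p).2 ↔
      ∀ w, g.metricCoeff x₀ p.1 a w + g.christoffelForm x₀ p w = 0 := by
  obtain ⟨e, he⟩ := g.exists_metricCoeff_equiv hp
  have : (g.geodesicField x₀ p).2 = - e.symm (g.christoffelForm x₀ p) := by
    rw [geodesicField, ← he, ContinuousLinearMap.inverse_equiv]; rfl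
  rw [this, ← he]
  constructor
  · rintro rfl w
    simp
  · intro h
    rw [← map_neg, ← e.symm_apply_apply a]
    congr 1
    ext w
    exact eq_neg_of_add_eq_zero_left (h w)

theorem isGeodesicOn_iff {V : ℝ → TangentBundle (𝓡∂ n) M} {J : Set ℝ} :
    g.IsGeodesicOn V J ↔ J.OrdConnected ∧ ContinuousOn V J ∧ ∀ t ∈ J,
      HasDerivWithinAt (fun s ↦ bundleChart (V t).proj (V s))
        (g.geodesicField (V t).proj (bundleChart (V t).proj (V t))) J t := by
  refine and_congr_right fun _ ↦ and_congr_right fun _ ↦ forall₂_congr fun t _ ↦ ?_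
  have hy : extChartAt (𝓡∂ n) (V t).proj (V t).proj ∈ (extChartAt (𝓡∂ n) (V t).proj).target :=
    mem_extChartAt_target _
  simp only [g.metricInChart_eq hy, g.christoffelInChart_eq hy]
  have key := fun a ↦ g.geodesicField_snd_iff (x₀ := (V t).proj)
    (p := bundleChart (V t).proj (V t)) (by rw [bundleChart_apply]; exact hy) (a := a)
  constructor
  · rintro ⟨h1, a, h2, h3⟩
    have ha : a = (g.geodesicField (V t).proj (bundleChart (V t).proj (V t))).2 :=
      (key a).2 (by rw [bundleChart_apply]; exact h3)
    rw [ha] at h2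
    have h4 := h1.prodMk h2
    have h5 : (tangentCoord (V t).proj (V t),
        (g.geodesicField (V t).proj (bundleChart (V t).proj (V t))).2) =
        g.geodesicField (V t).proj (bundleChart (V t).proj (V t)) := by
      rw [bundleChart_apply]; rfl
    rw [h5] at h4
    simpa only [← bundleChart_apply] using h4
  · intro h
    have h1 := h.fst
    have h2 := h.snd
    simp only [bundleChart_apply] at h1 h2
    refine ⟨h1, _, h2, ?_⟩
    have := (key _).1 rfl
    rwa [bundleChart_apply] at this

/-- The geodesic equation does not depend on the chart. -/
theorem hasDerivWithinAt_bundleChart_change {V : ℝ → TangentBundle (𝓡∂ n) M} {J : Set ℝ} {t : ℝ}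
    {x₀ x₁ : M} (hV : ContinuousWithinAt V J t)
    (h₀ : (V t).proj ∈ (extChartAt (𝓡∂ n) x₀).source)
    (h₁ : (V t).proj ∈ (extChartAt (𝓡∂ n) x₁).source) (ht : t ∈ J)
    (h : HasDerivWithinAt (fun s ↦ bundleChart x₀ (V s))
      (g.geodesicField x₀ (bundleChart x₀ (V t))) J t) :
    HasDerivWithinAt (fun s ↦ bundleChart x₁ (V s))
      (g.geodesicField x₁ (bundleChart x₁ (V t))) J t := by
  set S : Set (Model n) := range (𝓡∂ n) with hS
  set φ : Model n → Model n := extChartAt (𝓡∂ n) x₁ ∘ (extChartAt (𝓡∂ n) x₀).symm with hφ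
  set ψ := fderivWithin ℝ φ S with hψ
  set y₀ := extChartAt (𝓡∂ n) x₀ (V t).proj with hy₀
  set v₀ := tangentCoord x₀ (V t) with hv₀
  have hyT : y₀ ∈ (extChartAt (𝓡∂ n) x₀).target := (extChartAt (𝓡∂ n) x₀).map_source h₀
  have hyS : y₀ ∈ S := extChartAt_target_subset_range x₀ hyT
  have hU : UniqueDiffOn ℝ S := (𝓡∂ n).uniqueDiffOn
  have hφy : φ y₀ = extChartAt (𝓡∂ n) x₁ (V t).proj := by
    rw [hφ, Function.comp_apply, hy₀, (extChartAt (𝓡∂ n) x₀).left_inv h₀]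
  have hyT₁ : φ y₀ ∈ (extChartAt (𝓡∂ n) x₁).target := by
    rw [hφy]; exact (extChartAt (𝓡∂ n) x₁).map_source h₁
  have hc : ContDiffWithinAt ℝ ∞ φ S y₀ := by
    refine contDiffWithinAt_ext_coord_change x₁ x₀ ?_
    rw [PartialEquiv.trans_source'', PartialEquiv.symm_symm, PartialEquiv.symm_target]
    exact mem_image_of_mem _ ⟨h₀, h₁⟩
  have hφ' : HasFDerivWithinAt φ (ψ y₀) S y₀ :=
    (hc.differentiableWithinAt (by simp)).hasFDerivWithinAt
  have hcψ : ContDiffWithinAt ℝ ∞ ψ S y₀ := hc.fderivWithin_right hU (by simp) hyS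
  set ψ' := fderivWithin ℝ ψ S y₀ with hψ'
  have hψ'd : HasFDerivWithinAt ψ ψ' S y₀ :=
    (hcψ.differentiableWithinAt (by simp)).hasFDerivWithinAt
  have hsymm : ∀ a b, ψ' a b = ψ' b a := by
    have hcl : y₀ ∈ closure (interior S) := by
      have := (𝓡∂ n).range_subset_closure_interior hyS
      exact this
    exact fun a b ↦ (hc.isSymmSndFDerivWithinAt (by
      rw [minSmoothness_of_isRCLikeNormedField]; exact WithTop.coe_le_coe.2 le_top) hU hcl hyS) a b
  have hφS : MapsTo φ S S := fun y _ ↦ by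
    rw [hφ, Function.comp_apply, extChartAt_coe]; exact mem_range_self _
  -- the change of the metric coefficients
  have hsrc : ∀ᶠ y in 𝓝[S] y₀, y ∈ (extChartAt (𝓡∂ n) x₀).target ∧
      (extChartAt (𝓡∂ n) x₀).symm y ∈ (extChartAt (𝓡∂ n) x₁).source := by
    refine Filter.Eventually.and (extChartAt_target_mem_nhdsWithin_of_mem hyT) ?_
    have h3 : ContinuousWithinAt (extChartAt (𝓡∂ n) x₀).symm S y₀ :=
      (continuousAt_extChartAt_symm'' hyT).continuousWithinAt
    refine h3.eventually ((isOpen_extChartAt_source x₁).mem_nhds ?_)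
    rw [hy₀, (extChartAt (𝓡∂ n) x₀).left_inv h₀]; exact h₁
  have hG : ∀ a b, (fun y ↦ g.metricCoeff x₀ y a b) =ᶠ[𝓝[S] y₀]
      fun y ↦ g.metricCoeff x₁ (φ y) (ψ y a) (ψ y b) := by
    intro a b
    filter_upwards [hsrc] with y hy
    have hs := (extChartAt (𝓡∂ n) x₀).map_target hy.1
    set x := (extChartAt (𝓡∂ n) x₀).symm y with hx
    have hxy : extChartAt (𝓡∂ n) x₀ x = y := (extChartAt (𝓡∂ n) x₀).right_inv hy.1
    have hA : ∀ a : Model n, ψ y a = tangentCoord x₁ (⟨x, (trivializationAt (Model n)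
        (TangentSpace (𝓡∂ n) (M := M)) x₀).symmL ℝ x a⟩ : TangentBundle (𝓡∂ n) M) := by
      intro a
      rw [tangentCoord_change (x₀ := x₀) hs hy.2, tangentCoord_symm hs, hxy]
    rw [hA, hA]
    have h4 := g.metricCoeff_tangentCoord (x₀ := x₁)
      (v := (⟨x, (trivializationAt (Model n)
        (TangentSpace (𝓡∂ n) (M := M)) x₀).symmL ℝ x a⟩ : TangentBundle (𝓡∂ n) M))
      (w := (⟨x, (trivializationAt (Model n)
        (TangentSpace (𝓡∂ n) (M := M)) x₀).symmL ℝ x b⟩ : TangentBundle (𝓡∂ n) M)) hy.2 rfl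
    exact h4.symm
  have hG₀ : ∀ a b, g.metricCoeff x₀ y₀ a b = g.metricCoeff x₁ (φ y₀) (ψ y₀ a) (ψ y₀ b) :=
    fun a b ↦ (hG a b).self_of_nhdsWithin hyS
  have hDG : ∀ a b w, g.metricDeriv x₀ y₀ w a b =
      g.metricDeriv x₁ (φ y₀) (ψ y₀ w) (ψ y₀ a) (ψ y₀ b) +
        g.metricCoeff x₁ (φ y₀) (ψ' w a) (ψ y₀ b) + g.metricCoeff x₁ (φ y₀) (ψ y₀ a) (ψ' w b) := by
    intro a b w
    have hl := ((g.hasFDerivWithinAt_metricCoeff hyT).clm_apply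
      (hasFDerivWithinAt_const a y₀ _)).clm_apply (hasFDerivWithinAt_const b y₀ _)
    have hr := (((g.hasFDerivWithinAt_metricCoeff hyT₁).comp y₀ hφ' hφS).clm_apply
      (hψ'd.clm_apply (hasFDerivWithinAt_const a y₀ _))).clm_apply
      (hψ'd.clm_apply (hasFDerivWithinAt_const b y₀ _))
    have hr' := hr.congr_of_eventuallyEq (hG a b) (hG₀ a b)
    have := congrArg (fun A ↦ A w) ((hU y₀ hyS).eq hl hr')
    simp at this
    rw [this]
    ring
  -- the equation at the point
  have hp₀ : bundleChart x₀ (V t) = (y₀, v₀) := bundleChart_apply _ _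
  have hv₁ : tangentCoord x₁ (V t) = ψ y₀ v₀ := tangentCoord_change h₀ h₁
  have hp₁ : bundleChart x₁ (V t) = (φ y₀, ψ y₀ v₀) := by
    rw [bundleChart_apply, hφy, hv₁]
  rw [hp₀] at h
  set a₀ := (g.geodesicField x₀ (y₀, v₀)).2 with ha₀
  have hEL := (g.geodesicField_snd_iff (x₀ := x₀) (p := (y₀, v₀)) hyT).1 ha₀
  have ha₁ : ψ' v₀ v₀ + ψ y₀ a₀ = (g.geodesicField x₁ (φ y₀, ψ y₀ v₀)).2 := by
    refine (g.geodesicField_snd_iff (p := (φ y₀, ψ y₀ v₀)) hyT₁).2 fun w₁ ↦ ?_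
    obtain ⟨w, rfl⟩ : ∃ w, ψ y₀ w = w₁ := by
      refine ⟨tangentCoord x₀ (⟨(V t).proj, (trivializationAt (Model n)
        (TangentSpace (𝓡∂ n) (M := M)) x₁).symmL ℝ (V t).proj w₁⟩ : TangentBundle (𝓡∂ n) M), ?_⟩
      have := tangentCoord_change (x₀ := x₀) (x₁ := x₁) (v := (⟨(V t).proj, (trivializationAt
        (Model n) (TangentSpace (𝓡∂ n) (M := M)) x₁).symmL ℝ (V t).proj w₁⟩ :
        TangentBundle (𝓡∂ n) M)) h₀ h₁
      rw [tangentCoord_symm h₁] at this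
      exact this.symm
    have e := hEL w
    rw [christoffelForm_apply] at e ⊢
    dsimp only at e ⊢
    rw [hG₀, hDG v₀ w v₀, hDG v₀ v₀ w, hsymm w v₀] at e
    rw [map_add, add_apply]
    have e2 := g.metricCoeff_symm x₁ (φ y₀) (ψ y₀ v₀) (ψ' v₀ w)
    linarith
  -- the derivative of the curve in the second chart
  have hx := h.fst
  have hv := h.snd
  simp only [bundleChart_apply] at hx hv
  have hxS : MapsTo (fun s ↦ extChartAt (𝓡∂ n) x₀ (V s).proj) J S := fun s _ ↦ by
    rw [extChartAt_coe]; exact mem_range_self _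
  have hd₁ := HasFDerivWithinAt.comp_hasDerivWithinAt t hφ' hx hxS
  have hd₂ := (HasFDerivWithinAt.comp_hasDerivWithinAt t hψ'd hx hxS).clm_apply hv
  have hd := hd₁.prodMk hd₂
  rw [hp₁]
  have hval : (ψ y₀ (g.geodesicField x₀ (y₀, v₀)).1, ψ' (g.geodesicField x₀ (y₀, v₀)).1
      (tangentCoord x₀ (V t)) + ψ y₀ (g.geodesicField x₀ (y₀, v₀)).2) =
      g.geodesicField x₁ (φ y₀, ψ y₀ v₀) := by
    refine Prod.ext rfl ?_
    rw [← ha₁]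
    rfl
  have hev : (fun s ↦ bundleChart x₁ (V s)) =ᶠ[𝓝[J] t] fun s ↦
      ((φ ∘ fun s ↦ extChartAt (𝓡∂ n) x₀ (V s).proj) s,
        (ψ ∘ fun s ↦ extChartAt (𝓡∂ n) x₀ (V s).proj) s (tangentCoord x₀ (V s))) := by
    have hVp : ContinuousWithinAt (fun s ↦ (V s).proj) J t :=
      continuous_proj.continuousAt.comp_continuousWithinAt hV
    filter_upwards [hVp.eventually ((isOpen_extChartAt_source x₀).mem_nhds h₀),
      hVp.eventually ((isOpen_extChartAt_source x₁).mem_nhds h₁)] with s hs₀ hs₁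
    rw [bundleChart_apply, tangentCoord_change hs₀ hs₁]
    simp only [Function.comp_apply, hφ, (extChartAt (𝓡∂ n) x₀).left_inv hs₀]
    rfl
  refine HasDerivWithinAt.congr_of_eventuallyEq ?_ hev (hev.self_of_nhdsWithin ht)
  rw [← hval]
  exact hd

theorem IsGeodesicOn.hasDerivWithinAt {g : TimeOrientedLorentzianMetric n M}
    {V : ℝ → TangentBundle (𝓡∂ n) M} {J : Set ℝ} (hV : g.IsGeodesicOn V J) {t : ℝ} (ht : t ∈ J)
    {x₀ : M} (h₀ : (V t).proj ∈ (extChartAt (𝓡∂ n) x₀).source) :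
    HasDerivWithinAt (fun s ↦ bundleChart x₀ (V s))
      (g.geodesicField x₀ (bundleChart x₀ (V t))) J t := by
  rw [isGeodesicOn_iff] at hV
  exact g.hasDerivWithinAt_bundleChart_change (hV.2.1 t ht) (mem_extChartAt_source _) h₀ ht
    (hV.2.2 t ht)

theorem isGeodesicOn_of_hasDerivWithinAt {V : ℝ → TangentBundle (𝓡∂ n) M} {J : Set ℝ}
    (hJ : J.OrdConnected) (hV : ContinuousOn V J)
    (h : ∀ t ∈ J, ∃ x₀ : M, (V t).proj ∈ (extChartAt (𝓡∂ n) x₀).source ∧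
      HasDerivWithinAt (fun s ↦ bundleChart x₀ (V s))
        (g.geodesicField x₀ (bundleChart x₀ (V t))) J t) : g.IsGeodesicOn V J := by
  rw [isGeodesicOn_iff]
  refine ⟨hJ, hV, fun t ht ↦ ?_⟩
  obtain ⟨x₀, h₀, hd⟩ := h t ht
  exact g.hasDerivWithinAt_bundleChart_change (hV t ht) h₀ (mem_extChartAt_source _) ht hd

end TimeOrientedLorentzianMetric

section Retraction

variable {n : ℕ} [NeZero n]

/-- The retraction onto the half space which replaces a negative coordinate number `0` by `0`. -/
def halfProj (x : Model n) : Model n := (𝓡∂ n) ((𝓡∂ n).symm x)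

theorem halfProj_mem (x : Model n) : halfProj x ∈ range (𝓡∂ n) := mem_range_self _

theorem halfProj_eq {x : Model n} (hx : 0 ≤ x 0) : halfProj x = x := by
  apply (𝓡∂ n).right_inv
  rw [range_model]; exact hx

theorem halfProj_apply (x : Model n) (i : Fin n) :
    halfProj x i = if i = 0 then max (x 0) 0 else x i := by
  change (Function.update (fun i ↦ x i) 0 (max (x 0) 0)) i = _
  rw [Function.update_apply]

theorem dist_halfProj_le (x y : Model n) : dist (halfProj x) (halfProj y) ≤ dist x y := by
  rw [EuclideanSpace.dist_eq, EuclideanSpace.dist_eq]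
  apply Real.sqrt_le_sqrt
  refine Finset.sum_le_sum fun i _ ↦ ?_
  refine pow_le_pow_left₀ dist_nonneg ?_ 2
  rw [halfProj_apply, halfProj_apply]
  split_ifs with h
  · subst h
    rw [Real.dist_eq, Real.dist_eq]
    exact (abs_max_sub_max_le_abs _ _ _)
  · exact le_rfl

end Retraction

section ODE

variable {X : Type*} [NormedAddCommGroup X] [NormedSpace ℝ X]

/-- A curve which starts near the centre of a ball and has bounded velocity in this ball stays in
the ball for some time. -/
theorem dist_le_of_deriv_bound {y y' : ℝ → X} {p : X} {R B δ a : ℝ} (hB : B * δ < R / 2)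
    (hB0 : 0 ≤ B) (ha : a ≤ δ) (hδ : 0 < δ)
    (hy : ∀ t ∈ Icc 0 a, HasDerivWithinAt y (y' t) (Icc 0 a) t)
    (hb : ∀ t ∈ Icc 0 a, dist (y t) p ≤ R → ‖y' t‖ ≤ B) (h0 : dist (y 0) p ≤ R / 2) :
    ∀ t ∈ Icc 0 a, dist (y t) p ≤ R / 2 + R / 2 / δ * t := by
  have hCB : B < R / 2 / δ := by rwa [lt_div_iff₀ hδ]
  intro t ht
  rw [dist_eq_norm]
  refine image_norm_le_of_norm_deriv_right_lt_deriv_boundary (f := fun t ↦ y t - p)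
    (f' := y') (B := fun t ↦ R / 2 + R / 2 / δ * t) (B' := fun _ ↦ R / 2 / δ) (a := 0) (b := a) ?_ ?_ ?_ ?_ ?_ ht
  · exact (HasDerivWithinAt.continuousOn hy).sub continuousOn_const
  · intro s hs
    exact (((hy s ⟨hs.1, hs.2.le⟩).sub_const p).mono_of_mem_nhdsWithin
      (Icc_mem_nhdsGE_of_mem hs))
  · simpa [dist_eq_norm] using h0
  · intro s
    simpa using ((hasDerivAt_id s).const_mul (R / 2 / δ)).const_add (R / 2)
  · intro s hs hse
    refine (hb s ⟨hs.1, hs.2.le⟩ ?_).trans_lt hCB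
    rw [dist_eq_norm, hse]
    have : R / 2 / δ * s ≤ R / 2 / δ * δ :=
      mul_le_mul_of_nonneg_left (hs.2.le.trans ha) (hB0.trans hCB.le)
    rw [div_mul_cancel₀ _ hδ.ne'] at this
    linarith

theorem exists_integralCurve [CompleteSpace X] {f : X → X} {p : X} {R B δ : ℝ} {K : NNReal}
    (hR : 0 < R) (hδ : 0 < δ)
    (hB : B * δ < R / 2) (hB0 : 0 ≤ B) (hL : LipschitzOnWith K f (Metric.closedBall p R))
    (hb : ∀ q ∈ Metric.closedBall p R, ‖f q‖ ≤ B) {z : X} (hz : z ∈ Metric.closedBall p (R / 2)) :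
    ∃ y : ℝ → X, y 0 = z ∧ ∀ t ∈ Icc 0 δ, HasDerivWithinAt y (f (y t)) (Icc 0 δ) t ∧
      y t ∈ Metric.closedBall p R := by
  have hPL : IsPicardLindelof (fun _ : ℝ ↦ f) (tmin := 0) (tmax := δ)
      ⟨0, left_mem_Icc.2 hδ.le⟩ p ⟨R, hR.le⟩ ⟨R / 2, by positivity⟩ ⟨B, hB0⟩ K := by
    refine ⟨fun _ _ ↦ hL, fun _ _ ↦ continuousOn_const, fun _ _ ↦ hb, ?_⟩
    change B * max (δ - 0) (0 - 0) ≤ R - R / 2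
    rw [sub_zero, sub_zero, max_eq_left hδ.le]
    linarith
  obtain ⟨y, hy0, hy⟩ := hPL.exists_eq_forall_mem_Icc_hasDerivWithinAt hz
  refine ⟨y, hy0, fun t ht ↦ ⟨hy t ht, ?_⟩⟩
  have := dist_le_of_deriv_bound (a := δ) hB hB0 le_rfl hδ hy (fun t _ h ↦ hb _ h)
    (by have h1 : y 0 = z := hy0
        rw [h1]; exact hz) t ht
  rw [Metric.mem_closedBall]
  have h2 : R / 2 / δ * t ≤ R / 2 / δ * δ := mul_le_mul_of_nonneg_left ht.2 (by positivity)
  rw [div_mul_cancel₀ _ hδ.ne'] at h2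
  linarith

end ODE

section T2

variable {n : ℕ} [NeZero n] {M : Type*} [TopologicalSpace M]
  [ChartedSpace (EuclideanHalfSpace n) M] [IsManifold (𝓡∂ n) ∞ M]

instance [T2Space M] : T2Space (TangentBundle (𝓡∂ n) M) := by
  refine ⟨fun v w hvw ↦ ?_⟩
  by_cases h : v.proj = w.proj
  · have hv := mem_bundleChart_source_self v
    have hw : w ∈ (bundleChart v.proj : PartialEquiv (TangentBundle (𝓡∂ n) M) _).source := by
      rw [h]; exact mem_bundleChart_source_self w
    have hne : bundleChart v.proj v ≠ bundleChart v.proj w :=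
      fun he ↦ hvw ((bundleChart v.proj).injOn hv hw he)
    obtain ⟨A, B, hA, hB, hvA, hwB, hd⟩ := t2_separation hne
    refine ⟨_, _, (continuousOn_bundleChart v.proj).isOpen_inter_preimage
      (isOpen_bundleChart_source _) hA, (continuousOn_bundleChart v.proj).isOpen_inter_preimage
      (isOpen_bundleChart_source _) hB, ⟨hv, hvA⟩, ⟨hw, hwB⟩, ?_⟩
    rw [Set.disjoint_left]
    rintro u ⟨-, hu⟩ ⟨-, hu'⟩
    exact Set.disjoint_left.1 hd hu hu'
  · obtain ⟨A, B, hA, hB, hvA, hwB, hd⟩ := t2_separation h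
    exact ⟨_, _, hA.preimage continuous_proj, hB.preimage continuous_proj, hvA, hwB,
      hd.preimage _⟩

theorem isCompact_bundleChart_symm_image (x₀ : M) {C : Set (Phase n)} (hC : IsCompact C)
    (h : ∀ p ∈ C, p.1 ∈ (extChartAt (𝓡∂ n) x₀).target) :
    IsCompact ((bundleChart x₀ : PartialEquiv (TangentBundle (𝓡∂ n) M) _).symm '' C) :=
  hC.image_of_continuousOn ((continuousOn_bundleChart_symm x₀).mono fun p hp ↦ by
    rw [bundleChart_target]; exact ⟨h p hp, trivial⟩)

end T2

namespace TimeOrientedLorentzianMetric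

variable {n : ℕ} [NeZero n] {M : Type*} [TopologicalSpace M]
  [ChartedSpace (EuclideanHalfSpace n) M] [IsManifold (𝓡∂ n) ∞ M]
  (g : TimeOrientedLorentzianMetric n M)

/-- The geodesic vector field in a chart, extended beyond the half space. -/
def extField (x₀ : M) (p : Phase n) : Phase n := g.geodesicField x₀ (halfProj p.1, p.2)

theorem extField_eq {x₀ : M} {p : Phase n} (hp : 0 ≤ p.1 0) :
    g.extField x₀ p = g.geodesicField x₀ p := by
  rw [extField, halfProj_eq hp]

theorem extField_fst (x₀ : M) (p : Phase n) : (g.extField x₀ p).1 = p.2 := rfl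

theorem bundleChart_nonneg (x₀ : M) (v : TangentBundle (𝓡∂ n) M) : 0 ≤ (bundleChart x₀ v).1 0 := by
  rw [bundleChart_apply]
  have : extChartAt (𝓡∂ n) x₀ v.proj ∈ range (𝓡∂ n) := by
    rw [extChartAt_coe]; exact mem_range_self _
  rwa [range_model] at this

/-- A neighbourhood of a tangent vector, in the chart around its base point, in which the geodesic
flow is controlled for some time. -/
structure FlowBox (z₀ : TangentBundle (𝓡∂ n) M) where
  R : ℝ
  δ : ℝ
  B : ℝ
  K : NNReal
  R_pos : 0 < R
  δ_pos : 0 < δ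
  B_nonneg : 0 ≤ B
  B_mul_lt : B * δ < R / 2
  mem_target : ∀ p ∈ Metric.closedBall (bundleChart z₀.proj z₀) R, 0 ≤ p.1 0 →
    p.1 ∈ (extChartAt (𝓡∂ n) z₀.proj).target
  lipschitz : LipschitzOnWith K (g.extField z₀.proj)
    (Metric.closedBall (bundleChart z₀.proj z₀) R)
  bound : ∀ p ∈ Metric.closedBall (bundleChart z₀.proj z₀) R, ‖g.extField z₀.proj p‖ ≤ B

theorem nonempty_flowBox (z₀ : TangentBundle (𝓡∂ n) M) : Nonempty (g.FlowBox z₀) := by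
  set x₀ := z₀.proj with hx₀
  set p₀ := bundleChart x₀ z₀ with hp₀
  have hT : p₀.1 ∈ (extChartAt (𝓡∂ n) x₀).target := by
    rw [hp₀, bundleChart_apply]; exact mem_extChartAt_target _
  have hconv : Convex ℝ ((range (𝓡∂ n)) ×ˢ (univ : Set (Model n))) :=
    ((𝓡∂ n).convex_range).prod convex_univ
  have htm : (extChartAt (𝓡∂ n) x₀).target ×ˢ (univ : Set (Model n)) ∈
      𝓝[range (𝓡∂ n) ×ˢ univ] p₀ := by
    rw [← Prod.mk.eta (p := p₀), nhdsWithin_prod_eq]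
    exact prod_mem_prod (extChartAt_target_mem_nhdsWithin_of_mem hT) univ_mem
  have hcd : ContDiffWithinAt ℝ 1 (g.geodesicField x₀) (range (𝓡∂ n) ×ˢ univ) p₀ :=
    ((g.contDiffOn_geodesicField x₀ p₀ ⟨hT, trivial⟩).mono_of_mem_nhdsWithin htm).of_le
      (WithTop.coe_le_coe.2 le_top)
  obtain ⟨K, t, ht, hL⟩ := hcd.exists_lipschitzOnWith hconv
  obtain ⟨ε, hε, hball⟩ := Metric.mem_nhdsWithin_iff.1 (inter_mem ht htm)
  have hproj : ∀ p ∈ Metric.closedBall p₀ (ε / 2), (halfProj p.1, p.2) ∈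
      t ∩ (extChartAt (𝓡∂ n) x₀).target ×ˢ (univ : Set (Model n)) := by
    intro p hp
    refine hball ⟨?_, halfProj_mem _, trivial⟩
    rw [Metric.mem_closedBall, Prod.dist_eq] at hp
    rw [Metric.mem_ball, Prod.dist_eq]
    refine lt_of_le_of_lt (max_le_max ?_ le_rfl) (hp.trans_lt (half_lt_self hε))
    conv_lhs => rw [← halfProj_eq (coord_zero_nonneg hT)]
    exact dist_halfProj_le _ _
  have hLip : LipschitzOnWith K (g.extField x₀) (Metric.closedBall p₀ (ε / 2)) := by
    refine LipschitzOnWith.of_dist_le_mul fun p hp q hq ↦ ?_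
    refine (hL.dist_le_mul _ (hproj p hp).1 _ (hproj q hq).1).trans ?_
    refine mul_le_mul_of_nonneg_left ?_ K.2
    rw [Prod.dist_eq, Prod.dist_eq]
    exact max_le_max (dist_halfProj_le _ _) le_rfl
  set B := ‖g.extField x₀ p₀‖ + K * (ε / 2) with hB
  have hB0 : 0 ≤ B := by positivity
  refine ⟨⟨ε / 2, ε / 2 / 2 / (B + 1), B, K, by positivity, by positivity, hB0, ?_, ?_, hLip, ?_⟩⟩
  · rw [mul_div_assoc', div_lt_iff₀ (by positivity)]
    nlinarith
  · intro p hp h0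
    have := (hproj p hp).2.1
    rwa [halfProj_eq h0] at this
  · intro p hp
    have h1 := hLip.dist_le_mul p hp p₀ (Metric.mem_closedBall_self (by positivity))
    rw [dist_eq_norm] at h1
    have h2 := norm_sub_norm_le (g.extField x₀ p) (g.extField x₀ p₀)
    have h3 : (K : ℝ) * dist p p₀ ≤ K * (ε / 2) := mul_le_mul_of_nonneg_left hp K.2
    linarith

variable {g}

theorem IsGeodesicOn.mono {V : ℝ → TangentBundle (𝓡∂ n) M} {J J' : Set ℝ}
    (hV : g.IsGeodesicOn V J) (h : J' ⊆ J) (hJ' : J'.OrdConnected) : g.IsGeodesicOn V J' := by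
  rw [isGeodesicOn_iff] at hV ⊢
  exact ⟨hJ', hV.2.1.mono h, fun t ht ↦ (hV.2.2 t (h ht)).mono h⟩

theorem IsGeodesicOn.congr {V W : ℝ → TangentBundle (𝓡∂ n) M} {J : Set ℝ}
    (hV : g.IsGeodesicOn V J) (h : EqOn W V J) : g.IsGeodesicOn W J := by
  rw [isGeodesicOn_iff] at hV ⊢
  refine ⟨hV.1, hV.2.1.congr h, fun t ht ↦ ?_⟩
  rw [h ht]
  exact (hV.2.2 t ht).congr (fun s hs ↦ by rw [h hs]) (by rw [h ht])

namespace FlowBox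

variable {z₀ : TangentBundle (𝓡∂ n) M} (b : g.FlowBox z₀)

/-- The tangent vectors for which the flow is controlled. -/
def core : Set (TangentBundle (𝓡∂ n) M) :=
  {z | z ∈ (bundleChart z₀.proj : PartialEquiv (TangentBundle (𝓡∂ n) M) _).source ∧
    bundleChart z₀.proj z ∈ Metric.closedBall (bundleChart z₀.proj z₀) (b.R / 2)}

theorem core_mem_nhds {z : TangentBundle (𝓡∂ n) M}
    (hz : z ∈ (bundleChart z₀.proj : PartialEquiv (TangentBundle (𝓡∂ n) M) _).source)
    (h : dist (bundleChart z₀.proj z) (bundleChart z₀.proj z₀) < b.R / 2) : b.core ∈ 𝓝 z := by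
  have h1 := (continuousAt_bundleChart (mem_bundleChart_source.1 hz)).preimage_mem_nhds
    (Metric.isOpen_ball.mem_nhds (Metric.mem_ball.2 h))
  filter_upwards [(isOpen_bundleChart_source z₀.proj).mem_nhds hz, h1] with w hw hw'
  exact ⟨hw, Metric.ball_subset_closedBall hw'⟩

theorem core_mem_nhds_self : b.core ∈ 𝓝 z₀ :=
  b.core_mem_nhds (mem_bundleChart_source_self _) (by rw [dist_self]; linarith [b.R_pos])

theorem exists_solution {p : Phase n}
    (hp : p ∈ Metric.closedBall (bundleChart z₀.proj z₀) (b.R / 2)) :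
    ∃ y : ℝ → Phase n, y 0 = p ∧ ∀ t ∈ Icc 0 b.δ,
      HasDerivWithinAt y (g.extField z₀.proj (y t)) (Icc 0 b.δ) t ∧
        y t ∈ Metric.closedBall (bundleChart z₀.proj z₀) b.R :=
  exists_integralCurve b.R_pos b.δ_pos b.B_mul_lt b.B_nonneg b.lipschitz b.bound hp

/-- A geodesic which starts in the core stays in the chart for some time. -/
theorem geodesic_mem [T2Space M] {V : ℝ → TangentBundle (𝓡∂ n) M} {a : ℝ} (ha : a ≤ b.δ)
    (hV : g.IsGeodesicOn V (Icc 0 a)) (h0 : V 0 ∈ b.core) :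
    ∀ t ∈ Icc 0 a,
      V t ∈ (bundleChart z₀.proj : PartialEquiv (TangentBundle (𝓡∂ n) M) _).source ∧
      bundleChart z₀.proj (V t) ∈ Metric.closedBall (bundleChart z₀.proj z₀) b.R := by
  set x₀ := z₀.proj
  set p₀ := bundleChart x₀ z₀
  -- control on intervals on which the curve stays in the chart
  have key : ∀ c ≤ a, (∀ t ∈ Icc 0 c, V t ∈ (bundleChart x₀ : PartialEquiv
      (TangentBundle (𝓡∂ n) M) _).source) → ∀ t ∈ Icc 0 c,
      dist (bundleChart x₀ (V t)) p₀ ≤ b.R / 2 + b.R / 2 / b.δ * t := by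
    intro c hc hs
    refine dist_le_of_deriv_bound b.B_mul_lt b.B_nonneg (hc.trans ha) b.δ_pos
      (y' := fun t ↦ g.geodesicField x₀ (bundleChart x₀ (V t))) ?_ ?_ h0.2
    · intro t ht
      exact (hV.hasDerivWithinAt ⟨ht.1, ht.2.trans hc⟩ (mem_bundleChart_source.1 (hs t ht))).mono
        (Icc_subset_Icc_right hc)
    · intro t ht htR
      rw [← g.extField_eq (bundleChart_nonneg x₀ (V t))]
      exact b.bound _ htR
  suffices h : ∀ t ∈ Icc 0 a, V t ∈ (bundleChart x₀ : PartialEquiv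
      (TangentBundle (𝓡∂ n) M) _).source by
    intro t ht
    refine ⟨h t ht, (key a le_rfl h t ht).trans ?_⟩
    have h2 : b.R / 2 / b.δ * t ≤ b.R / 2 / b.δ * b.δ :=
      mul_le_mul_of_nonneg_left (ht.2.trans ha)
        (div_nonneg (by linarith [b.R_pos]) b.δ_pos.le)
    rw [div_mul_cancel₀ _ b.δ_pos.ne'] at h2
    linarith
  by_contra hcon
  push Not at hcon
  obtain ⟨t₁, ht₁, hVt₁⟩ := hcon
  set N := Icc 0 a ∩ V ⁻¹' ((bundleChart x₀ : PartialEquiv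
      (TangentBundle (𝓡∂ n) M) _).source)ᶜ with hN
  have hNc : IsCompact N := by
    refine isCompact_Icc.of_isClosed_subset ?_ inter_subset_left
    exact hV.2.1.preimage_isClosed_of_isClosed isClosed_Icc
      (isOpen_bundleChart_source x₀).isClosed_compl
  obtain ⟨c, hc, hcmin⟩ := hNc.exists_isLeast ⟨t₁, ht₁, hVt₁⟩
  have hc0 : 0 < c := by
    refine lt_of_le_of_ne hc.1.1 fun h ↦ hc.2 ?_
    rw [← h]; exact h0.1
  have hlt : ∀ t ∈ Ico 0 c, V t ∈ (bundleChart x₀ : PartialEquiv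
      (TangentBundle (𝓡∂ n) M) _).source := by
    intro t ht
    by_contra h
    exact absurd (hcmin ⟨⟨ht.1, ht.2.le.trans hc.1.2⟩, h⟩) (not_le.2 ht.2)
  set C : Set (Phase n) := Metric.closedBall p₀ b.R ∩ {p | 0 ≤ p.1 0} with hC
  have hCc : IsCompact C := by
    refine (isCompact_closedBall p₀ b.R).inter_right ?_
    exact isClosed_le continuous_const (by fun_prop)
  have hA := isCompact_bundleChart_symm_image x₀ hCc (fun p hp ↦ b.mem_target p hp.1 hp.2)
  have hmem : ∀ t ∈ Ico 0 c, V t ∈ (bundleChart x₀ : PartialEquiv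
      (TangentBundle (𝓡∂ n) M) _).symm '' C := by
    intro t ht
    refine ⟨bundleChart x₀ (V t), ⟨?_, bundleChart_nonneg _ _⟩,
      (bundleChart x₀).left_inv (hlt t ht)⟩
    refine (key t (ht.2.le.trans hc.1.2)
      (fun s hs ↦ hlt s ⟨hs.1, hs.2.trans_lt ht.2⟩) t ⟨ht.1, le_rfl⟩).trans ?_
    have h2 : b.R / 2 / b.δ * t ≤ b.R / 2 / b.δ * b.δ :=
      mul_le_mul_of_nonneg_left ((ht.2.le.trans hc.1.2).trans ha)
        (div_nonneg (by linarith [b.R_pos]) b.δ_pos.le)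
    rw [div_mul_cancel₀ _ b.δ_pos.ne'] at h2
    linarith
  have hcl : V c ∈ (bundleChart x₀ : PartialEquiv (TangentBundle (𝓡∂ n) M) _).symm '' C := by
    refine hA.isClosed.mem_of_frequently_of_tendsto (f := V) (b := 𝓝[Ico 0 c] c) ?_ ?_
    · have : (𝓝[Ico 0 c] c).NeBot := by
        rw [← mem_closure_iff_nhdsWithin_neBot, closure_Ico hc0.ne]
        exact ⟨hc0.le, le_rfl⟩
      exact (eventually_mem_nhdsWithin.mono hmem).frequently
    · exact (hV.2.1 c hc.1).mono fun t ht ↦ ⟨ht.1, ht.2.le.trans hc.1.2⟩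
  obtain ⟨p, hp, hpc⟩ := hcl
  apply hc.2
  rw [← hpc]
  refine (bundleChart x₀).map_target ?_
  rw [bundleChart_target]
  exact ⟨b.mem_target p hp.1 hp.2, trivial⟩

/-- Solutions of the geodesic equation in the chart are geodesics. -/
theorem isGeodesicOn_symm {y : ℝ → Phase n} {J : Set ℝ} (hJ : J.OrdConnected)
    (hy : ∀ t ∈ J, HasDerivWithinAt y (g.extField z₀.proj (y t)) J t ∧
      y t ∈ Metric.closedBall (bundleChart z₀.proj z₀) b.R) (h0 : ∀ t ∈ J, 0 ≤ (y t).1 0) :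
    g.IsGeodesicOn (fun t ↦ (bundleChart z₀.proj : PartialEquiv
      (TangentBundle (𝓡∂ n) M) _).symm (y t)) J := by
  have hT : ∀ t ∈ J, y t ∈ (bundleChart z₀.proj : PartialEquiv
      (TangentBundle (𝓡∂ n) M) _).target := fun t ht ↦ by
    rw [bundleChart_target]; exact ⟨b.mem_target _ (hy t ht).2 (h0 t ht), trivial⟩
  refine g.isGeodesicOn_of_hasDerivWithinAt hJ ?_ fun t ht ↦ ⟨z₀.proj, ?_, ?_⟩
  · exact (continuousOn_bundleChart_symm z₀.proj).comp
      (HasDerivWithinAt.continuousOn fun t ht ↦ (hy t ht).1) hT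
  · exact mem_bundleChart_source.1 ((bundleChart z₀.proj).map_target (hT t ht))
  · have hr : ∀ s ∈ J, bundleChart z₀.proj ((bundleChart z₀.proj : PartialEquiv
      (TangentBundle (𝓡∂ n) M) _).symm (y s)) = y s := fun s hs ↦
        (bundleChart z₀.proj).right_inv (hT s hs)
    rw [hr t ht, ← g.extField_eq (h0 t ht)]
    exact (hy t ht).1.congr hr (hr t ht)

end FlowBox

end TimeOrientedLorentzianMetric

section Scale

variable {n : ℕ} [NeZero n] {M : Type*} [TopologicalSpace M]
  [ChartedSpace (EuclideanHalfSpace n) M] [IsManifold (𝓡∂ n) ∞ M]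

/-- Multiplication of a tangent vector by a scalar. -/
def vscale (c : ℝ) (v : TangentBundle (𝓡∂ n) M) : TangentBundle (𝓡∂ n) M := ⟨v.proj, c • v.2⟩

@[simp]
theorem vscale_proj (c : ℝ) (v : TangentBundle (𝓡∂ n) M) : (vscale c v).proj = v.proj := rfl

theorem vscale_one (v : TangentBundle (𝓡∂ n) M) : vscale 1 v = v := by
  rw [vscale, one_smul]

theorem vscale_vscale (c d : ℝ) (v : TangentBundle (𝓡∂ n) M) :
    vscale c (vscale d v) = vscale (c * d) v := by
  rw [vscale, vscale, vscale, mul_smul]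

theorem bundleChart_vscale {x₀ : M} {v : TangentBundle (𝓡∂ n) M} (c : ℝ)
    (h : v.proj ∈ (extChartAt (𝓡∂ n) x₀).source) :
    bundleChart x₀ (vscale c v) = ((bundleChart x₀ v).1, c • (bundleChart x₀ v).2) := by
  rw [bundleChart_apply, bundleChart_apply]
  exact Prod.ext rfl (tangentCoord_smul x₀ v.proj h c v.2)

theorem continuous_vscale (c : ℝ) :
    Continuous (vscale c : TangentBundle (𝓡∂ n) M → TangentBundle (𝓡∂ n) M) := by
  rw [continuous_iff_continuousAt]
  intro v
  have hv := mem_bundleChart_source_self v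
  have hs : ∀ w ∈ (bundleChart v.proj : PartialEquiv (TangentBundle (𝓡∂ n) M) _).source,
      vscale c w = (bundleChart v.proj : PartialEquiv (TangentBundle (𝓡∂ n) M) _).symm
        ((bundleChart v.proj w).1, c • (bundleChart v.proj w).2) := by
    intro w hw
    rw [← bundleChart_vscale c (mem_bundleChart_source.1 hw)]
    exact ((bundleChart v.proj).left_inv (mem_bundleChart_source.2
      (by exact mem_bundleChart_source.1 hw))).symm
  have hc : ContinuousOn (vscale c)
      (bundleChart v.proj : PartialEquiv (TangentBundle (𝓡∂ n) M) _).source := by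
    refine ContinuousOn.congr ?_ hs
    refine (continuousOn_bundleChart_symm v.proj).comp
      ((continuousOn_bundleChart v.proj).fst.prodMk
        ((continuousOn_bundleChart v.proj).snd.const_smul c)) fun w hw ↦ ?_
    have := (bundleChart v.proj).map_source hw
    rw [bundleChart_target] at this ⊢
    exact ⟨this.1, trivial⟩
  exact hc.continuousAt ((isOpen_bundleChart_source _).mem_nhds hv)

end Scale

namespace TimeOrientedLorentzianMetric

variable {n : ℕ} [NeZero n] {M : Type*} [TopologicalSpace M]
  [ChartedSpace (EuclideanHalfSpace n) M] [IsManifold (𝓡∂ n) ∞ M]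
  {g : TimeOrientedLorentzianMetric n M}

theorem geodesicField_smul (x₀ : M) (y v : Model n) (c : ℝ) :
    g.geodesicField x₀ (y, c • v) = (c • v, c ^ 2 • (g.geodesicField x₀ (y, v)).2) := by
  refine Prod.ext rfl ?_
  have : g.christoffelForm x₀ (y, c • v) = c ^ 2 • g.christoffelForm x₀ (y, v) := by
    ext w
    simp only [christoffelForm_apply, map_smul, smul_apply, smul_eq_mul]
    ring
  change -(g.metricCoeff x₀ y).inverse (g.christoffelForm x₀ (y, c • v)) =
    c ^ 2 • -(g.metricCoeff x₀ y).inverse (g.christoffelForm x₀ (y, v))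
  rw [this, map_smul, smul_neg]

/-- Affine reparametrizations of geodesics are geodesics. -/
theorem IsGeodesicOn.comp_affine {V : ℝ → TangentBundle (𝓡∂ n) M} {J J' : Set ℝ}
    (hV : g.IsGeodesicOn V J) (c d : ℝ) (hJ' : J'.OrdConnected)
    (h : MapsTo (fun t ↦ c * t + d) J' J) :
    g.IsGeodesicOn (fun t ↦ vscale c (V (c * t + d))) J' := by
  have haff : ContinuousOn (fun t : ℝ ↦ c * t + d) J' := by fun_prop
  have hVc : ContinuousOn (fun t ↦ V (c * t + d)) J' := hV.2.1.comp haff h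
  refine g.isGeodesicOn_of_hasDerivWithinAt hJ'
    ((continuous_vscale c).comp_continuousOn hVc) fun t ht ↦
      ⟨(V (c * t + d)).proj, mem_extChartAt_source _, ?_⟩
  set x₀ := (V (c * t + d)).proj with hx₀
  have hsrc : (V (c * t + d)).proj ∈ (extChartAt (𝓡∂ n) x₀).source := mem_extChartAt_source _
  have hd := hV.hasDerivWithinAt (h ht) (x₀ := x₀) (mem_extChartAt_source _)
  have ha : HasDerivWithinAt (fun t : ℝ ↦ c * t + d) c J' t := by
    simpa using (((hasDerivAt_id t).const_mul c).add_const d).hasDerivWithinAt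
  have h1 := HasDerivWithinAt.scomp t hd ha h
  have hfst : HasDerivWithinAt (fun s ↦ (bundleChart x₀ (V (c * s + d))).1) _ J' t := h1.fst
  have hsnd : HasDerivWithinAt (fun s ↦ (bundleChart x₀ (V (c * s + d))).2) _ J' t := h1.snd
  have h2 := hfst.prodMk (HasDerivWithinAt.const_smul c hsnd)
  have hev : (fun s ↦ bundleChart x₀ (vscale c (V (c * s + d)))) =ᶠ[𝓝[J'] t] fun s ↦
      ((bundleChart x₀ (V (c * s + d))).1, c • (bundleChart x₀ (V (c * s + d))).2) := by
    have : ContinuousWithinAt (fun s ↦ (V (c * s + d)).proj) J' t :=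
      continuous_proj.continuousAt.comp_continuousWithinAt (hVc t ht)
    filter_upwards [this.eventually ((isOpen_extChartAt_source (I := 𝓡∂ n) x₀).mem_nhds hsrc)] with s hs
    exact bundleChart_vscale c hs
  refine HasDerivWithinAt.congr_of_eventuallyEq ?_ hev (hev.self_of_nhdsWithin ht)
  rw [bundleChart_vscale (x₀ := x₀) (v := V (c * t + d)) c hsrc, geodesicField_smul]
  refine h2.congr_deriv ?_
  refine Prod.ext rfl ?_
  change c • c • (g.geodesicField x₀ (bundleChart x₀ (V (c * t + d)))).2 = _
  rw [smul_smul, sq]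

theorem IsGeodesicOn.shift {V : ℝ → TangentBundle (𝓡∂ n) M} {a b : ℝ}
    (hV : g.IsGeodesicOn V (Icc a b)) (d : ℝ) {a' b' : ℝ} (ha : a ≤ a' + d) (hb : b' + d ≤ b) :
    g.IsGeodesicOn (fun t ↦ V (t + d)) (Icc a' b') := by
  have := hV.comp_affine 1 d (J' := Icc a' b') ordConnected_Icc fun t ht ↦ by
    constructor <;> linarith [ht.1, ht.2]
  simpa only [one_mul, vscale_one] using this

/-- A geodesic traversed backwards. -/
theorem IsGeodesicOn.reverse {V : ℝ → TangentBundle (𝓡∂ n) M} {a b : ℝ}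
    (hV : g.IsGeodesicOn V (Icc a b)) (d : ℝ) {a' b' : ℝ} (ha : a ≤ d - b') (hb : d - a' ≤ b) :
    g.IsGeodesicOn (fun t ↦ vscale (-1) (V (d - t))) (Icc a' b') := by
  have := hV.comp_affine (-1) d (J' := Icc a' b') ordConnected_Icc fun t ht ↦ by
    constructor <;> linarith [ht.1, ht.2]
  refine this.congr fun t _ ↦ ?_
  change vscale (-1) (V (d - t)) = vscale (-1) (V (-1 * t + d))
  rw [show -1 * t + d = d - t by ring]

theorem IsGeodesicOn.concat {V W : ℝ → TangentBundle (𝓡∂ n) M} {a b c : ℝ}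
    (hV : g.IsGeodesicOn V (Icc a b)) (hW : g.IsGeodesicOn W (Icc b c)) (hab : a ≤ b) (hbc : b ≤ c)
    (h : V b = W b) : g.IsGeodesicOn (fun t ↦ if t ≤ b then V t else W t) (Icc a c) := by
  set Z : ℝ → TangentBundle (𝓡∂ n) M := fun t ↦ if t ≤ b then V t else W t with hZ
  have hZV : EqOn Z V (Icc a b) := fun t ht ↦ if_pos ht.2
  have hZW : EqOn Z W (Icc b c) := fun t ht ↦ by
    rcases eq_or_lt_of_le ht.1 with h1 | h1
    · rw [hZ, ← h1]; dsimp only; rw [if_pos le_rfl, h]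
    · exact if_neg (not_le.2 h1)
  have h1 := hV.congr hZV
  have h2 := hW.congr hZW
  rw [isGeodesicOn_iff] at h1 h2 ⊢
  have hU : Icc a c = Icc a b ∪ Icc b c := (Icc_union_Icc_eq_Icc hab hbc).symm
  refine ⟨ordConnected_Icc, ?_, fun t ht ↦ ?_⟩
  · rw [hU]; exact h1.2.1.union_of_isClosed h2.2.1 isClosed_Icc isClosed_Icc
  · rcases lt_trichotomy t b with hlt | rfl | hlt
    · refine (h1.2.2 t ⟨ht.1, hlt.le⟩).mono_of_mem_nhdsWithin ?_
      have : Icc a b = Icc a c ∩ Iic b := by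
        ext s; simp only [mem_Icc, mem_inter_iff, mem_Iic]
        exact ⟨fun h ↦ ⟨⟨h.1, h.2.trans hbc⟩, h.2⟩, fun h ↦ ⟨h.1.1, h.2⟩⟩
      rw [this]
      exact inter_mem_nhdsWithin _ (Iic_mem_nhds hlt)
    · rw [hU]
      exact (h1.2.2 t ⟨hab, le_rfl⟩).union (h2.2.2 t ⟨le_rfl, hbc⟩)
    · refine (h2.2.2 t ⟨hlt.le, ht.2⟩).mono_of_mem_nhdsWithin ?_
      have : Icc b c = Icc a c ∩ Ici b := by
        ext s; simp only [mem_Icc, mem_inter_iff, mem_Ici]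
        exact ⟨fun h ↦ ⟨⟨hab.trans h.1, h.2⟩, h.1⟩, fun h ↦ ⟨h.2, h.1.2⟩⟩
      rw [this]
      exact inter_mem_nhdsWithin _ (Ici_mem_nhds hlt)

/-- A one-point geodesic. -/
theorem isGeodesicOn_singleton (V : ℝ → TangentBundle (𝓡∂ n) M) (a : ℝ) :
    g.IsGeodesicOn V (Icc a a) := by
  rw [isGeodesicOn_iff, Icc_self]
  refine ⟨ordConnected_singleton, continuousOn_singleton _ _, ?_⟩
  rintro t rfl
  exact HasFDerivWithinAt.of_subsingleton subsingleton_singleton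

end TimeOrientedLorentzianMetric

section Rates

variable {n : ℕ} [NeZero n] {M : Type*} [TopologicalSpace M]
  [ChartedSpace (EuclideanHalfSpace n) M] [IsManifold (𝓡∂ n) ∞ M] {ι : Type*} {l : Filter ι}

/-- In each chart of the tangent bundle, the distance of `Z i` and `z` is `O(θ i)`. -/
def ConvergesAtRate (l : Filter ι) (θ : ι → ℝ) (Z : ι → TangentBundle (𝓡∂ n) M)
    (z : TangentBundle (𝓡∂ n) M) : Prop :=
  ∀ x₀ : M, z.proj ∈ (extChartAt (𝓡∂ n) x₀).source →
    ∃ C : ℝ, ∀ᶠ i in l, dist (bundleChart x₀ (Z i)) (bundleChart x₀ z) ≤ C * |θ i|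

theorem convergesAtRate_of_chart {θ : ι → ℝ} {Z : ι → TangentBundle (𝓡∂ n) M}
    {z : TangentBundle (𝓡∂ n) M} (hZ : Tendsto Z l (𝓝 z)) {x₀ : M}
    (hx₀ : z.proj ∈ (extChartAt (𝓡∂ n) x₀).source) {C : ℝ}
    (hC : ∀ᶠ i in l, dist (bundleChart x₀ (Z i)) (bundleChart x₀ z) ≤ C * |θ i|) :
    ConvergesAtRate l θ Z z := by
  intro x₁ hx₁
  set Φ := (bundleChart x₁ : PartialEquiv (TangentBundle (𝓡∂ n) M) _) ∘
    (bundleChart x₀ : PartialEquiv (TangentBundle (𝓡∂ n) M) _).symm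
  have h0 := mem_bundleChart_source.2 hx₀
  have h1 := mem_bundleChart_source.2 hx₁
  have hΦ : ContDiffWithinAt ℝ 1 Φ (range (𝓡∂ n).tangent) (bundleChart x₀ z) := by
    refine contDiffWithinAt_ext_coord_change (I := (𝓡∂ n).tangent) (n := 1)
      (⟨x₁, 0⟩ : TangentBundle (𝓡∂ n) M) ⟨x₀, 0⟩ ?_
    rw [PartialEquiv.trans_source'', PartialEquiv.symm_symm, PartialEquiv.symm_target]
    exact mem_image_of_mem _ ⟨h0, h1⟩
  have hO := (hΦ.differentiableWithinAt one_ne_zero).isBigO_sub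
  obtain ⟨D, hD0, hD⟩ := hO.exists_pos
  rw [Asymptotics.isBigOWith_iff] at hD
  have ht : Tendsto (fun i ↦ bundleChart x₀ (Z i)) l
      (𝓝[range (𝓡∂ n).tangent] (bundleChart x₀ z)) := by
    refine tendsto_nhdsWithin_iff.2 ⟨(continuousAt_bundleChart hx₀).tendsto.comp hZ, ?_⟩
    exact Eventually.of_forall fun i ↦ by
      rw [bundleChart, extChartAt_coe]; exact mem_range_self _
  refine ⟨D * C, ?_⟩
  filter_upwards [ht.eventually hD, hC,
    hZ.eventually ((isOpen_bundleChart_source x₀).mem_nhds h0)] with i hi hCi hsi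
  have e1 : Φ (bundleChart x₀ (Z i)) = bundleChart x₁ (Z i) := by
    simp only [Φ, Function.comp_apply, (bundleChart x₀).left_inv hsi]
  have e2 : Φ (bundleChart x₀ z) = bundleChart x₁ z := by
    simp only [Φ, Function.comp_apply, (bundleChart x₀).left_inv h0]
  rw [e1, e2, ← dist_eq_norm, ← dist_eq_norm] at hi
  rw [mul_assoc]
  exact hi.trans (mul_le_mul_of_nonneg_left hCi hD0.le)

/-- In each chart, the base point of `Z i` is `z + r i • z + O(θ i) + o(r i)`. -/
def MovesAtRate (l : Filter ι) (θ r : ι → ℝ) (Z : ι → TangentBundle (𝓡∂ n) M)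
    (z : TangentBundle (𝓡∂ n) M) : Prop :=
  ∀ x₀ : M, z.proj ∈ (extChartAt (𝓡∂ n) x₀).source → ∀ ε > 0, ∃ C : ℝ, 0 ≤ C ∧ ∀ᶠ i in l,
    ‖extChartAt (𝓡∂ n) x₀ (Z i).proj - extChartAt (𝓡∂ n) x₀ z.proj - r i • tangentCoord x₀ z‖ ≤
      C * |θ i| + ε * |r i|

theorem movesAtRate_of_chart {θ r : ι → ℝ} {Z : ι → TangentBundle (𝓡∂ n) M}
    {z : TangentBundle (𝓡∂ n) M} (hZ : Tendsto Z l (𝓝 z)) {x₀ : M}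
    (hx₀ : z.proj ∈ (extChartAt (𝓡∂ n) x₀).source)
    (h : ∀ ε > 0, ∃ C : ℝ, 0 ≤ C ∧ ∀ᶠ i in l,
      ‖extChartAt (𝓡∂ n) x₀ (Z i).proj - extChartAt (𝓡∂ n) x₀ z.proj - r i • tangentCoord x₀ z‖ ≤
      C * |θ i| + ε * |r i|) :
    MovesAtRate l θ r Z z := by
  intro x₁ hx₁ ε hε
  set Φ := extChartAt (𝓡∂ n) x₁ ∘ (extChartAt (𝓡∂ n) x₀).symm
  set y := extChartAt (𝓡∂ n) x₀ z.proj with hy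
  set v := tangentCoord x₀ z with hv
  have hΦ : HasFDerivWithinAt Φ (fderivWithin ℝ Φ (range (𝓡∂ n)) y) (range (𝓡∂ n)) y := by
    have : ContDiffWithinAt ℝ 1 Φ (range (𝓡∂ n)) y := by
      refine contDiffWithinAt_ext_coord_change x₁ x₀ ?_
      rw [PartialEquiv.trans_source'', PartialEquiv.symm_symm, PartialEquiv.symm_target]
      exact mem_image_of_mem _ ⟨hx₀, hx₁⟩
    exact (this.differentiableWithinAt one_ne_zero).hasFDerivWithinAt
  set A := fderivWithin ℝ Φ (range (𝓡∂ n)) y with hA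
  have hv₁ : tangentCoord x₁ z = A v := tangentCoord_change hx₀ hx₁
  have hpr : Tendsto (fun i ↦ (Z i).proj) l (𝓝 z.proj) := (continuous_proj.tendsto z).comp hZ
  have ht : Tendsto (fun i ↦ extChartAt (𝓡∂ n) x₀ (Z i).proj) l (𝓝[range (𝓡∂ n)] y) := by
    refine tendsto_nhdsWithin_iff.2 ⟨?_, Eventually.of_forall fun i ↦ by
      rw [extChartAt_coe]; exact mem_range_self _⟩
    exact ((continuousOn_extChartAt x₀).continuousAt
      ((isOpen_extChartAt_source x₀).mem_nhds hx₀)).tendsto.comp hpr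
  set η := ε / (‖A‖ + (‖v‖ + 1) + 1) with hη
  have hden : 0 < ‖A‖ + (‖v‖ + 1) + 1 := by positivity
  have hη0 : 0 < η := by positivity
  set η' := min η 1 with hη'
  have hη'0 : 0 < η' := lt_min hη0 one_pos
  obtain ⟨C, hC0, hC⟩ := h η' hη'0
  have hlo := (hasFDerivWithinAt_iff_isLittleO.1 hΦ).def hη0
  refine ⟨‖A‖ * C + η * C, by positivity, ?_⟩
  filter_upwards [hC, ht.eventually hlo, hpr.eventually ((isOpen_extChartAt_source x₀).mem_nhds hx₀)]
    with i hCi hi hsi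
  set d := extChartAt (𝓡∂ n) x₀ (Z i).proj - y with hd
  have e1 : Φ (extChartAt (𝓡∂ n) x₀ (Z i).proj) = extChartAt (𝓡∂ n) x₁ (Z i).proj := by
    simp only [Φ, Function.comp_apply, (extChartAt (𝓡∂ n) x₀).left_inv hsi]
  have e2 : Φ y = extChartAt (𝓡∂ n) x₁ z.proj := by
    simp only [Φ, Function.comp_apply, hy, (extChartAt (𝓡∂ n) x₀).left_inv hx₀]
  rw [e1, e2] at hi
  rw [hv₁]
  have e3 : extChartAt (𝓡∂ n) x₁ (Z i).proj - extChartAt (𝓡∂ n) x₁ z.proj - r i • A v =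
      (extChartAt (𝓡∂ n) x₁ (Z i).proj - extChartAt (𝓡∂ n) x₁ z.proj - A d) +
        A (d - r i • v) := by
    rw [A.map_sub d, A.map_smul]; abel
  have hdn : ‖d‖ ≤ C * |θ i| + (‖v‖ + 1) * |r i| := by
    have : d = (d - r i • v) + r i • v := by abel
    rw [this]
    refine (norm_add_le _ _).trans ?_
    rw [norm_smul, Real.norm_eq_abs]
    nlinarith [min_le_right η 1, abs_nonneg (r i)]
  rw [e3]
  have hA1 : ‖A (d - r i • v)‖ ≤ ‖A‖ * (C * |θ i| + η * |r i|) :=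
    (A.le_opNorm _).trans (mul_le_mul_of_nonneg_left (hCi.trans (by
      gcongr; exact min_le_left _ _)) (norm_nonneg _))
  have hη2 : η * (‖A‖ + (‖v‖ + 1)) ≤ ε := by
    have : η * (‖A‖ + (‖v‖ + 1) + 1) = ε := div_mul_cancel₀ _ hden.ne'
    linarith
  calc _ ≤ η * ‖d‖ + ‖A‖ * (C * |θ i| + η * |r i|) := (norm_add_le _ _).trans (add_le_add hi hA1)
    _ ≤ η * (C * |θ i| + (‖v‖ + 1) * |r i|) + ‖A‖ * (C * |θ i| + η * |r i|) := by gcongr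
    _ = (‖A‖ * C + η * C) * |θ i| + η * (‖A‖ + (‖v‖ + 1)) * |r i| := by ring
    _ ≤ _ := by gcongr

end Rates

namespace TimeOrientedLorentzianMetric

variable {n : ℕ} [NeZero n] {M : Type*} [TopologicalSpace M]
  [ChartedSpace (EuclideanHalfSpace n) M] [IsManifold (𝓡∂ n) ∞ M]
  {g : TimeOrientedLorentzianMetric n M} {ι : Type*} {l : Filter ι}

/-- Within a flow box, geodesics depend continuously on their initial vectors. -/
theorem FlowBox.tendsto_geodesic [T2Space M] [l.NeBot] {z₀ : TangentBundle (𝓡∂ n) M}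
    (b : g.FlowBox z₀)
    {V : ι → ℝ → TangentBundle (𝓡∂ n) M} {s : ι → ℝ} {s₀ : ℝ} {z : TangentBundle (𝓡∂ n) M}
    (hs : ∀ᶠ i in l, 0 ≤ s i) (hV : ∀ᶠ i in l, g.IsGeodesicOn (V i) (Icc 0 (s i)))
    (hz : z ∈ b.core) (hcore : ∀ᶠ i in l, V i 0 ∈ b.core)
    (h0 : Tendsto (fun i ↦ V i 0) l (𝓝 z)) (hs₀ : Tendsto s l (𝓝 s₀)) (hδ : s₀ < b.δ) :
    ∃ W, g.IsGeodesicOn W (Icc 0 s₀) ∧ W 0 = z ∧ Tendsto (fun i ↦ V i (s i)) l (𝓝 (W s₀)) ∧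
      ∀ θ : ι → ℝ, ConvergesAtRate l θ (fun i ↦ V i 0) z →
        MovesAtRate l θ (fun i ↦ s i - s₀) (fun i ↦ V i (s i)) (W s₀) ∧
        ((∀ᶠ i in l, s i = s₀) → ConvergesAtRate l θ (fun i ↦ V i (s i)) (W s₀)) := by
  set x₀ := z₀.proj
  set κ := (bundleChart x₀ : PartialEquiv (TangentBundle (𝓡∂ n) M) (Phase n)) with hκ
  set p := κ z with hp
  have hs₀0 : 0 ≤ s₀ := ge_of_tendsto hs₀ hs
  have hsδ : ∀ᶠ i in l, s i < b.δ := hs₀.eventually (gt_mem_nhds hδ)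
  have hzp : z.proj ∈ (extChartAt (𝓡∂ n) x₀).source := mem_bundleChart_source.1 hz.1
  obtain ⟨y, hy0, hy⟩ := b.exists_solution hz.2
  have hyc : ContinuousOn y (Icc 0 b.δ) := HasDerivWithinAt.continuousOn fun t ht ↦ (hy t ht).1
  -- Gronwall
  have hG : ∀ᶠ i in l, ∀ t ∈ Icc 0 (s i),
      dist (κ (V i t)) (y t) ≤ Real.exp (b.K * b.δ) * dist (κ (V i 0)) p := by
    filter_upwards [hs, hV, hcore, hsδ] with i hi hVi hci hδi t ht
    have hmem := b.geodesic_mem hδi.le hVi hci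
    have hder : ∀ t ∈ Icc 0 (s i), HasDerivWithinAt (fun t ↦ κ (V i t))
        (g.extField x₀ (κ (V i t))) (Icc 0 (s i)) t := fun t ht ↦ by
      rw [g.extField_eq (bundleChart_nonneg x₀ (V i t))]
      exact hVi.hasDerivWithinAt ht (mem_bundleChart_source.1 (hmem t ht).1)
    have := dist_le_of_trajectories_ODE_of_mem (v := fun _ ↦ g.extField x₀)
      (s := fun _ ↦ Metric.closedBall (κ z₀) b.R) (K := b.K) (f := fun t ↦ κ (V i t)) (g := y)
      (a := 0) (b := s i) (δ := dist (κ (V i 0)) p) (fun _ _ ↦ b.lipschitz)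
      (HasDerivWithinAt.continuousOn hder)
      (fun t ht ↦ (hder t ⟨ht.1, ht.2.le⟩).mono_of_mem_nhdsWithin (Icc_mem_nhdsGE_of_mem ht))
      (fun t ht ↦ (hmem t ⟨ht.1, ht.2.le⟩).2)
      (hyc.mono (Icc_subset_Icc_right hδi.le))
      (fun t ht ↦ ((hy t ⟨ht.1, ht.2.le.trans hδi.le⟩).1.mono
        (Icc_subset_Icc_right hδi.le)).mono_of_mem_nhdsWithin (Icc_mem_nhdsGE_of_mem ht))
      (fun t ht ↦ (hy t ⟨ht.1, ht.2.le.trans hδi.le⟩).2) (by rw [hy0]) t ht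
    refine this.trans ?_
    rw [mul_comm]
    refine mul_le_mul_of_nonneg_right (Real.exp_le_exp.2 ?_) dist_nonneg
    rw [sub_zero]
    exact mul_le_mul_of_nonneg_left (ht.2.trans hδi.le) b.K.2
  have hκ0 : Tendsto (fun i ↦ κ (V i 0)) l (𝓝 p) := (continuousAt_bundleChart hzp).tendsto.comp h0
  have hd0 : Tendsto (fun i ↦ Real.exp (b.K * b.δ) * dist (κ (V i 0)) p) l (𝓝 0) := by
    have := (tendsto_iff_dist_tendsto_zero.1 hκ0).const_mul (Real.exp (b.K * b.δ))
    rwa [mul_zero] at this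
  have hs₀m : s₀ ∈ Icc 0 b.δ := ⟨hs₀0, hδ.le⟩
  have hsw : Tendsto s l (𝓝[Icc 0 b.δ] s₀) := tendsto_nhdsWithin_iff.2
    ⟨hs₀, (hs.and hsδ).mono fun i hi ↦ ⟨hi.1, hi.2.le⟩⟩
  have hys : Tendsto (fun i ↦ y (s i)) l (𝓝 (y s₀)) := (hyc s₀ hs₀m).tendsto.comp hsw
  have hGs : ∀ᶠ i in l, dist (κ (V i (s i))) (y (s i)) ≤
      Real.exp (b.K * b.δ) * dist (κ (V i 0)) p := by
    filter_upwards [hG, hs] with i hi hsi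
    exact hi _ ⟨hsi, le_rfl⟩
  have hend : Tendsto (fun i ↦ κ (V i (s i))) l (𝓝 (y s₀)) := by
    have h1 : Tendsto (fun i ↦ dist (y (s i)) (κ (V i (s i)))) l (𝓝 0) := by
      refine squeeze_zero' (Eventually.of_forall fun _ ↦ dist_nonneg) ?_ hd0
      filter_upwards [hGs] with i hi
      rwa [dist_comm]
    exact hys.congr_dist h1
  have hclosed : IsClosed {q : Phase n | 0 ≤ q.1 0} := isClosed_le continuous_const (by fun_prop)
  have hnn : ∀ t ∈ Icc 0 s₀, 0 ≤ (y t).1 0 := by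
    intro t ht
    rcases eq_or_lt_of_le ht.2 with rfl | hlt
    · exact hclosed.mem_of_tendsto hend (Eventually.of_forall fun i ↦ bundleChart_nonneg _ _)
    · have h1 : Tendsto (fun i ↦ κ (V i t)) l (𝓝 (y t)) := by
        rw [tendsto_iff_dist_tendsto_zero]
        refine squeeze_zero' (Eventually.of_forall fun _ ↦ dist_nonneg) ?_ hd0
        filter_upwards [hG, hs₀.eventually (lt_mem_nhds hlt)] with i hi hti
        exact hi t ⟨ht.1, hti.le⟩
      exact hclosed.mem_of_tendsto h1 (Eventually.of_forall fun i ↦ bundleChart_nonneg _ _)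
  set W : ℝ → TangentBundle (𝓡∂ n) M := fun t ↦ κ.symm (y t) with hW
  have hsub : Icc 0 s₀ ⊆ Icc 0 b.δ := Icc_subset_Icc_right hδ.le
  have hWg : g.IsGeodesicOn W (Icc 0 s₀) := b.isGeodesicOn_symm ordConnected_Icc
    (fun t ht ↦ ⟨(hy t (hsub ht)).1.mono hsub, (hy t (hsub ht)).2⟩) hnn
  have hyT : y s₀ ∈ κ.target := by
    rw [hκ, bundleChart_target]
    exact ⟨b.mem_target _ (hy s₀ hs₀m).2 (hnn s₀ ⟨hs₀0, le_rfl⟩), trivial⟩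
  have hsrc : ∀ᶠ i in l, V i (s i) ∈ κ.source := by
    filter_upwards [hs, hV, hcore, hsδ] with i hi hVi hci hδi
    exact (b.geodesic_mem hδi.le hVi hci _ ⟨hi, le_rfl⟩).1
  have hWlim : Tendsto (fun i ↦ V i (s i)) l (𝓝 (W s₀)) := by
    have h1 : Tendsto (fun i ↦ κ (V i (s i))) l (𝓝[κ.target] (y s₀)) :=
      tendsto_nhdsWithin_iff.2 ⟨hend, hsrc.mono fun i hi ↦ κ.map_source hi⟩
    have h2 := (continuousOn_bundleChart_symm x₀ (y s₀) hyT).tendsto.comp h1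
    refine h2.congr' ?_
    filter_upwards [hsrc] with i hi
    exact κ.left_inv hi
  have hκW : κ (W s₀) = y s₀ := κ.right_inv hyT
  have hWs : (W s₀).proj ∈ (extChartAt (𝓡∂ n) x₀).source :=
    mem_bundleChart_source.1 (κ.map_target hyT)
  refine ⟨W, hWg, ?_, hWlim, fun θ hθ ↦ ?_⟩
  · change κ.symm (y 0) = z
    rw [hy0]; exact κ.left_inv hz.1
  obtain ⟨C, hC⟩ := hθ x₀ hzp
  have hC' : ∀ᶠ i in l, dist (κ (V i (s i))) (y (s i)) ≤
      Real.exp (b.K * b.δ) * |C| * |θ i| := by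
    filter_upwards [hGs, hC] with i hi hCi
    rw [mul_assoc]
    exact hi.trans (mul_le_mul_of_nonneg_left (hCi.trans
      (mul_le_mul_of_nonneg_right (le_abs_self C) (abs_nonneg _))) (Real.exp_nonneg _))
  constructor
  · refine movesAtRate_of_chart hWlim hWs fun ε hε ↦
      ⟨Real.exp (b.K * b.δ) * |C|, by positivity, ?_⟩
    have hlo := (hasDerivWithinAt_iff_isLittleO.1 (hy s₀ hs₀m).1).def hε
    filter_upwards [hC', hsw.eventually hlo] with i hi hli
    have e1 : ∀ v : TangentBundle (𝓡∂ n) M, extChartAt (𝓡∂ n) x₀ v.proj = (κ v).1 := fun v ↦ by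
      rw [hκ, bundleChart_apply]
    have e2 : tangentCoord x₀ (W s₀) = (g.extField x₀ (y s₀)).1 := by
      rw [extField_fst, ← hκW, hκ, bundleChart_apply]
    rw [e1, e1, e2, hκW]
    have e3 : (κ (V i (s i))).1 - (y s₀).1 - (s i - s₀) • (g.extField x₀ (y s₀)).1 =
        (κ (V i (s i)) - y (s i)).1 + (y (s i) - y s₀ - (s i - s₀) • g.extField x₀ (y s₀)).1 := by
      simp only [Prod.fst_sub, Prod.smul_fst]; abel
    rw [e3]
    refine (norm_add_le _ _).trans (add_le_add ?_ ?_)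
    · rw [dist_eq_norm] at hi
      exact (norm_fst_le _).trans hi
    · exact (norm_fst_le _).trans hli
  · intro heq
    refine convergesAtRate_of_chart hWlim hWs (C := Real.exp (b.K * b.δ) * |C|) ?_
    filter_upwards [hC', heq] with i hi he
    rw [he] at hi ⊢
    rw [← hκ, hκW]
    exact hi

/-- Geodesics with velocities in a compact set depend continuously on their initial vectors. -/
theorem tendsto_geodesic_of_isCompact [T2Space M] [l.NeBot] {K : Set (TangentBundle (𝓡∂ n) M)}
    (hK : IsCompact K) {V : ι → ℝ → TangentBundle (𝓡∂ n) M} {s : ι → ℝ} {s₀ : ℝ}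
    {z : TangentBundle (𝓡∂ n) M}
    (hs : ∀ᶠ i in l, 0 ≤ s i) (hV : ∀ᶠ i in l, g.IsGeodesicOn (V i) (Icc 0 (s i)))
    (hVK : ∀ᶠ i in l, ∀ t ∈ Icc 0 (s i), V i t ∈ K)
    (h0 : Tendsto (fun i ↦ V i 0) l (𝓝 z)) (hs₀ : Tendsto s l (𝓝 s₀)) :
    ∃ W, g.IsGeodesicOn W (Icc 0 s₀) ∧ W 0 = z ∧ Tendsto (fun i ↦ V i (s i)) l (𝓝 (W s₀)) ∧
      ∀ θ : ι → ℝ, ConvergesAtRate l θ (fun i ↦ V i 0) z →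
        MovesAtRate l θ (fun i ↦ s i - s₀) (fun i ↦ V i (s i)) (W s₀) := by
  have hs₀0 : 0 ≤ s₀ := ge_of_tendsto hs₀ hs
  let b : ∀ z₀, g.FlowBox z₀ := fun z₀ ↦ (g.nonempty_flowBox z₀).some
  obtain ⟨F, hF, hcov⟩ := hK.elim_nhds_subcover (fun z₀ ↦ interior (b z₀).core)
    fun z₀ _ ↦ interior_mem_nhds.2 (b z₀).core_mem_nhds_self
  obtain ⟨δ, hδ0, hδ⟩ : ∃ δ > 0, ∀ z₀ ∈ F, δ ≤ (b z₀).δ := by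
    classical
    clear hF hcov
    induction F using Finset.induction_on with
    | empty => exact ⟨1, one_pos, by simp⟩
    | insert a F _ ih =>
      obtain ⟨δ, h1, h2⟩ := ih
      refine ⟨min δ (b a).δ, lt_min h1 (b a).δ_pos, fun z₀ hz₀ ↦ ?_⟩
      rcases Finset.mem_insert.1 hz₀ with rfl | h
      · exact min_le_right _ _
      · exact (min_le_left _ _).trans (h2 _ h)
  have hbox : ∀ z ∈ K, ∃ z₀, ∃ b : g.FlowBox z₀, δ ≤ b.δ ∧ z ∈ interior b.core := by
    intro z hz
    obtain ⟨z₀, hz₀, h⟩ := mem_iUnion₂.1 (hcov hz)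
    exact ⟨z₀, b z₀, hδ z₀ hz₀, h⟩
  obtain ⟨N, hN⟩ := exists_nat_gt (s₀ / δ)
  set h := s₀ / (N + 1) with hh
  have hh0 : 0 ≤ h := by positivity
  have hhδ : h < δ := by
    rw [hh, div_lt_iff₀ (by positivity)]
    rw [div_lt_iff₀ hδ0] at hN
    nlinarith
  have hNh : N * h + h = s₀ := by rw [hh]; field_simp
  have hle : ∀ k : ℕ, k ≤ N → ∀ᶠ i in l, k * h ≤ s i := by
    intro k hk
    have hk' : (k : ℝ) ≤ N := by exact_mod_cast hk
    rcases eq_or_lt_of_le hh0 with h1 | h1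
    · rw [← h1]; simpa using hs
    · refine (hs₀.eventually (lt_mem_nhds (?_ : k * h < s₀))).mono fun _ h ↦ h.le
      nlinarith
  have claim : ∀ k : ℕ, k ≤ N → ∃ W, g.IsGeodesicOn W (Icc 0 (k * h)) ∧ W 0 = z ∧
      Tendsto (fun i ↦ V i (k * h)) l (𝓝 (W (k * h))) ∧
      ∀ θ : ι → ℝ, ConvergesAtRate l θ (fun i ↦ V i 0) z →
        ConvergesAtRate l θ (fun i ↦ V i (k * h)) (W (k * h)) := by
    intro k
    induction k with
    | zero =>
      intro _
      refine ⟨fun _ ↦ z, ?_, rfl, by simpa using h0, fun θ hθ ↦ by simpa using hθ⟩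
      simpa using g.isGeodesicOn_singleton (fun _ ↦ z) 0
    | succ k ih =>
      intro hk
      obtain ⟨W, hWg, hW0, hWl, hWr⟩ := ih (by omega)
      have hzK : W (k * h) ∈ K := by
        refine hK.isClosed.mem_of_tendsto hWl ?_
        filter_upwards [hVK, hle k (by omega)] with i hi h2
        exact hi _ ⟨by positivity, h2⟩
      obtain ⟨z₀, b, hbδ, hzb⟩ := hbox _ hzK
      have e0 : ((k + 1 : ℕ) : ℝ) * h = h + k * h := by push_cast; ring
      obtain ⟨W', hW'g, hW'0, hW'l, hW'r⟩ := b.tendsto_geodesic (l := l)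
        (V := fun i t ↦ V i (t + k * h)) (s := fun _ ↦ h) (s₀ := h) (z := W (k * h))
        (Eventually.of_forall fun _ ↦ hh0) (by
          filter_upwards [hV, hle (k + 1) hk] with i hi h2
          refine hi.shift (k * h) (by positivity) ?_
          rwa [e0] at h2) (interior_subset hzb)
        (by
          simp only [zero_add]
          exact (hWl.eventually (isOpen_interior.mem_nhds hzb)).mono fun i hi ↦ interior_subset hi)
        (by simpa using hWl) tendsto_const_nhds (hhδ.trans_le hbδ)
      have hsh : g.IsGeodesicOn (fun t ↦ W' (t + -(k * h))) (Icc (k * h) ((k + 1 : ℕ) * h)) := by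
        refine hW'g.shift (-(k * h)) (by linarith) ?_
        rw [e0]; linarith
      have hle' : (k : ℝ) * h ≤ (k + 1 : ℕ) * h := by rw [e0]; linarith
      have hc := hWg.concat hsh (by positivity) hle' (by simp [hW'0])
      have hval : (if ((k + 1 : ℕ) : ℝ) * h ≤ k * h then W (((k + 1 : ℕ) : ℝ) * h) else
          W' (((k + 1 : ℕ) : ℝ) * h + -(k * h))) = W' h := by
        split_ifs with hif
        · have : h = 0 := by rw [e0] at hif; linarith
          rw [this]; simp [hW'0, this]
        · rw [e0]; congr 1; ring
      refine ⟨_, hc, ?_, ?_, fun θ hθ ↦ ?_⟩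
      · rw [if_pos (by positivity)]; exact hW0
      · rw [hval, e0]; exact hW'l
      · rw [hval, e0]
        exact (hW'r θ (by simpa using hWr θ hθ)).2 (Eventually.of_forall fun _ ↦ rfl)
  obtain ⟨W, hWg, hW0, hWl, hWr⟩ := claim N le_rfl
  have hzK : W (N * h) ∈ K := by
    refine hK.isClosed.mem_of_tendsto hWl ?_
    filter_upwards [hVK, hle N le_rfl] with i hi h2
    exact hi _ ⟨by positivity, h2⟩
  obtain ⟨z₀, b, hbδ, hzb⟩ := hbox _ hzK
  obtain ⟨W', hW'g, hW'0, hW'l, hW'r⟩ := b.tendsto_geodesic (l := l)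
    (V := fun i t ↦ V i (t + N * h)) (s := fun i ↦ s i - N * h) (s₀ := h) (z := W (N * h))
    (by filter_upwards [hle N le_rfl] with i hi; linarith) (by
      filter_upwards [hV] with i hi
      exact hi.shift (N * h) (by positivity) (by linarith)) (interior_subset hzb)
    (by
      simp only [zero_add]
      exact (hWl.eventually (isOpen_interior.mem_nhds hzb)).mono fun i hi ↦ interior_subset hi)
    (by simpa using hWl) (by
      have := hs₀.sub_const (N * h)
      rwa [← hNh, add_sub_cancel_left] at this) (hhδ.trans_le hbδ)
  have hsh : g.IsGeodesicOn (fun t ↦ W' (t + -(N * h))) (Icc (N * h) s₀) :=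
    hW'g.shift (-(N * h)) (by linarith) (by linarith)
  have hle' : (N : ℝ) * h ≤ s₀ := by linarith
  have hc := hWg.concat hsh (by positivity) hle' (by simp [hW'0])
  have hval : (if s₀ ≤ N * h then W s₀ else W' (s₀ + -(N * h))) = W' h := by
    split_ifs with hif
    · have : h = 0 := by linarith
      rw [this]; simp [hW'0, this, ← hNh]
    · congr 1; linarith
  refine ⟨_, hc, ?_, ?_, fun θ hθ ↦ ?_⟩
  · rw [if_pos (by positivity)]; exact hW0
  · rw [hval]; simpa using hW'l
  · rw [hval]
    have := (hW'r θ (by simpa using hWr θ hθ)).1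
    have e : ∀ i, s i - N * h - h = s i - s₀ := fun i ↦ by rw [← hNh]; ring
    simpa [e] using this

end TimeOrientedLorentzianMetric

namespace TimeOrientedLorentzianMetric

variable {n : ℕ} [NeZero n] {M : Type*} [TopologicalSpace M]
  [ChartedSpace (EuclideanHalfSpace n) M] [IsManifold (𝓡∂ n) ∞ M]
  (g : TimeOrientedLorentzianMetric n M)

section Algebra

/-- The scalar product is positive definite on the orthogonal complement of a timelike vector. -/
theorem inner_pos_of_orthogonal {x : M} {T w : TangentSpace (𝓡∂ n) x} (hT : g.inner x T T < 0)
    (hw : g.inner x T w = 0) (hw0 : w ≠ 0) : 0 < g.inner x w w := by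
  by_contra hneg
  push Not at hneg
  obtain ⟨v, hv, hpos⟩ := g.signature x
  set α := g.inner x v w with hα
  set β := g.inner x v T with hβ
  have hwT : g.inner x w T = 0 := by rw [g.symm, hw]
  have horth : g.inner x v (α • T - β • w) = 0 := by
    rw [map_sub, map_smul, map_smul, ← hα, ← hβ, smul_eq_mul, smul_eq_mul]; ring
  have hself : g.inner x (α • T - β • w) (α • T - β • w) =
      α ^ 2 * g.inner x T T + β ^ 2 * g.inner x w w := by
    simp only [map_sub, map_smul, sub_apply, smul_apply, smul_eq_mul, hw, hwT]
    ring
  have hle : g.inner x (α • T - β • w) (α • T - β • w) ≤ 0 := by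
    rw [hself]; nlinarith [sq_nonneg α, sq_nonneg β]
  have h0 : α • T - β • w = 0 := by
    by_contra hne
    exact absurd (hpos _ horth hne) (not_lt.2 hle)
  have h1 : g.inner x T (α • T - β • w) = 0 := by rw [h0, map_zero]
  rw [map_sub, map_smul, map_smul, hw, smul_zero, sub_zero, smul_eq_mul] at h1
  have hα0 : α = 0 := (mul_eq_zero.1 h1).resolve_right hT.ne
  rw [hα0, zero_smul, zero_sub, neg_eq_zero] at h0
  have hβ0 : β = 0 := (smul_eq_zero.1 h0).resolve_right hw0
  have hT0 : T ≠ 0 := by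
    rintro rfl
    rw [map_zero] at hT
    exact lt_irrefl _ hT
  exact absurd (hpos T hβ0 hT0) (not_lt.2 hT.le)

theorem inner_ne_zero_of_timelike {x : M} {T w : TangentSpace (𝓡∂ n) x}
    (hT : g.inner x T T < 0) (hw : g.inner x w w ≤ 0) (hw0 : w ≠ 0) : g.inner x T w ≠ 0 :=
  fun h ↦ absurd (g.inner_pos_of_orthogonal hT h hw0) (not_lt.2 hw)

/-- The scalar product of a tangent vector with the time orientation. -/
def timePairing (v : TangentBundle (𝓡∂ n) M) : ℝ := g.inner v.proj (g.timeField v.proj) v.2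

theorem isCausal_iff {v : TangentBundle (𝓡∂ n) M} :
    g.IsCausal v ↔ v.2 ≠ 0 ∧ g.normSq v ≤ 0 := by
  constructor
  · rintro (h | h)
    · refine ⟨fun h0 ↦ ?_, le_of_lt h⟩
      rw [IsTimelike, normSq, h0, map_zero] at h
      exact lt_irrefl _ h
    · exact ⟨h.1, h.2.le⟩
  · rintro ⟨h0, h⟩
    rcases lt_or_eq_of_le h with h | h
    · exact Or.inl h
    · exact Or.inr ⟨h0, h⟩

variable {g}

theorem IsCausal.timePairing_ne_zero {v : TangentBundle (𝓡∂ n) M} (hv : g.IsCausal v) :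
    g.timePairing v ≠ 0 :=
  g.inner_ne_zero_of_timelike (g.timeField_timelike _) (g.isCausal_iff.1 hv).2
    (g.isCausal_iff.1 hv).1

theorem normSq_vscale (c : ℝ) (v : TangentBundle (𝓡∂ n) M) :
    g.normSq (vscale c v) = c ^ 2 * g.normSq v := by
  rw [normSq, normSq]
  change g.inner v.proj (c • v.2) (c • v.2) = _
  rw [map_smul, map_smul, smul_apply, smul_eq_mul, smul_eq_mul]
  ring

theorem timePairing_vscale (c : ℝ) (v : TangentBundle (𝓡∂ n) M) :
    g.timePairing (vscale c v) = c * g.timePairing v := by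
  change g.inner v.proj (g.timeField v.proj) (c • v.2) = _
  rw [map_smul, smul_eq_mul, timePairing]

theorem IsCausal.vscale {v : TangentBundle (𝓡∂ n) M} (hv : g.IsCausal v) {c : ℝ} (hc : c ≠ 0) :
    g.IsCausal (vscale c v) := by
  rw [isCausal_iff] at hv ⊢
  refine ⟨smul_ne_zero hc hv.1, ?_⟩
  rw [normSq_vscale]
  exact mul_nonpos_of_nonneg_of_nonpos (sq_nonneg c) hv.2

theorem causalNorm_vscale_neg_one (v : TangentBundle (𝓡∂ n) M) :
    g.causalNorm (BrokenLens.vscale (-1) v) = g.causalNorm v := by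
  rw [causalNorm, normSq_vscale, causalNorm]; norm_num

end Algebra

section Continuity

variable {g}

theorem normSq_eq_chart {x₀ : M} {v : TangentBundle (𝓡∂ n) M}
    (h : v.proj ∈ (extChartAt (𝓡∂ n) x₀).source) :
    g.normSq v = g.metricCoeff x₀ (bundleChart x₀ v).1 (bundleChart x₀ v).2
      (bundleChart x₀ v).2 := by
  rw [bundleChart_apply]
  exact (g.metricCoeff_tangentCoord h rfl).symm

/-- The time orientation in a chart. -/
def timeCoord (g : TimeOrientedLorentzianMetric n M) (x₀ x : M) : Model n :=
  tangentCoord x₀ (⟨x, g.timeField x⟩ : TangentBundle (𝓡∂ n) M)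

theorem timePairing_eq_chart {x₀ : M} {v : TangentBundle (𝓡∂ n) M}
    (h : v.proj ∈ (extChartAt (𝓡∂ n) x₀).source) :
    g.timePairing v = g.metricCoeff x₀ (bundleChart x₀ v).1 (g.timeCoord x₀ v.proj)
      (bundleChart x₀ v).2 := by
  rw [bundleChart_apply]
  exact (g.metricCoeff_tangentCoord (v := ⟨v.proj, g.timeField v.proj⟩) (w := v) h rfl).symm

theorem continuousOn_timeCoord (x₀ : M) :
    ContinuousOn (g.timeCoord x₀) (extChartAt (𝓡∂ n) x₀).source := by
  have h1 : Continuous (fun x : M ↦ (⟨x, g.timeField x⟩ : TangentBundle (𝓡∂ n) M)) :=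
    g.timeField_contMDiff.continuous
  have h2 := (continuousOn_bundleChart x₀).comp h1.continuousOn
    (s := (extChartAt (𝓡∂ n) x₀).source) fun x hx ↦ mem_bundleChart_source.2 hx
  refine h2.snd.congr fun x _ ↦ ?_
  change _ = (bundleChart x₀ (⟨x, g.timeField x⟩ : TangentBundle (𝓡∂ n) M)).2
  rw [bundleChart_apply]
  rfl

theorem continuousOn_metricCoeff (x₀ : M) :
    ContinuousOn (fun x ↦ g.metricCoeff x₀ (extChartAt (𝓡∂ n) x₀ x))
      (extChartAt (𝓡∂ n) x₀).source :=
  (g.contDiffOn_metricCoeff x₀).continuousOn.comp (continuousOn_extChartAt x₀)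
    (extChartAt (𝓡∂ n) x₀).mapsTo

theorem continuous_normSq : Continuous g.normSq := by
  rw [continuous_iff_continuousAt]
  intro v
  have hc := continuousOn_bundleChart (n := n) v.proj
  have h1 : ContinuousOn (fun w : TangentBundle (𝓡∂ n) M ↦
      g.metricCoeff v.proj (bundleChart v.proj w).1)
      (bundleChart v.proj : PartialEquiv (TangentBundle (𝓡∂ n) M) _).source :=
    (g.contDiffOn_metricCoeff v.proj).continuousOn.comp hc.fst fun w hw ↦ by
      have := (bundleChart v.proj).map_source hw
      rw [bundleChart_target] at this; exact this.1
  have h2 := ((h1.clm_apply hc.snd).clm_apply hc.snd).congr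
    (fun w hw ↦ g.normSq_eq_chart (mem_bundleChart_source.1 hw))
  exact h2.continuousAt ((isOpen_bundleChart_source _).mem_nhds (mem_bundleChart_source_self v))

theorem continuous_timePairing : Continuous g.timePairing := by
  rw [continuous_iff_continuousAt]
  intro v
  have hc := continuousOn_bundleChart (n := n) v.proj
  have h1 : ContinuousOn (fun w : TangentBundle (𝓡∂ n) M ↦
      g.metricCoeff v.proj (bundleChart v.proj w).1)
      (bundleChart v.proj : PartialEquiv (TangentBundle (𝓡∂ n) M) _).source :=
    (g.contDiffOn_metricCoeff v.proj).continuousOn.comp hc.fst fun w hw ↦ by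
      have := (bundleChart v.proj).map_source hw
      rw [bundleChart_target] at this; exact this.1
  have h3 : ContinuousOn (fun w : TangentBundle (𝓡∂ n) M ↦ g.timeCoord v.proj w.proj)
      (bundleChart v.proj : PartialEquiv (TangentBundle (𝓡∂ n) M) _).source :=
    (g.continuousOn_timeCoord v.proj).comp continuous_proj.continuousOn
      fun w hw ↦ mem_bundleChart_source.1 hw
  have h2 := ((h1.clm_apply h3).clm_apply hc.snd).congr
    (fun w hw ↦ g.timePairing_eq_chart (mem_bundleChart_source.1 hw))
  exact h2.continuousAt ((isOpen_bundleChart_source _).mem_nhds (mem_bundleChart_source_self v))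

theorem continuous_causalNorm : Continuous g.causalNorm :=
  Real.continuous_sqrt.comp continuous_normSq.neg

end Continuity

section Conservation

variable {g}

theorem IsGeodesicOn.normSq_eq {V : ℝ → TangentBundle (𝓡∂ n) M} {a b : ℝ}
    (hV : g.IsGeodesicOn V (Icc a b)) {s t : ℝ} (hs : s ∈ Icc a b) (ht : t ∈ Icc a b) :
    g.normSq (V s) = g.normSq (V t) := by
  have hder : ∀ t ∈ Icc a b, HasDerivWithinAt (fun s ↦ g.normSq (V s)) 0 (Icc a b) t := by
    intro t ht
    set x₀ := (V t).proj with hx₀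
    have hsrc : (V t).proj ∈ (extChartAt (𝓡∂ n) x₀).source := mem_extChartAt_source _
    have hT : (bundleChart x₀ (V t)).1 ∈ (extChartAt (𝓡∂ n) x₀).target := by
      rw [bundleChart_apply]; exact (extChartAt (𝓡∂ n) x₀).map_source hsrc
    have hd := hV.hasDerivWithinAt ht hsrc
    set p := bundleChart x₀ (V t) with hp
    have hd1 : HasDerivWithinAt (fun s ↦ (bundleChart x₀ (V s)).1) (g.geodesicField x₀ p).1
      (Icc a b) t := hd.fst
    have hd2 : HasDerivWithinAt (fun s ↦ (bundleChart x₀ (V s)).2) (g.geodesicField x₀ p).2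
      (Icc a b) t := hd.snd
    have hG : HasFDerivWithinAt (g.metricCoeff x₀) (g.metricDeriv x₀ p.1) (range (𝓡∂ n))
      ((fun s ↦ (bundleChart x₀ (V s)).1) t) := g.hasFDerivWithinAt_metricCoeff hT
    have hm : MapsTo (fun s ↦ (bundleChart x₀ (V s)).1) (Icc a b) (range (𝓡∂ n)) := fun s _ ↦ by
      rw [range_model]; exact bundleChart_nonneg _ _
    have h1 := HasFDerivWithinAt.comp_hasDerivWithinAt t hG hd1 hm
    have h2 := (h1.clm_apply hd2).clm_apply hd2
    have hev : (fun s ↦ g.normSq (V s)) =ᶠ[𝓝[Icc a b] t] fun s ↦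
        (g.metricCoeff x₀ ∘ fun s ↦ (bundleChart x₀ (V s)).1) s (bundleChart x₀ (V s)).2
          (bundleChart x₀ (V s)).2 := by
      have : ContinuousWithinAt (fun s ↦ (V s).proj) (Icc a b) t :=
        continuous_proj.continuousAt.comp_continuousWithinAt (hV.2.1 t ht)
      filter_upwards [this.eventually ((isOpen_extChartAt_source (I := 𝓡∂ n) x₀).mem_nhds hsrc)]
        with s hs
      exact normSq_eq_chart hs
    refine (h2.congr_of_eventuallyEq hev (hev.self_of_nhdsWithin ht)).congr_deriv ?_
    have hEL := (g.geodesicField_snd_iff hT).1 rfl p.2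
    rw [christoffelForm_apply] at hEL
    have e1 : (g.geodesicField x₀ p).1 = p.2 := rfl
    have e2 := g.metricCoeff_symm x₀ p.1 p.2 (g.geodesicField x₀ p).2
    simp only [add_apply, Function.comp_apply, ← hp, e1, e2]
    linarith
  have hc : ContinuousOn (fun s ↦ g.normSq (V s)) (Icc a b) :=
    continuous_normSq.comp_continuousOn hV.2.1
  have := constant_of_has_deriv_right_zero hc fun t ht ↦
    (hder t ⟨ht.1, ht.2.le⟩).mono_of_mem_nhdsWithin (Icc_mem_nhdsGE_of_mem ht)
  rw [this s hs, this t ht]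

/-- Geodesics are determined by their initial vectors. -/
theorem IsGeodesicOn.eq_of_initial [T2Space M] {V W : ℝ → TangentBundle (𝓡∂ n) M} {a : ℝ}
    (hV : g.IsGeodesicOn V (Icc 0 a)) (hW : g.IsGeodesicOn W (Icc 0 a)) (h : V 0 = W 0) :
    ∀ t ∈ Icc 0 a, V t = W t := by
  intro t ht
  have hsub : Icc 0 t ⊆ Icc 0 a := Icc_subset_Icc_right ht.2
  have hK : IsCompact (V '' Icc 0 a ∪ W '' Icc 0 a) :=
    (isCompact_Icc.image_of_continuousOn hV.2.1).union (isCompact_Icc.image_of_continuousOn hW.2.1)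
  obtain ⟨Z, -, -, hZ, -⟩ := tendsto_geodesic_of_isCompact (g := g) (l := (⊤ : Filter Bool)) hK
    (V := fun i ↦ if i then V else W) (s := fun _ ↦ t) (s₀ := t) (z := V 0)
    (Eventually.of_forall fun _ ↦ ht.1)
    (Eventually.of_forall fun i ↦ by
      cases i
      · simpa using hW.mono hsub ordConnected_Icc
      · simpa using hV.mono hsub ordConnected_Icc)
    (Eventually.of_forall fun i s hs ↦ by
      cases i
      · exact Or.inr ⟨s, hsub hs, rfl⟩
      · exact Or.inl ⟨s, hsub hs, rfl⟩)
    (by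
      refine tendsto_const_nhds.congr fun i ↦ ?_
      cases i
      · simpa using h
      · rfl) tendsto_const_nhds
  have h1 : Tendsto (fun _ : Bool ↦ V t) (pure true) (𝓝 (Z t)) := by
    refine (hZ.mono_left le_top).congr' ?_
    rw [EventuallyEq, eventually_pure]; rfl
  have h2 : Tendsto (fun _ : Bool ↦ W t) (pure false) (𝓝 (Z t)) := by
    refine (hZ.mono_left le_top).congr' ?_
    rw [EventuallyEq, eventually_pure]; rfl
  rw [tendsto_const_nhds_iff] at h1 h2
  rw [h1, h2]

theorem vscale_zero_isGeodesicOn (z : TangentBundle (𝓡∂ n) M) (hz : z.2 = 0) (J : Set ℝ)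
    (hJ : J.OrdConnected) : g.IsGeodesicOn (fun _ ↦ z) J := by
  rw [isGeodesicOn_iff]
  refine ⟨hJ, continuousOn_const, fun t _ ↦ ?_⟩
  have h0 : g.geodesicField z.proj (bundleChart z.proj z) = 0 := by
    have h1 : vscale 0 z = z := by
      rw [vscale, zero_smul, ← hz]
    have h2 := bundleChart_vscale (v := z) 0 (mem_extChartAt_source (I := 𝓡∂ n) z.proj)
    rw [h1, zero_smul] at h2
    have h3 := geodesicField_smul (g := g) z.proj (bundleChart z.proj z).1 0 0
    rw [smul_zero] at h3
    rw [h2, h3]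
    simp
  rw [h0]
  exact hasDerivWithinAt_const _ _ _

/-- A geodesic with a vanishing velocity is constant. -/
theorem IsGeodesicOn.snd_ne_zero [T2Space M] {V : ℝ → TangentBundle (𝓡∂ n) M} {a b : ℝ}
    (hV : g.IsGeodesicOn V (Icc a b)) {s t : ℝ} (hs : s ∈ Icc a b) (ht : t ∈ Icc a b)
    (h : (V s).2 ≠ 0) : (V t).2 ≠ 0 := by
  intro h0
  apply h
  rcases le_total t s with hts | hst
  · have h1 := hV.shift t (a' := 0) (b' := s - t) (by linarith [ht.1]) (by linarith [hs.2])
    have h2 := h1.eq_of_initial (vscale_zero_isGeodesicOn (V t) h0 _ ordConnected_Icc)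
      (by simp) (s - t) ⟨by linarith, le_rfl⟩
    simp only [sub_add_cancel] at h2
    rw [h2]; exact h0
  · have h1 := hV.reverse t (a' := 0) (b' := t - s) (by linarith [hs.1]) (by linarith [ht.2])
    have h0' : (vscale (-1) (V t)).2 = 0 := by
      change (-1 : ℝ) • (V t).2 = 0
      rw [h0, smul_zero]
    have h2 := h1.eq_of_initial (vscale_zero_isGeodesicOn (vscale (-1) (V t)) h0' _
      ordConnected_Icc) (by simp) (t - s) ⟨by linarith, le_rfl⟩
    simp only [sub_sub_cancel] at h2
    have h3 := congrArg (vscale (-1)) h2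
    rw [vscale_vscale, vscale_vscale] at h3
    norm_num [vscale_one] at h3
    rw [h3]; exact h0

theorem IsGeodesicOn.isCausal [T2Space M] {V : ℝ → TangentBundle (𝓡∂ n) M} {a b : ℝ}
    (hV : g.IsGeodesicOn V (Icc a b)) {s t : ℝ} (hs : s ∈ Icc a b) (ht : t ∈ Icc a b)
    (h : g.IsCausal (V s)) : g.IsCausal (V t) := by
  rw [isCausal_iff] at h ⊢
  exact ⟨hV.snd_ne_zero hs ht h.1, by rw [hV.normSq_eq ht hs]; exact h.2⟩

theorem IsGeodesicOn.isLightlike [T2Space M] {V : ℝ → TangentBundle (𝓡∂ n) M} {a b : ℝ}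
    (hV : g.IsGeodesicOn V (Icc a b)) {s t : ℝ} (hs : s ∈ Icc a b) (ht : t ∈ Icc a b)
    (h : g.IsLightlike (V s)) : g.IsLightlike (V t) :=
  ⟨hV.snd_ne_zero hs ht h.1, by rw [hV.normSq_eq ht hs]; exact h.2⟩

theorem IsGeodesicOn.isTimelike {V : ℝ → TangentBundle (𝓡∂ n) M} {a b : ℝ}
    (hV : g.IsGeodesicOn V (Icc a b)) {s t : ℝ} (hs : s ∈ Icc a b) (ht : t ∈ Icc a b)
    (h : g.IsTimelike (V s)) : g.IsTimelike (V t) := by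
  rw [IsTimelike, hV.normSq_eq ht hs]; exact h

/-- A causal geodesic remains future-directed. -/
theorem IsGeodesicOn.timePairing_neg [T2Space M] {V : ℝ → TangentBundle (𝓡∂ n) M} {a b : ℝ}
    (hV : g.IsGeodesicOn V (Icc a b)) {s t : ℝ} (hs : s ∈ Icc a b) (ht : t ∈ Icc a b)
    (h : g.IsCausal (V s)) (hneg : g.timePairing (V s) < 0) : g.timePairing (V t) < 0 := by
  by_contra hcon
  push Not at hcon
  have hc : ContinuousOn (fun r ↦ g.timePairing (V r)) (Icc a b) :=
    continuous_timePairing.comp_continuousOn hV.2.1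
  obtain ⟨r, hr, h0⟩ := (isPreconnected_Icc.intermediate_value hs ht hc) ⟨hneg.le, hcon⟩
  exact (hV.isCausal hs hr h).timePairing_ne_zero h0

end Conservation

section Smooth

variable {g}

theorem IsGeodesicOn.contMDiffOn {V : ℝ → TangentBundle (𝓡∂ n) M} {a b : ℝ} (hab : a < b)
    (hV : g.IsGeodesicOn V (Icc a b)) :
    ContMDiffOn 𝓘(ℝ, ℝ) (𝓡∂ n) ∞ (fun t ↦ (V t).proj) (Icc a b) := by
  intro t ht
  set x₀ := (V t).proj with hx₀
  have hsrc : (V t).proj ∈ (extChartAt (𝓡∂ n) x₀).source := mem_extChartAt_source _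
  have hc : ContinuousOn (fun s ↦ (V s).proj) (Icc a b) :=
    continuous_proj.comp_continuousOn hV.2.1
  obtain ⟨O, hO, htO, hOs⟩ := mem_nhdsWithin.1
    ((hc t ht).preimage_mem_nhdsWithin ((isOpen_extChartAt_source (I := 𝓡∂ n) x₀).mem_nhds hsrc))
  set J := Icc a b ∩ O with hJ
  have hU : UniqueDiffOn ℝ J := (uniqueDiffOn_Icc hab).inter hO
  set y : ℝ → Phase n := fun s ↦ bundleChart x₀ (V s) with hy
  have hJs : ∀ s ∈ J, (V s).proj ∈ (extChartAt (𝓡∂ n) x₀).source := fun s hs ↦ hOs ⟨hs.2, hs.1⟩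
  have hder : ∀ s ∈ J, HasDerivWithinAt y (g.geodesicField x₀ (y s)) J s := fun s hs ↦
    (hV.hasDerivWithinAt hs.1 (hJs s hs)).mono inter_subset_left
  have hmaps : MapsTo y J ((extChartAt (𝓡∂ n) x₀).target ×ˢ univ) := fun s hs ↦ by
    have := (bundleChart x₀).map_source (mem_bundleChart_source.2 (hJs s hs))
    rwa [bundleChart_target] at this
  have hk : ∀ k : ℕ, ContDiffOn ℝ k y J := by
    intro k
    induction k with
    | zero => exact contDiffOn_zero.2 (HasDerivWithinAt.continuousOn hder)
    | succ k ih =>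
      push_cast
      rw [contDiffOn_succ_iff_derivWithin hU]
      refine ⟨fun s hs ↦ (hder s hs).differentiableWithinAt, by simp, ?_⟩
      refine (((g.contDiffOn_geodesicField x₀).of_le (by
        exact_mod_cast le_top)).comp ih hmaps).congr fun s hs ↦ ?_
      exact (hder s hs).derivWithin (hU s hs)
  have hinf : ContDiffOn ℝ ∞ y J := contDiffOn_infty.2 hk
  have hJn : J ∈ 𝓝[Icc a b] t := inter_mem_nhdsWithin _ (hO.mem_nhds htO)
  rw [contMDiffWithinAt_iff_target]
  refine ⟨hc t ht, ?_⟩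
  rw [contMDiffWithinAt_iff_contDiffWithinAt]
  have h1 : ContDiffWithinAt ℝ ∞ (fun s ↦ (y s).1) (Icc a b) t :=
    (hinf t ⟨ht, htO⟩).fst.mono_of_mem_nhdsWithin hJn
  refine h1.congr (fun s _ ↦ ?_) ?_ <;> simp only [hy, bundleChart_apply, Function.comp_apply, hx₀]

theorem tangentCoord_self (v : TangentBundle (𝓡∂ n) M) : tangentCoord v.proj v = v.2 := by
  have h := symm_tangentCoord (x₀ := v.proj) (v := v) (mem_extChartAt_source _)
  exact tangentCoordChange_self (I := 𝓡∂ n) (x := v.proj) (z := v.proj) (v := v.2)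
    (mem_extChartAt_source _)

theorem IsGeodesicOn.mfderivWithin_eq {V : ℝ → TangentBundle (𝓡∂ n) M} {a b : ℝ} (hab : a < b)
    (hV : g.IsGeodesicOn V (Icc a b)) {t : ℝ} (ht : t ∈ Icc a b) :
    mfderivWithin 𝓘(ℝ, ℝ) (𝓡∂ n) (fun t ↦ (V t).proj) (Icc a b) t (1 : ℝ) = (V t).2 := by
  have hc : ContinuousOn (fun s ↦ (V s).proj) (Icc a b) :=
    continuous_proj.comp_continuousOn hV.2.1
  have hd := (hV.2.2 t ht).1
  rw [tangentCoord_self] at hd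
  have hm : HasMFDerivWithinAt 𝓘(ℝ, ℝ) (𝓡∂ n) (fun t ↦ (V t).proj) (Icc a b) t
      (ContinuousLinearMap.toSpanSingleton ℝ (V t).2) := by
    refine ⟨hc t ht, ?_⟩
    simpa [writtenInExtChartAt] using! hd.hasFDerivWithinAt
  have hu : UniqueMDiffWithinAt 𝓘(ℝ, ℝ) (Icc a b) t :=
    uniqueMDiffWithinAt_iff_uniqueDiffWithinAt.2 (uniqueDiffOn_Icc hab t ht)
  rw [hm.mfderivWithin hu]
  exact one_smul ℝ _

theorem IsGeodesicOn.isFutureCausalCurve [T2Space M] {V : ℝ → TangentBundle (𝓡∂ n) M} {a b : ℝ}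
    (hab : a < b) (hV : g.IsGeodesicOn V (Icc a b)) (hc : g.IsCausal (V a))
    (hf : g.timePairing (V a) < 0) : g.IsFutureCausalCurve (fun t ↦ (V t).proj) a b := by
  have hba : 0 < b - a := sub_pos.2 hab
  have e0 : a + ((0 : ℕ) : ℝ) * (b - a) = a := by push_cast; ring
  have e1 : a + ((1 : ℕ) : ℝ) * (b - a) = b := by push_cast; ring
  refine ⟨1, fun i ↦ a + i * (b - a), ?_, e0, e1, ?_⟩
  · intro i j hij
    have : (i : ℝ) < j := by exact_mod_cast hij
    dsimp only
    nlinarith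
  · intro i hi
    obtain rfl : i = 0 := by omega
    simp only [zero_add]
    rw [e0, e1]
    refine ⟨hV.contMDiffOn hab, fun t ht ↦ ?_⟩
    rw [hV.mfderivWithin_eq hab ht]
    have ha : a ∈ Icc a b := left_mem_Icc.2 hab.le
    exact ⟨hV.isCausal ha ht hc, hV.timePairing_neg ha ht hc hf⟩

end Smooth

end TimeOrientedLorentzianMetric

namespace TimeOrientedLorentzianMetric

variable {n : ℕ} [NeZero n] {M : Type*} [TopologicalSpace M]
  [ChartedSpace (EuclideanHalfSpace n) M] [IsManifold (𝓡∂ n) ∞ M]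

section LocalBounds

variable (g : TimeOrientedLorentzianMetric n M)

/-- The linear functional `-g(T, ·)` in the chart around `x₀`, frozen at `x₀`. -/
def timeFunctional (x₀ : M) : Model n →L[ℝ] ℝ :=
  -(g.metricCoeff x₀ (extChartAt (𝓡∂ n) x₀ x₀) (g.timeCoord x₀ x₀))

/-- Bounds, for unit coordinate vectors `u` at `x`, with constant `c`. -/
def UnitBounds (x₀ : M) (q : M × ℝ) (u : Model n) : Prop :=
  (g.metricCoeff x₀ (extChartAt (𝓡∂ n) x₀ q.1) u u ≤ 0 →
    g.metricCoeff x₀ (extChartAt (𝓡∂ n) x₀ q.1) (g.timeCoord x₀ q.1) u ≤ 0 →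
      q.2 < g.timeFunctional x₀ u ∧
      q.2 < -g.metricCoeff x₀ (extChartAt (𝓡∂ n) x₀ q.1) (g.timeCoord x₀ q.1) u) ∧
  q.2 * |g.timeFunctional x₀ u| < 1 ∧
  q.2 * |g.metricCoeff x₀ (extChartAt (𝓡∂ n) x₀ q.1) (g.timeCoord x₀ q.1) u| < 1 ∧
  q.2 * |g.timeFunctional x₀ (g.geodesicField x₀ (extChartAt (𝓡∂ n) x₀ q.1, u)).2| < 1

theorem _root_.BrokenLens.bundleChart_snd_eq_zero {x₀ : M} {v : TangentBundle (𝓡∂ n) M}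
    (hv : v.2 = 0) (h : v.proj ∈ (extChartAt (𝓡∂ n) x₀).source) : (bundleChart x₀ v).2 = 0 := by
  have h1 : vscale 0 v = v := by rw [vscale, zero_smul, ← hv]
  have h2 := congrArg Prod.snd (bundleChart_vscale 0 h)
  rw [h1] at h2
  exact h2.trans (zero_smul ℝ _)

theorem _root_.BrokenLens.exists_bundleChart_eq (x₀ : M) (u : Model n) :
    ∃ v : TangentBundle (𝓡∂ n) M, v.proj = x₀ ∧
      bundleChart x₀ v = (extChartAt (𝓡∂ n) x₀ x₀, u) := by
  have hy := mem_extChartAt_target (I := 𝓡∂ n) x₀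
  have hmem : (extChartAt (𝓡∂ n) x₀ x₀, u) ∈
      (bundleChart x₀ : PartialEquiv (TangentBundle (𝓡∂ n) M) _).target := by
    rw [bundleChart_target]; exact ⟨hy, mem_univ _⟩
  refine ⟨(bundleChart x₀).symm (extChartAt (𝓡∂ n) x₀ x₀, u), ?_, (bundleChart x₀).right_inv hmem⟩
  exact (bundleChart_symm_proj (p := (extChartAt (𝓡∂ n) x₀ x₀, u)) hy).trans
    (extChartAt_to_inv x₀)

theorem eventually_unitBounds (x₀ : M) {u : Model n} (hu : u ≠ 0) :
    ∀ᶠ z : (M × ℝ) × Model n in 𝓝 ((x₀, 0), u), g.UnitBounds x₀ z.1 z.2 := by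
  have hx₀ : (extChartAt (𝓡∂ n) x₀).source ∈ 𝓝 x₀ := extChartAt_source_mem_nhds x₀
  have hp : ContinuousAt (fun z : (M × ℝ) × Model n ↦ z.1.1) ((x₀, 0), u) :=
    continuousAt_fst.comp' continuousAt_fst
  have hG : ContinuousAt (fun z : (M × ℝ) × Model n ↦
      g.metricCoeff x₀ (extChartAt (𝓡∂ n) x₀ z.1.1)) ((x₀, 0), u) :=
    ContinuousAt.comp (f := fun z : (M × ℝ) × Model n ↦ z.1.1)
      (g := fun x ↦ g.metricCoeff x₀ (extChartAt (𝓡∂ n) x₀ x))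
      ((g.continuousOn_metricCoeff x₀).continuousAt hx₀) hp
  have hT : ContinuousAt (fun z : (M × ℝ) × Model n ↦ g.timeCoord x₀ z.1.1) ((x₀, 0), u) :=
    ContinuousAt.comp (f := fun z : (M × ℝ) × Model n ↦ z.1.1) (g := g.timeCoord x₀)
      ((g.continuousOn_timeCoord x₀).continuousAt hx₀) hp
  have hN : ContinuousAt (fun z : (M × ℝ) × Model n ↦
      g.metricCoeff x₀ (extChartAt (𝓡∂ n) x₀ z.1.1) z.2 z.2) ((x₀, 0), u) :=
    (hG.clm_apply continuousAt_snd).clm_apply continuousAt_snd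
  have htp : ContinuousAt (fun z : (M × ℝ) × Model n ↦
      g.metricCoeff x₀ (extChartAt (𝓡∂ n) x₀ z.1.1) (g.timeCoord x₀ z.1.1) z.2) ((x₀, 0), u) :=
    (hG.clm_apply hT).clm_apply continuousAt_snd
  have hL : ContinuousAt (fun z : (M × ℝ) × Model n ↦ g.timeFunctional x₀ z.2) ((x₀, 0), u) :=
    (g.timeFunctional x₀).continuous.continuousAt.comp' continuousAt_snd
  have hpair : ContinuousAt (fun z : M × Model n ↦
      (g.geodesicField x₀ (extChartAt (𝓡∂ n) x₀ z.1, z.2)).2) (x₀, u) := by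
    have h1 : ContinuousOn (fun z : M × Model n ↦
        (g.geodesicField x₀ (extChartAt (𝓡∂ n) x₀ z.1, z.2)))
        ((extChartAt (𝓡∂ n) x₀).source ×ˢ univ) :=
      (g.contDiffOn_geodesicField x₀).continuousOn.comp
        (((continuousOn_extChartAt x₀).comp continuousOn_fst fun z hz ↦ hz.1).prodMk
          continuousOn_snd) fun z hz ↦ ⟨(extChartAt (𝓡∂ n) x₀).map_source hz.1, mem_univ _⟩
    exact (h1.continuousAt (prod_mem_nhds hx₀ univ_mem)).snd
  have hF : ContinuousAt (fun z : (M × ℝ) × Model n ↦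
      g.timeFunctional x₀ (g.geodesicField x₀ (extChartAt (𝓡∂ n) x₀ z.1.1, z.2)).2)
      ((x₀, 0), u) :=
    (g.timeFunctional x₀).continuous.continuousAt.comp'
      (ContinuousAt.comp (f := fun z : (M × ℝ) × Model n ↦ (z.1.1, z.2))
        (g := fun z : M × Model n ↦ (g.geodesicField x₀ (extChartAt (𝓡∂ n) x₀ z.1, z.2)).2) hpair (hp.prodMk continuousAt_snd))
  have hc : ContinuousAt (fun z : (M × ℝ) × Model n ↦ z.1.2) ((x₀, 0), u) :=
    continuousAt_snd.comp' continuousAt_fst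
  have h0 : ∀ {f : (M × ℝ) × Model n → ℝ}, ContinuousAt f ((x₀, 0), u) →
      ∀ᶠ z in 𝓝 ((x₀, 0), u), z.1.2 * |f z| < 1 := fun hf ↦
    (hc.mul hf.abs).eventually_lt continuousAt_const (by simp)
  refine Eventually.and ?_ ((h0 hL).and ((h0 htp).and (h0 hF)))
  rcases lt_or_ge 0 (g.metricCoeff x₀ (extChartAt (𝓡∂ n) x₀ x₀) u u) with h1 | h1
  · filter_upwards [continuousAt_const.eventually_lt hN h1] with z hz hz'
    exact absurd hz' (not_le.2 hz)
  rcases lt_or_ge 0 (g.metricCoeff x₀ (extChartAt (𝓡∂ n) x₀ x₀) (g.timeCoord x₀ x₀) u)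
    with h2 | h2
  · filter_upwards [continuousAt_const.eventually_lt htp h2] with z hz _ hz'
    exact absurd hz' (not_le.2 hz)
  have h3 : g.metricCoeff x₀ (extChartAt (𝓡∂ n) x₀ x₀) (g.timeCoord x₀ x₀) u ≠ 0 := by
    obtain ⟨v, hvp, hvb⟩ := exists_bundleChart_eq x₀ u
    have hvs : v.proj ∈ (extChartAt (𝓡∂ n) x₀).source := by
      rw [hvp]; exact mem_extChartAt_source x₀
    have hcv : g.IsCausal v := by
      refine g.isCausal_iff.2 ⟨fun hv0 ↦ hu ?_, ?_⟩
      · rw [← bundleChart_snd_eq_zero hv0 hvs, hvb]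
      · rw [g.normSq_eq_chart hvs, hvb]; exact h1
    have := hcv.timePairing_ne_zero
    rwa [g.timePairing_eq_chart hvs, hvb, hvp] at this
  have h4 : g.metricCoeff x₀ (extChartAt (𝓡∂ n) x₀ x₀) (g.timeCoord x₀ x₀) u < 0 :=
    lt_of_le_of_ne h2 h3
  have e1 : (0 : ℝ) < g.timeFunctional x₀ u := by
    rw [timeFunctional, _root_.neg_apply]; linarith
  filter_upwards [hc.eventually_lt hL e1, hc.eventually_lt htp.neg (neg_pos.2 h4)]
    with z hz1 hz2 _ _ using ⟨hz1, hz2⟩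

theorem exists_coord_bounds (x₀ : M) : ∃ U ∈ 𝓝 x₀, U ⊆ (extChartAt (𝓡∂ n) x₀).source ∧
    ∃ c : ℝ, 0 < c ∧ ∀ v : TangentBundle (𝓡∂ n) M, v.proj ∈ U → g.normSq v ≤ 0 →
      g.timePairing v ≤ 0 →
      c * ‖(bundleChart x₀ v).2‖ ≤ g.timeFunctional x₀ (bundleChart x₀ v).2 ∧
      c * ‖(bundleChart x₀ v).2‖ ≤ -g.timePairing v ∧
      c * |g.timeFunctional x₀ (bundleChart x₀ v).2| ≤ ‖(bundleChart x₀ v).2‖ ∧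
      c * |g.timePairing v| ≤ ‖(bundleChart x₀ v).2‖ ∧
      c * |g.timeFunctional x₀ (g.geodesicField x₀ (bundleChart x₀ v)).2| ≤
        ‖(bundleChart x₀ v).2‖ ^ 2 := by
  have h := (isCompact_sphere (0 : Model n) 1).eventually_forall_of_forall_eventually
    (x₀ := (x₀, (0 : ℝ))) (P := g.UnitBounds x₀)
    fun u hu ↦ g.eventually_unitBounds x₀ (ne_zero_of_mem_unit_sphere ⟨u, hu⟩)
  rw [nhds_prod_eq, eventually_prod_iff] at h
  obtain ⟨pa, ha, pb, hb, hab⟩ := h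
  obtain ⟨c, hc, hc0⟩ := ((hb.filter_mono nhdsWithin_le_nhds : ∀ᶠ c in 𝓝[>] (0 : ℝ), pb c).and
    self_mem_nhdsWithin).exists
  refine ⟨{x | pa x} ∩ (extChartAt (𝓡∂ n) x₀).source,
    inter_mem ha (extChartAt_source_mem_nhds x₀), inter_subset_right, c, hc0, ?_⟩
  intro v hv hN htp
  have hvs := hv.2
  rw [g.normSq_eq_chart hvs] at hN
  rw [g.timePairing_eq_chart hvs] at htp ⊢
  have hfst : (bundleChart x₀ v).1 = extChartAt (𝓡∂ n) x₀ v.proj := by rw [bundleChart_apply]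
  set z := bundleChart x₀ v with hz
  obtain ⟨y, u⟩ := z
  simp only at hfst hN htp ⊢
  rcases eq_or_ne u 0 with rfl | hu
  · have h5 : (g.geodesicField x₀ (y, 0)).2 = 0 := by
      have h6 := congrArg Prod.snd (g.geodesicField_smul x₀ y 0 0)
      rw [smul_zero] at h6
      exact h6.trans (by rw [zero_pow two_ne_zero, zero_smul])
    rw [h5]
    simp only [map_zero, norm_zero, abs_zero, mul_zero, neg_zero, le_refl, true_and]
    norm_num
  have hr : 0 < ‖u‖ := norm_pos_iff.2 hu
  set w : Model n := ‖u‖⁻¹ • u with hw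
  have huw : u = ‖u‖ • w := by rw [hw, smul_smul, mul_inv_cancel₀ hr.ne', one_smul]
  have hws : w ∈ Metric.sphere (0 : Model n) 1 := by
    rw [mem_sphere_zero_iff_norm, hw, norm_smul, norm_inv, norm_norm, inv_mul_cancel₀ hr.ne']
  obtain ⟨h1, h2, h3, h4⟩ := hab hv.1 hc w hws
  simp only [← hfst] at h1 h3 h4
  set r := ‖u‖ with hrdef
  rw [huw] at hN htp
  simp only [map_smul, smul_apply, smul_eq_mul] at hN htp
  have hN' : g.metricCoeff x₀ y w w ≤ 0 := by
    by_contra hcon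
    push Not at hcon
    exact absurd hN (not_le.2 (by positivity))
  have htp' : g.metricCoeff x₀ y (g.timeCoord x₀ v.proj) w ≤ 0 := by
    by_contra hcon
    push Not at hcon
    exact absurd htp (not_le.2 (by positivity))
  obtain ⟨h5, h6⟩ := h1 hN' htp'
  rw [huw, geodesicField_smul]
  simp only [map_smul, smul_eq_mul, abs_mul, abs_of_pos hr, abs_of_pos (pow_pos hr 2)]
  refine ⟨?_, ?_, ?_, ?_, ?_⟩
  · nlinarith
  · nlinarith
  · nlinarith
  · nlinarith
  · nlinarith [pow_pos hr 2]

end LocalBounds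

end TimeOrientedLorentzianMetric

/-- The values of `f` on `J` are comparable, and bounded by the inverse length of `J`, with
constant `C`. -/
def HarnackOn (C : ℝ) (f : ℝ → ℝ) (J : Set ℝ) : Prop :=
  (∀ t ∈ J, ∀ t' ∈ J, f t ≤ C * f t') ∧ ∀ r ∈ J, ∀ r' ∈ J, ∀ t ∈ J, |r - r'| * f t ≤ C

theorem HarnackOn.mono_const {C C' : ℝ} {f : ℝ → ℝ} {J : Set ℝ} (h : HarnackOn C f J)
    (hCC : C ≤ C') (hf : ∀ t ∈ J, 0 ≤ f t) : HarnackOn C' f J :=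
  ⟨fun t ht t' ht' ↦ (h.1 t ht t' ht').trans (mul_le_mul_of_nonneg_right hCC (hf t' ht')),
    fun r hr r' hr' t ht ↦ (h.2 r hr r' hr' t ht).trans hCC⟩

theorem HarnackOn.comp_comparable {C c : ℝ} {f m : ℝ → ℝ} {J : Set ℝ} (h : HarnackOn C m J)
    (hC : 0 ≤ C) (hc : 1 ≤ c) (h1 : ∀ t ∈ J, f t ≤ c * m t) (h2 : ∀ t ∈ J, m t ≤ c * f t) :
    HarnackOn (c * C * c) f J := by
  refine ⟨fun t ht t' ht' ↦ ?_, fun r hr r' hr' t ht ↦ ?_⟩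
  · calc f t ≤ c * m t := h1 t ht
      _ ≤ c * (C * (c * f t')) := by
        gcongr
        exact (h.1 t ht t' ht').trans (mul_le_mul_of_nonneg_left (h2 t' ht') hC)
      _ = _ := by ring
  · calc |r - r'| * f t ≤ |r - r'| * (c * m t) :=
        mul_le_mul_of_nonneg_left (h1 t ht) (abs_nonneg _)
      _ = c * (|r - r'| * m t) := by ring
      _ ≤ c * C := mul_le_mul_of_nonneg_left (h.2 r hr r' hr' t ht) (by linarith)
      _ ≤ c * C * c := le_mul_of_one_le_right (by positivity) hc

theorem HarnackOn.of_deriv {B : ℝ} {h m μ : ℝ → ℝ} {J : Set ℝ} (hJ : J.OrdConnected) (hB : 0 ≤ B)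
    (hh : ∀ t ∈ J, HasDerivWithinAt h (m t) J t) (hm : ∀ t ∈ J, HasDerivWithinAt m (μ t) J t)
    (hm0 : ∀ t ∈ J, 0 ≤ m t) (hμ : ∀ t ∈ J, |μ t| ≤ B * m t ^ 2) (hh1 : ∀ t ∈ J, |h t| ≤ 1) :
    HarnackOn (2 * Real.exp (2 * B)) m J := by
  have hint : interior J ⊆ J := interior_subset
  have key : ∀ σ : ℝ, (σ = 1 ∨ σ = -1) → ∀ t ∈ J,
      HasDerivWithinAt (fun s ↦ m s * Real.exp (σ * B * h s))
        (μ t * Real.exp (σ * B * h t) + m t * (Real.exp (σ * B * h t) * (σ * B * m t))) J t :=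
    fun σ _ t ht ↦ (hm t ht).mul (((hh t ht).const_mul (σ * B)).exp)
  have hmono : MonotoneOn (fun s ↦ m s * Real.exp (1 * B * h s)) J := by
    refine monotoneOn_of_hasDerivWithinAt_nonneg hJ.convex
      (fun t ht ↦ (key 1 (Or.inl rfl) t ht).continuousWithinAt)
      (fun t ht ↦ (key 1 (Or.inl rfl) t (hint ht)).mono hint) fun t ht ↦ ?_
    have h1 := (abs_le.1 (hμ t (hint ht))).1
    have h2 := Real.exp_pos (1 * B * h t)
    have : 0 ≤ Real.exp (1 * B * h t) * (μ t + B * m t ^ 2) :=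
      mul_nonneg h2.le (by linarith)
    linarith
  have hanti : AntitoneOn (fun s ↦ m s * Real.exp (-1 * B * h s)) J := by
    refine antitoneOn_of_hasDerivWithinAt_nonpos hJ.convex
      (fun t ht ↦ (key (-1) (Or.inr rfl) t ht).continuousWithinAt)
      (fun t ht ↦ (key (-1) (Or.inr rfl) t (hint ht)).mono hint) fun t ht ↦ ?_
    have h1 := (abs_le.1 (hμ t (hint ht))).2
    have h2 := Real.exp_pos (-1 * B * h t)
    have : 0 ≤ Real.exp (-1 * B * h t) * (B * m t ^ 2 - μ t) :=
      mul_nonneg h2.le (by linarith)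
    linarith
  have hcomp : ∀ t ∈ J, ∀ t' ∈ J, m t ≤ Real.exp (2 * B) * m t' := by
    intro t ht t' ht'
    have b1 := abs_le.1 (hh1 t ht)
    have b2 := abs_le.1 (hh1 t' ht')
    have aux : ∀ σ : ℝ, (σ = 1 ∨ σ = -1) →
        m t * Real.exp (σ * B * h t) ≤ m t' * Real.exp (σ * B * h t') →
        m t ≤ Real.exp (2 * B) * m t' := by
      intro σ hσ hle
      have h3 : m t ≤ m t' * Real.exp (σ * B * h t' - σ * B * h t) := by
        rw [Real.exp_sub, mul_div_assoc', le_div_iff₀ (Real.exp_pos _)]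
        exact hle
      refine h3.trans ?_
      rw [mul_comm]
      refine mul_le_mul_of_nonneg_right (Real.exp_le_exp.2 ?_) (hm0 t' ht')
      rcases hσ with rfl | rfl <;> nlinarith
    rcases le_total t t' with htt | htt
    · exact aux 1 (Or.inl rfl) (hmono ht ht' htt)
    · exact aux (-1) (Or.inr rfl) (hanti ht' ht htt)
  have he := Real.exp_pos (2 * B)
  refine ⟨fun t ht t' ht' ↦ ?_, ?_⟩
  · have := hcomp t ht t' ht'
    have := mul_nonneg he.le (hm0 t' ht')
    linarith
  have hlen : ∀ r ∈ J, ∀ r' ∈ J, r ≤ r' → ∀ t ∈ J, (r' - r) * m t ≤ 2 * Real.exp (2 * B) := by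
    intro r hr r' hr' hrr t ht
    have hmn : MonotoneOn (fun s ↦ Real.exp (2 * B) * h s - m t * s) J := by
      have hd : ∀ s ∈ J, HasDerivWithinAt (fun s ↦ Real.exp (2 * B) * h s - m t * s)
          (Real.exp (2 * B) * m s - m t * 1) J s := fun s hs ↦
        ((hh s hs).const_mul _).sub ((hasDerivWithinAt_id s J).const_mul _)
      refine monotoneOn_of_hasDerivWithinAt_nonneg hJ.convex
        (fun s hs ↦ (hd s hs).continuousWithinAt)
        (fun s hs ↦ (hd s (hint hs)).mono hint) fun s hs ↦ ?_
      have := hcomp t ht s (hint hs)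
      linarith
    have h1 := hmn hr hr' hrr
    simp only at h1
    have b1 := abs_le.1 (hh1 r hr)
    have b2 := abs_le.1 (hh1 r' hr')
    nlinarith
  intro r hr r' hr' t ht
  rcases le_total r r' with hrr | hrr
  · rw [abs_sub_comm, abs_of_nonneg (sub_nonneg.2 hrr)]; exact hlen r hr r' hr' hrr t ht
  · rw [abs_of_nonneg (sub_nonneg.2 hrr)]; exact hlen r' hr' r hr hrr t ht

theorem HarnackOn.insert_closure {C : ℝ} {f : ℝ → ℝ} {J S : Set ℝ} (h : HarnackOn C f J)
    (hf : ContinuousOn f S) (hJS : J ⊆ S) {τ : ℝ} (hτ : τ ∈ S) (hτJ : τ ∈ closure J) :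
    (∀ t ∈ J, f t ≤ C * f τ ∧ f τ ≤ C * f t) ∧ ∀ r ∈ J, ∀ t ∈ J, |r - τ| * f t ≤ C := by
  have hw : ContinuousWithinAt f J τ := (hf τ hτ).mono hJS
  refine ⟨fun t ht ↦ ⟨?_, ?_⟩, fun r hr t ht ↦ ?_⟩
  · exact ContinuousWithinAt.closure_le hτJ continuousWithinAt_const
      (continuousWithinAt_const.mul hw) fun y hy ↦ h.1 t ht y hy
  · exact ContinuousWithinAt.closure_le hτJ hw continuousWithinAt_const fun y hy ↦ h.1 y hy t ht
  · exact ContinuousWithinAt.closure_le hτJ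
      (((continuousWithinAt_const.sub continuousWithinAt_id).abs).mul continuousWithinAt_const)
      continuousWithinAt_const fun y hy ↦ h.2 r hr y hy t ht

theorem HarnackOn.union {C₁ C₂ : ℝ} {f : ℝ → ℝ} {J₁ J₂ S : Set ℝ} (h₁ : HarnackOn C₁ f J₁)
    (h₂ : HarnackOn C₂ f J₂) (hC₁ : 1 ≤ C₁) (hC₂ : 1 ≤ C₂) (hf : ContinuousOn f S)
    (hf0 : ∀ t ∈ S, 0 ≤ f t) (hJ₁ : J₁ ⊆ S) (hJ₂ : J₂ ⊆ S) (hJ : (J₁ ∪ J₂).OrdConnected) :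
    HarnackOn (2 * C₁ * C₂) f (J₁ ∪ J₂) := by
  have hCC : 1 ≤ C₁ * C₂ := one_le_mul_of_one_le_of_one_le hC₁ hC₂
  have e1 : C₁ ≤ 2 * C₁ * C₂ := by nlinarith
  have e2 : C₂ ≤ 2 * C₁ * C₂ := by nlinarith
  rcases J₁.eq_empty_or_nonempty with rfl | hne₁
  · rw [empty_union]; exact h₂.mono_const e2 fun t ht ↦ hf0 t (hJ₂ ht)
  rcases J₂.eq_empty_or_nonempty with rfl | hne₂
  · rw [union_empty]; exact h₁.mono_const e1 fun t ht ↦ hf0 t (hJ₁ ht)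
  obtain ⟨τ, hτ, hτ₁, hτ₂⟩ := isPreconnected_closed_iff.1 hJ.isPreconnected (closure J₁) (closure J₂)
    isClosed_closure isClosed_closure (union_subset_union subset_closure subset_closure)
    (by obtain ⟨x, hx⟩ := hne₁; exact ⟨x, Or.inl hx, subset_closure hx⟩)
    (by obtain ⟨x, hx⟩ := hne₂; exact ⟨x, Or.inr hx, subset_closure hx⟩)
  have hτS : τ ∈ S := union_subset hJ₁ hJ₂ hτ
  obtain ⟨a₁, b₁⟩ := h₁.insert_closure hf hJ₁ hτS hτ₁
  obtain ⟨a₂, b₂⟩ := h₂.insert_closure hf hJ₂ hτS hτ₂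
  have p0 := hf0 τ hτS
  have p1 : ∀ t ∈ J₁, 0 ≤ f t := fun t ht ↦ hf0 t (hJ₁ ht)
  have p2 : ∀ t ∈ J₂, 0 ≤ f t := fun t ht ↦ hf0 t (hJ₂ ht)
  have c1 : ∀ t ∈ J₁, ∀ t' ∈ J₂, f t ≤ C₁ * C₂ * f t' ∧ f t' ≤ C₁ * C₂ * f t := by
    intro t ht t' ht'
    have h1 := (a₁ t ht).1
    have h2 := (a₁ t ht).2
    have h3 := (a₂ t' ht').1
    have h4 := (a₂ t' ht').2
    constructor <;> nlinarith
  have q1 : ∀ t ∈ J₁, ∀ r ∈ J₁, |r - τ| * f t ≤ C₁ * C₂ := fun t ht r hr ↦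
    (b₁ r hr t ht).trans (by nlinarith)
  have q2 : ∀ t ∈ J₂, ∀ r ∈ J₂, |r - τ| * f t ≤ C₁ * C₂ := fun t ht r hr ↦
    (b₂ r hr t ht).trans (by nlinarith)
  have q3 : ∀ t ∈ J₂, ∀ r ∈ J₁, |r - τ| * f t ≤ C₁ * C₂ := by
    intro t ht r hr
    have h1 : |r - τ| * f τ ≤ C₁ := by
      refine ContinuousWithinAt.closure_le hτ₁ (continuousWithinAt_const.mul ((hf τ hτS).mono hJ₁))
        continuousWithinAt_const fun y hy ↦ b₁ r hr y hy
    have h2 := (a₂ t ht).1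
    calc |r - τ| * f t ≤ |r - τ| * (C₂ * f τ) := mul_le_mul_of_nonneg_left h2 (abs_nonneg _)
      _ = C₂ * (|r - τ| * f τ) := by ring
      _ ≤ C₂ * C₁ := mul_le_mul_of_nonneg_left h1 (by linarith)
      _ = _ := by ring
  have q4 : ∀ t ∈ J₁, ∀ r ∈ J₂, |r - τ| * f t ≤ C₁ * C₂ := by
    intro t ht r hr
    have h1 : |r - τ| * f τ ≤ C₂ := by
      refine ContinuousWithinAt.closure_le hτ₂ (continuousWithinAt_const.mul ((hf τ hτS).mono hJ₂))
        continuousWithinAt_const fun y hy ↦ b₂ r hr y hy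
    have h2 := (a₁ t ht).1
    calc |r - τ| * f t ≤ |r - τ| * (C₁ * f τ) := mul_le_mul_of_nonneg_left h2 (abs_nonneg _)
      _ = C₁ * (|r - τ| * f τ) := by ring
      _ ≤ C₁ * C₂ := mul_le_mul_of_nonneg_left h1 (by linarith)
  have q : ∀ t ∈ J₁ ∪ J₂, ∀ r ∈ J₁ ∪ J₂, |r - τ| * f t ≤ C₁ * C₂ := by
    rintro t (ht | ht) r (hr | hr)
    exacts [q1 t ht r hr, q4 t ht r hr, q3 t ht r hr, q2 t ht r hr]
  refine ⟨?_, fun r hr r' hr' t ht ↦ ?_⟩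
  · rintro t (ht | ht) t' (ht' | ht')
    · exact (h₁.mono_const e1 p1).1 t ht t' ht'
    · have := (c1 t ht t' ht').1
      have := p2 t' ht'
      nlinarith
    · have := (c1 t' ht' t ht).2
      have := p1 t' ht'
      nlinarith
    · exact (h₂.mono_const e2 p2).1 t ht t' ht'
  · have h1 := q t ht r hr
    have h2 := q t ht r' hr'
    have h3 : 0 ≤ f t := hf0 t (union_subset hJ₁ hJ₂ ht)
    have h4 : |r - r'| ≤ |r - τ| + |r' - τ| := by
      rw [abs_sub_comm r' τ]; exact abs_sub_le r τ r'
    nlinarith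

namespace TimeOrientedLorentzianMetric

variable {n : ℕ} [NeZero n] {M : Type*} [TopologicalSpace M]
  [ChartedSpace (EuclideanHalfSpace n) M] [IsManifold (𝓡∂ n) ∞ M]

section GlobalBounds

variable (g : TimeOrientedLorentzianMetric n M)

/-- On the pieces in `S` of future-directed causal geodesics, the time component of the velocity
varies by a bounded factor, and the affine length is bounded. -/
def HasGeodesicBounds (S : Set M) : Prop :=
  ∃ C : ℝ, 1 ≤ C ∧ ∀ (V : ℝ → TangentBundle (𝓡∂ n) M) (a b : ℝ), g.IsGeodesicOn V (Icc a b) →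
    (∀ t ∈ Icc a b, g.IsCausal (V t) ∧ g.timePairing (V t) < 0) →
    ∀ J ⊆ Icc a b, J.OrdConnected → (∀ t ∈ J, (V t).proj ∈ S) →
      HarnackOn C (fun t ↦ -g.timePairing (V t)) J

variable {g}

theorem HasGeodesicBounds.mono {S S' : Set M} (h : g.HasGeodesicBounds S) (hS : S' ⊆ S) :
    g.HasGeodesicBounds S' := by
  obtain ⟨C, hC, h⟩ := h
  exact ⟨C, hC, fun V a b hV hc J hJ hJo hJS ↦ h V a b hV hc J hJ hJo fun t ht ↦ hS (hJS t ht)⟩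

theorem hasGeodesicBounds_empty : g.HasGeodesicBounds ∅ :=
  ⟨1, le_rfl, fun _ _ _ _ _ _ _ _ hJS ↦
    ⟨fun t ht ↦ (hJS t ht).elim, fun t ht ↦ (hJS t ht).elim⟩⟩

theorem exists_hasGeodesicBounds (x₀ : M) : ∃ U ∈ 𝓝 x₀, g.HasGeodesicBounds U := by
  obtain ⟨U, hU, hUs, c, hc, hb⟩ := g.exists_coord_bounds x₀
  set L₀ := g.timeFunctional x₀ with hL₀
  have hcont : ContinuousAt (fun x ↦ L₀ (extChartAt (𝓡∂ n) x₀ x - extChartAt (𝓡∂ n) x₀ x₀)) x₀ :=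
    L₀.continuous.continuousAt.comp'
      ((continuousAt_extChartAt (I := 𝓡∂ n) x₀).sub continuousAt_const)
  have hsmall : ∀ᶠ x in 𝓝 x₀,
      |L₀ (extChartAt (𝓡∂ n) x₀ x - extChartAt (𝓡∂ n) x₀ x₀)| < 1 :=
    hcont.abs.eventually_lt continuousAt_const (by simp)
  refine ⟨_, inter_mem hU hsmall, ?_⟩
  set B := (c ^ 3)⁻¹ with hB
  set e := max 1 ((c ^ 2)⁻¹) with he
  have he1 : 1 ≤ e := le_max_left _ _
  have hexp := Real.exp_pos (2 * B)
  refine ⟨max 1 (e * (2 * Real.exp (2 * B)) * e), le_max_left _ _,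
    fun V a b hV hca J hJ hJo hJU ↦ ?_⟩
  refine HarnackOn.mono_const ?_ (le_max_right _ _) fun t ht ↦ by linarith [(hca t (hJ ht)).2]
  have hbt : ∀ t ∈ J, _ := fun t ht ↦ hb (V t) (hJU t ht).1
    (g.isCausal_iff.1 (hca t (hJ ht)).1).2 (hca t (hJ ht)).2.le
  have hder : ∀ t ∈ J, HasDerivWithinAt (fun s ↦ bundleChart x₀ (V s))
      (g.geodesicField x₀ (bundleChart x₀ (V t))) J t := fun t ht ↦
    (hV.hasDerivWithinAt (hJ ht) (hUs (hJU t ht).1)).mono hJ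
  have hm : HarnackOn (2 * Real.exp (2 * B)) (fun t ↦ L₀ (bundleChart x₀ (V t)).2) J := by
    refine HarnackOn.of_deriv (B := B)
      (h := fun t ↦ L₀ ((bundleChart x₀ (V t)).1 - extChartAt (𝓡∂ n) x₀ x₀))
      (μ := fun t ↦ L₀ (g.geodesicField x₀ (bundleChart x₀ (V t))).2) hJo (by positivity)
      (fun t ht ↦ ?_) (fun t ht ↦ ?_) (fun t ht ↦ ?_) (fun t ht ↦ ?_) fun t ht ↦ ?_
    · exact L₀.hasFDerivAt.comp_hasDerivWithinAt t
        (((hasFDerivAt_fst.comp_hasDerivWithinAt t (hder t ht))).sub_const _)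
    · exact L₀.hasFDerivAt.comp_hasDerivWithinAt t
        ((ContinuousLinearMap.snd ℝ (Model n) (Model n)).hasFDerivAt.comp_hasDerivWithinAt t
          (hder t ht))
    · have := (hbt t ht).1
      exact le_trans (by positivity) this
    · obtain ⟨h1, -, -, -, h5⟩ := hbt t ht
      have h6 : 0 ≤ c * ‖(bundleChart x₀ (V t)).2‖ := by positivity
      have h7 : (c * ‖(bundleChart x₀ (V t)).2‖) ^ 2 ≤ (L₀ (bundleChart x₀ (V t)).2) ^ 2 :=
        pow_le_pow_left₀ h6 h1 2
      rw [hB, inv_mul_eq_div, le_div_iff₀ (by positivity)]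
      calc |L₀ (g.geodesicField x₀ (bundleChart x₀ (V t))).2| * c ^ 3
          = c ^ 2 * (c * |L₀ (g.geodesicField x₀ (bundleChart x₀ (V t))).2|) := by ring
        _ ≤ c ^ 2 * ‖(bundleChart x₀ (V t)).2‖ ^ 2 := by gcongr
        _ = (c * ‖(bundleChart x₀ (V t)).2‖) ^ 2 := by ring
        _ ≤ _ := h7
    · have h1 := (hJU t ht).2
      have h2 : (bundleChart x₀ (V t)).1 = extChartAt (𝓡∂ n) x₀ (V t).proj := by
        rw [bundleChart_apply]
      rw [h2]
      exact (le_of_lt h1)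
  have hei : (c ^ 2)⁻¹ ≤ e := le_max_right _ _
  refine hm.comp_comparable (by positivity) he1 (fun t ht ↦ ?_) fun t ht ↦ ?_
  · obtain ⟨h1, -, -, h4, -⟩ := hbt t ht
    have h5 : 0 ≤ L₀ (bundleChart x₀ (V t)).2 := le_trans (by positivity) h1
    refine le_trans ?_ (mul_le_mul_of_nonneg_right hei h5)
    rw [inv_mul_eq_div, le_div_iff₀ (by positivity)]
    have := neg_le_abs (g.timePairing (V t))
    nlinarith
  · obtain ⟨-, h2, h3, -, -⟩ := hbt t ht
    have h5 : 0 ≤ -g.timePairing (V t) := le_trans (by positivity) h2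
    refine le_trans ?_ (mul_le_mul_of_nonneg_right hei h5)
    rw [inv_mul_eq_div, le_div_iff₀ (by positivity)]
    have := le_abs_self (L₀ (bundleChart x₀ (V t)).2)
    nlinarith

theorem IsCausallyConvex.ordConnected [T2Space M] {U : Set M} (hU : g.IsCausallyConvex U)
    {V : ℝ → TangentBundle (𝓡∂ n) M} {a b : ℝ} (hV : g.IsGeodesicOn V (Icc a b))
    (hc : ∀ t ∈ Icc a b, g.IsCausal (V t) ∧ g.timePairing (V t) < 0)
    {s t r : ℝ} (hs : s ∈ Icc a b) (ht : t ∈ Icc a b) (hsU : (V s).proj ∈ U)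
    (htU : (V t).proj ∈ U) (hr : r ∈ Icc s t) : (V r).proj ∈ U := by
  rcases (hr.1.trans hr.2).eq_or_lt with h | h
  · subst h
    rwa [le_antisymm hr.2 hr.1]
  · exact hU _ s t ((hV.mono (Icc_subset_Icc hs.1 ht.2) ordConnected_Icc).isFutureCausalCurve h
      (hc s hs).1 (hc s hs).2) hsU htU r hr

theorem HasGeodesicBounds.union [T2Space M] {S U : Set M} (hS : g.HasGeodesicBounds S)
    (hU : g.HasGeodesicBounds U) (hconv : g.IsCausallyConvex U) : g.HasGeodesicBounds (U ∪ S) := by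
  obtain ⟨C, hC, hS⟩ := hS
  obtain ⟨D, hD, hU⟩ := hU
  have hDC : 1 ≤ 2 * C * D := by nlinarith [one_le_mul_of_one_le_of_one_le hC hD]
  refine ⟨2 * (2 * C * D) * C, by nlinarith [one_le_mul_of_one_le_of_one_le hDC hC],
    fun V a b hV hc J hJ hJo hJS ↦ ?_⟩
  have hf : ContinuousOn (fun t ↦ -g.timePairing (V t)) (Icc a b) :=
    (continuous_timePairing.comp_continuousOn hV.2.1).neg
  have hf0 : ∀ t ∈ Icc a b, 0 ≤ -g.timePairing (V t) := fun t ht ↦ by linarith [(hc t ht).2]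
  set I := {t | t ∈ J ∧ (V t).proj ∈ U} with hI
  set Jb := {t | t ∈ J ∧ (V t).proj ∉ U ∧ ∀ i ∈ I, t < i} with hJb
  set Ja := {t | t ∈ J ∧ (V t).proj ∉ U ∧ ¬ ∀ i ∈ I, t < i} with hJa
  have hsep : ∀ i ∈ I, ∀ i' ∈ I, ∀ t ∈ Icc i i', (V t).proj ∈ U := fun i hi i' hi' t ht ↦
    hconv.ordConnected hV hc (hJ hi.1) (hJ hi'.1) hi.2 hi'.2 ht
  have hab : ∀ t ∈ Ja, ∀ i ∈ I, i < t := by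
    intro t ht i hi
    by_contra hcon
    push Not at hcon
    obtain ⟨ht1, ht2, ht3⟩ := ht
    push Not at ht3
    obtain ⟨i', hi', hle⟩ := ht3
    exact ht2 (hsep i' hi' i hi t ⟨hle, hcon⟩)
  have hIo : I.OrdConnected := ⟨fun x hx y hy t ht ↦ ⟨hJo.out hx.1 hy.1 ht, hsep x hx y hy t ht⟩⟩
  have hJbo : Jb.OrdConnected := by
    refine ⟨fun x hx y hy t ht ↦ ?_⟩
    have h1 : ∀ i ∈ I, t < i := fun i hi ↦ ht.2.trans_lt (hy.2.2 i hi)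
    have h2 := hJo.out hx.1 hy.1 ht
    exact ⟨h2, fun h3 ↦ lt_irrefl _ (h1 t ⟨h2, h3⟩), h1⟩
  have hJao : Ja.OrdConnected := by
    refine ⟨fun x hx y hy t ht ↦ ?_⟩
    have h2 := hJo.out hx.1 hy.1 ht
    refine ⟨h2, fun h3 ↦ ?_, fun h4 ↦ hx.2.2 fun i hi ↦ ht.1.trans_lt (h4 i hi)⟩
    exact not_lt.2 ht.1 (hab x hx t ⟨h2, h3⟩)
  have hbi : (Jb ∪ I).OrdConnected := by
    refine ⟨fun x hx y hy t ht ↦ ?_⟩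
    have hxJ : x ∈ J := hx.elim (fun h ↦ h.1) fun h ↦ h.1
    have hyJ : y ∈ J := hy.elim (fun h ↦ h.1) fun h ↦ h.1
    have h2 := hJo.out hxJ hyJ ht
    by_cases h3 : (V t).proj ∈ U
    · exact Or.inr ⟨h2, h3⟩
    · refine Or.inl ⟨h2, h3, ?_⟩
      by_contra h4
      rcases hy with hy | hy
      · exact h4 fun i hi ↦ ht.2.trans_lt (hy.2.2 i hi)
      · exact not_lt.2 ht.2 (hab t ⟨h2, h3, h4⟩ y hy)
  have hall : (Jb ∪ I) ∪ Ja = J := by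
    ext t
    constructor
    · rintro ((h | h) | h) <;> exact h.1
    · intro h
      by_cases h3 : (V t).proj ∈ U
      · exact Or.inl (Or.inr ⟨h, h3⟩)
      · by_cases h4 : ∀ i ∈ I, t < i
        · exact Or.inl (Or.inl ⟨h, h3, h4⟩)
        · exact Or.inr ⟨h, h3, h4⟩
  have sJb : Jb ⊆ Icc a b := fun t ht ↦ hJ ht.1
  have sI : I ⊆ Icc a b := fun t ht ↦ hJ ht.1
  have sJa : Ja ⊆ Icc a b := fun t ht ↦ hJ ht.1
  have k1 := hS V a b hV hc Jb sJb hJbo fun t ht ↦ (hJS t ht.1).resolve_left ht.2.1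
  have k2 := hU V a b hV hc I sI hIo fun t ht ↦ ht.2
  have k3 := hS V a b hV hc Ja sJa hJao fun t ht ↦ (hJS t ht.1).resolve_left ht.2.1
  have := (k1.union k2 hC hD hf hf0 sJb sI hbi).union k3 hDC hC hf hf0 (union_subset sJb sI) sJa
    (by rw [hall]; exact hJo)
  rwa [hall] at this

theorem IsStronglyCausal.hasGeodesicBounds [T2Space M] [CompactSpace M]
    (hsc : g.IsStronglyCausal) : g.HasGeodesicBounds univ := by
  choose U hU hUb using fun x : M ↦ exists_hasGeodesicBounds (g := g) x
  choose W hW hWU hWc using fun x : M ↦ hsc x (U x) (hU x)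
  obtain ⟨F, hF⟩ := isCompact_univ.elim_nhds_subcover W fun x _ ↦ hW x
  refine HasGeodesicBounds.mono ?_ hF.2
  clear hF
  classical
  induction F using Finset.induction_on with
  | empty => simpa using hasGeodesicBounds_empty
  | insert x F _ ih =>
    rw [Finset.set_biUnion_insert]
    exact ih.union ((hUb x).mono (hWU x)) (hWc x)

end GlobalBounds

end TimeOrientedLorentzianMetric

section Boundary

variable {n : ℕ} [NeZero n] {M : Type*} [TopologicalSpace M]
  [ChartedSpace (EuclideanHalfSpace n) M] [IsManifold (𝓡∂ n) ∞ M]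

theorem mem_boundary_iff {x₀ x : M} (hx : x ∈ (extChartAt (𝓡∂ n) x₀).source) :
    x ∈ (𝓡∂ n).boundary M ↔ extChartAt (𝓡∂ n) x₀ x 0 = 0 := by
  have h0 : 0 ≤ extChartAt (𝓡∂ n) x₀ x 0 := coord_zero_nonneg ((extChartAt (𝓡∂ n) x₀).map_source hx)
  rw [extChartAt_source] at hx
  have h := (𝓡∂ n).isInteriorPoint_iff_of_mem_atlas (n := ∞) (by norm_num)
    (chart_mem_atlas (EuclideanHalfSpace n) x₀) hx
  have h1 : (𝓡∂ n).IsInteriorPoint x ↔ 0 < extChartAt (𝓡∂ n) x₀ x 0 := by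
    refine h.trans ⟨fun hi ↦ ?_, fun hi ↦ ?_⟩
    · have := OpenPartialHomeomorph.interior_extend_target_subset_interior_range _ hi
      rwa [interior_range_modelWithCornersEuclideanHalfSpace] at this
    · refine OpenPartialHomeomorph.mem_interior_extend_target _
        ((chartAt (EuclideanHalfSpace n) x₀).map_source hx) ?_
      rw [interior_range_modelWithCornersEuclideanHalfSpace]
      exact hi
  change (𝓡∂ n).IsBoundaryPoint x ↔ _
  rw [ModelWithCorners.isBoundaryPoint_iff_not_isInteriorPoint, h1, not_lt]
  exact ⟨fun h2 ↦ le_antisymm h2 h0, fun h2 ↦ h2.le⟩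

theorem isClosed_boundary : IsClosed ((𝓡∂ n).boundary M) :=
  (𝓡∂ n).isClosed_boundary (n := ∞) (by norm_num)

end Boundary

namespace TimeOrientedLorentzianMetric

variable {n : ℕ} [NeZero n] {M : Type*} [TopologicalSpace M]
  [ChartedSpace (EuclideanHalfSpace n) M] [IsManifold (𝓡∂ n) ∞ M]

section CausalBounds

variable (g : TimeOrientedLorentzianMetric n M)

/-- Along causal geodesics, the time component of the velocity and the affine length are
bounded in terms of the initial velocity. -/
def CausalBounds : Prop :=
  ∃ C : ℝ, 1 ≤ C ∧ ∀ (V : ℝ → TangentBundle (𝓡∂ n) M) (a b : ℝ), a ≤ b →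
    g.IsGeodesicOn V (Icc a b) → g.IsCausal (V a) →
    (∀ t ∈ Icc a b, |g.timePairing (V t)| ≤ C * |g.timePairing (V a)|) ∧
    (b - a) * |g.timePairing (V a)| ≤ C

variable {g}

theorem IsStronglyCausal.causalBounds [T2Space M] [CompactSpace M]
    (hsc : g.IsStronglyCausal) : g.CausalBounds := by
  obtain ⟨C, hC, h⟩ := hsc.hasGeodesicBounds
  have hf : ∀ (V : ℝ → TangentBundle (𝓡∂ n) M) (a b : ℝ), a ≤ b →
      g.IsGeodesicOn V (Icc a b) → (∀ t ∈ Icc a b, g.IsCausal (V t) ∧ g.timePairing (V t) < 0) →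
      ∀ r ∈ Icc a b, (∀ t ∈ Icc a b, |g.timePairing (V t)| ≤ C * |g.timePairing (V r)|) ∧
        (b - a) * |g.timePairing (V r)| ≤ C := by
    intro V a b hab hV hc r hr
    obtain ⟨h1, h2⟩ := h V a b hV hc (Icc a b) Subset.rfl ordConnected_Icc fun _ _ ↦ mem_univ _
    refine ⟨fun t ht ↦ ?_, ?_⟩
    · rw [abs_of_neg (hc t ht).2, abs_of_neg (hc r hr).2]
      exact h1 t ht r hr
    · rw [abs_of_neg (hc r hr).2, ← abs_of_nonneg (sub_nonneg.2 hab)]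
      exact h2 b (right_mem_Icc.2 hab) a (left_mem_Icc.2 hab) r hr
  refine ⟨C, hC, fun V a b hab hV hc ↦ ?_⟩
  have ha := left_mem_Icc.2 hab
  rcases lt_or_gt_of_ne hc.timePairing_ne_zero with h0 | h0
  · exact hf V a b hab hV (fun t ht ↦ ⟨hV.isCausal ha ht hc, hV.timePairing_neg ha ht hc h0⟩) a ha
  · have hr : g.IsGeodesicOn (fun t ↦ vscale (-1) (V (a + b - t))) (Icc a b) :=
      hV.reverse (a + b) (by linarith) (by linarith)
    have hb := right_mem_Icc.2 hab
    have hbc : g.IsCausal (vscale (-1) (V (a + b - b))) := by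
      rw [add_sub_cancel_right]; exact hc.vscale (by norm_num)
    have hbn : g.timePairing (vscale (-1) (V (a + b - b))) < 0 := by
      rw [add_sub_cancel_right, timePairing_vscale]; linarith
    obtain ⟨h1, h2⟩ := hf _ a b hab hr
      (fun t ht ↦ ⟨hr.isCausal hb ht hbc, hr.timePairing_neg hb ht hbc hbn⟩) b hb
    simp only [timePairing_vscale, add_sub_cancel_right, abs_mul, abs_neg, abs_one, one_mul]
      at h1 h2
    refine ⟨fun t ht ↦ ?_, h2⟩
    have := h1 (a + b - t) ⟨by linarith [ht.2], by linarith [ht.1]⟩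
    rwa [sub_sub_cancel] at this

theorem isClosed_causal (R : ℝ) :
    IsClosed {v : TangentBundle (𝓡∂ n) M | g.normSq v ≤ 0 ∧ |g.timePairing v| ≤ R} :=
  (isClosed_le continuous_normSq continuous_const).inter
    (isClosed_le continuous_timePairing.abs continuous_const)

theorem isCompact_causal [T2Space M] [CompactSpace M] (R : ℝ) :
    IsCompact {v : TangentBundle (𝓡∂ n) M | g.normSq v ≤ 0 ∧ |g.timePairing v| ≤ R} := by
  have hloc : ∀ x₀ : M, ∃ s ∈ 𝓝 x₀, ∃ K : Set (TangentBundle (𝓡∂ n) M), IsCompact K ∧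
      ∀ v : TangentBundle (𝓡∂ n) M, v.proj ∈ s → g.normSq v ≤ 0 → |g.timePairing v| ≤ R →
        v ∈ K := by
    intro x₀
    obtain ⟨U, hU, hUs, c, hc, hb⟩ := g.exists_coord_bounds x₀
    obtain ⟨s, hs, hsU, hsc⟩ := local_compact_nhds hU
    have hC : IsCompact ((extChartAt (𝓡∂ n) x₀ '' s) ×ˢ Metric.closedBall (0 : Model n) (R / c)) :=
      (hsc.image_of_continuousOn ((continuousOn_extChartAt x₀).mono (hsU.trans hUs))).prod
        (isCompact_closedBall _ _)
    refine ⟨s, hs, _, isCompact_bundleChart_symm_image x₀ hC ?_, fun v hv hN htp ↦ ?_⟩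
    · rintro p ⟨⟨x, hx, hxp⟩, -⟩
      rw [← hxp]
      exact (extChartAt (𝓡∂ n) x₀).map_source (hUs (hsU hx))
    · have hvs := hUs (hsU hv)
      have key : c * ‖(bundleChart x₀ v).2‖ ≤ |g.timePairing v| := by
        rcases le_total (g.timePairing v) 0 with h0 | h0
        · rw [abs_of_nonpos h0]; exact (hb v (hsU hv) hN h0).2.1
        · have h1 := (hb (vscale (-1) v) (hsU hv) (by rw [normSq_vscale]; linarith)
            (by rw [timePairing_vscale]; linarith)).2.1
          rw [bundleChart_vscale _ hvs, timePairing_vscale] at h1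
          simp only [norm_smul, norm_neg, norm_one, one_mul] at h1
          rw [abs_of_nonneg h0]; linarith
      refine ⟨bundleChart x₀ v, ⟨⟨v.proj, hv, ?_⟩, ?_⟩,
        (bundleChart x₀).left_inv (mem_bundleChart_source.2 hvs)⟩
      · rw [bundleChart_apply]
      · rw [mem_closedBall_zero_iff, le_div_iff₀ hc]; linarith
  choose s hs K hK h using hloc
  obtain ⟨F, hF⟩ := isCompact_univ.elim_nhds_subcover s fun x _ ↦ hs x
  refine (F.isCompact_biUnion fun x _ ↦ hK x).of_isClosed_subset (isClosed_causal R) ?_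
  intro v hv
  obtain ⟨x, hx, hxv⟩ := mem_iUnion₂.1 (hF.2 (mem_univ v.proj))
  exact mem_iUnion₂.2 ⟨x, hx, h x v hxv hv.1 hv.2⟩

variable {ι : Type*} {l : Filter ι}

theorem isCausal_of_tendsto [l.NeBot] {Z : ι → TangentBundle (𝓡∂ n) M}
    {z : TangentBundle (𝓡∂ n) M} (hZ : Tendsto Z l (𝓝 z)) (hc : ∀ᶠ i in l, g.IsCausal (Z i))
    (hz : z.2 ≠ 0) : g.IsCausal z :=
  g.isCausal_iff.2 ⟨hz, le_of_tendsto ((continuous_normSq.tendsto z).comp hZ)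
    (hc.mono fun _ hi ↦ (g.isCausal_iff.1 hi).2)⟩

/-- Geodesics with converging causal initial velocities and converging lengths converge. -/
theorem CausalBounds.tendsto_geodesic [T2Space M] [CompactSpace M] [l.NeBot] (hg : g.CausalBounds)
    {V : ι → ℝ → TangentBundle (𝓡∂ n) M} {s : ι → ℝ} {s₀ : ℝ} {z : TangentBundle (𝓡∂ n) M}
    (hs : ∀ᶠ i in l, 0 ≤ s i) (hV : ∀ᶠ i in l, g.IsGeodesicOn (V i) (Icc 0 (s i)))
    (hc : ∀ᶠ i in l, g.IsCausal (V i 0))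
    (h0 : Tendsto (fun i ↦ V i 0) l (𝓝 z)) (hs₀ : Tendsto s l (𝓝 s₀)) :
    ∃ W, g.IsGeodesicOn W (Icc 0 s₀) ∧ W 0 = z ∧ Tendsto (fun i ↦ V i (s i)) l (𝓝 (W s₀)) ∧
      ∀ θ : ι → ℝ, ConvergesAtRate l θ (fun i ↦ V i 0) z →
        MovesAtRate l θ (fun i ↦ s i - s₀) (fun i ↦ V i (s i)) (W s₀) := by
  obtain ⟨C, hC, h⟩ := hg
  refine tendsto_geodesic_of_isCompact
    (g.isCompact_causal (C * (|g.timePairing z| + 1))) hs hV ?_ h0 hs₀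
  have h1 : ∀ᶠ i in l, |g.timePairing (V i 0)| < |g.timePairing z| + 1 :=
    ((continuous_timePairing.abs.tendsto z).comp h0).eventually_lt tendsto_const_nhds (by simp)
  filter_upwards [hs, hV, hc, h1] with i hsi hVi hci h1i t ht
  refine ⟨(g.isCausal_iff.1 (hVi.isCausal (left_mem_Icc.2 hsi) ht hci)).2, ?_⟩
  exact ((h (V i) 0 (s i) hsi hVi hci).1 t ht).trans (by gcongr)

/-- Geodesics with converging causal initial velocities have bounded lengths. -/
theorem CausalBounds.exists_tendsto [T2Space M] {l : Ultrafilter ι} (hg : g.CausalBounds)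
    {V : ι → ℝ → TangentBundle (𝓡∂ n) M} {s : ι → ℝ} {z : TangentBundle (𝓡∂ n) M}
    (hs : ∀ᶠ i in l, 0 ≤ s i) (hV : ∀ᶠ i in l, g.IsGeodesicOn (V i) (Icc 0 (s i)))
    (hc : ∀ᶠ i in l, g.IsCausal (V i 0))
    (h0 : Tendsto (fun i ↦ V i 0) l (𝓝 z)) (hz : z.2 ≠ 0) :
    ∃ s₀, 0 ≤ s₀ ∧ Tendsto s l (𝓝 s₀) := by
  obtain ⟨C, hC, h⟩ := hg
  have hzc := g.isCausal_of_tendsto h0 hc hz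
  have hm : 0 < |g.timePairing z| := abs_pos.2 hzc.timePairing_ne_zero
  have h1 : ∀ᶠ i in l, |g.timePairing z| / 2 < |g.timePairing (V i 0)| :=
    tendsto_const_nhds.eventually_lt ((continuous_timePairing.abs.tendsto z).comp h0)
      (half_lt_self hm)
  have h2 : ∀ᶠ i in l, s i ∈ Icc 0 (C / (|g.timePairing z| / 2)) := by
    filter_upwards [hs, hV, hc, h1] with i hsi hVi hci h1i
    refine ⟨hsi, ?_⟩
    rw [le_div_iff₀ (half_pos hm)]
    have := (h (V i) 0 (s i) hsi hVi hci).2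
    rw [sub_zero] at this
    nlinarith
  obtain ⟨s₀, hs₀, hle⟩ := isCompact_Icc.ultrafilter_le_nhds (l.map s)
    (le_principal_iff.2 (by exact h2))
  exact ⟨s₀, hs₀.1, hle⟩

end CausalBounds

end TimeOrientedLorentzianMetric

theorem abs_fst_zero_sub_le {n : ℕ} [NeZero n] (p q : Phase n) : |p.1 0 - q.1 0| ≤ ‖p - q‖ :=
  (PiLp.norm_apply_le (p := 2) (p.1 - q.1) 0).trans (norm_fst_le (p - q))

theorem abs_snd_zero_sub_le {n : ℕ} [NeZero n] (p q : Phase n) : |p.2 0 - q.2 0| ≤ ‖p - q‖ :=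
  (PiLp.norm_apply_le (p := 2) (p.2 - q.2) 0).trans (norm_snd_le (p - q))

theorem hasDerivWithinAt_fst_zero {n : ℕ} [NeZero n] {y : ℝ → Phase n} {y' : Phase n} {J : Set ℝ}
    {t : ℝ} (h : HasDerivWithinAt y y' J t) : HasDerivWithinAt (fun t ↦ (y t).1 0) (y'.1 0) J t :=
  ((EuclideanSpace.proj (0 : Fin n) : Model n →L[ℝ] ℝ).comp
    (ContinuousLinearMap.fst ℝ (Model n) (Model n))).hasFDerivAt.comp_hasDerivWithinAt t h

namespace TimeOrientedLorentzianMetric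

variable {n : ℕ} [NeZero n] {M : Type*} [TopologicalSpace M]
  [ChartedSpace (EuclideanHalfSpace n) M] [IsManifold (𝓡∂ n) ∞ M]
  {g : TimeOrientedLorentzianMetric n M}

section Tangency

theorem IsGeodesicOn.hasDerivWithinAt_zero {V : ℝ → TangentBundle (𝓡∂ n) M} {J : Set ℝ}
    (hV : g.IsGeodesicOn V J) {t : ℝ} (ht : t ∈ J) {x₀ : M}
    (h₀ : (V t).proj ∈ (extChartAt (𝓡∂ n) x₀).source) :
    HasDerivWithinAt (fun s ↦ (bundleChart x₀ (V s)).1 0) ((bundleChart x₀ (V t)).2 0) J t :=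
  hasDerivWithinAt_fst_zero (hV.hasDerivWithinAt ht h₀)

/-- A geodesic which meets the boundary at an interior parameter is tangent to the boundary. -/
theorem IsGeodesicOn.isTangentToBoundary {V : ℝ → TangentBundle (𝓡∂ n) M} {a b t : ℝ}
    (hV : g.IsGeodesicOn V (Icc a b)) (ht : t ∈ Ioo a b)
    (hb : (V t).proj ∈ (𝓡∂ n).boundary M) : IsTangentToBoundary (V t) := by
  refine ⟨hb, ?_⟩
  have hs := mem_extChartAt_source (I := 𝓡∂ n) (V t).proj
  have hd := (hV.hasDerivWithinAt_zero (Ioo_subset_Icc_self ht) hs).hasDerivAt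
    (Icc_mem_nhds ht.1 ht.2)
  have h0 := (mem_boundary_iff hs).1 hb
  rw [bundleChart_apply] at hd
  refine IsLocalMin.hasDerivAt_eq_zero (Eventually.of_forall fun s ↦ ?_) hd
  simp only [bundleChart_apply]
  rw [h0]
  have := bundleChart_nonneg (V t).proj (V s)
  rwa [bundleChart_apply] at this

/-- A geodesic contained in the boundary is tangent to it. -/
theorem IsGeodesicOn.snd_zero_of_boundary {V : ℝ → TangentBundle (𝓡∂ n) M} {a b t : ℝ}
    (hab : a < b) (hV : g.IsGeodesicOn V (Icc a b)) (ht : t ∈ Icc a b)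
    (hb : ∀ s ∈ Icc a b, (V s).proj ∈ (𝓡∂ n).boundary M) {x₀ : M}
    (h₀ : (V t).proj ∈ (extChartAt (𝓡∂ n) x₀).source) : (bundleChart x₀ (V t)).2 0 = 0 := by
  have hd := hV.hasDerivWithinAt_zero ht h₀
  have hev : ∀ᶠ s in 𝓝[Icc a b] t, (bundleChart x₀ (V s)).1 0 = 0 := by
    have h1 := ((continuous_proj.comp_continuousOn hV.2.1) t ht).preimage_mem_nhdsWithin
      ((isOpen_extChartAt_source (I := 𝓡∂ n) x₀).mem_nhds h₀)
    filter_upwards [h1, self_mem_nhdsWithin] with s hs hsJ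
    rw [bundleChart_apply]
    exact (mem_boundary_iff hs).1 (hb s hsJ)
  have hd0 : HasDerivWithinAt (fun s ↦ (bundleChart x₀ (V s)).1 0) 0 (Icc a b) t :=
    (hasDerivWithinAt_const t (Icc a b) (0 : ℝ)).congr_of_eventuallyEq hev
      (hev.self_of_nhdsWithin ht)
  exact (uniqueDiffOn_Icc hab t ht).eq_deriv _ hd hd0

end Tangency

section NoLoops

/-- In a strongly causal manifold, causal geodesics do not return to their starting point. -/
theorem IsStronglyCausal.length_eq_zero [T2Space M] (hsc : g.IsStronglyCausal)
    {V : ℝ → TangentBundle (𝓡∂ n) M} {s : ℝ} (hs : 0 ≤ s) (hV : g.IsGeodesicOn V (Icc 0 s))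
    (hc : g.IsCausal (V 0)) (h : (V 0).proj = (V s).proj) : s = 0 := by
  have key : ∀ V : ℝ → TangentBundle (𝓡∂ n) M, g.IsGeodesicOn V (Icc 0 s) → g.IsCausal (V 0) →
      g.timePairing (V 0) < 0 → (V 0).proj = (V s).proj → s = 0 := by
    intro V hV hc hn h
    by_contra hne
    have hs' : 0 < s := lt_of_le_of_ne hs (Ne.symm hne)
    have h0 := left_mem_Icc.2 hs
    have hconst : ∀ t ∈ Icc 0 s, (V t).proj = (V 0).proj := by
      intro t ht
      by_contra hcon
      obtain ⟨U, hU, hUs, hUc⟩ := hsc (V 0).proj {(V t).proj}ᶜ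
        (isOpen_compl_singleton.mem_nhds fun h' ↦ hcon h'.symm)
      exact hUs (hUc _ 0 s (hV.isFutureCausalCurve hs' hc hn) (mem_of_mem_nhds hU)
        (h ▸ mem_of_mem_nhds hU) t ht) rfl
    have hd := (hV.2.2 0 h0).1
    have hd0 : HasDerivWithinAt (fun s ↦ extChartAt (𝓡∂ n) (V 0).proj (V s).proj) 0 (Icc 0 s) 0 :=
      (hasDerivWithinAt_const 0 (Icc 0 s) (extChartAt (𝓡∂ n) (V 0).proj (V 0).proj)).congr
        (fun t ht ↦ by rw [hconst t ht]) rfl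
    have h1 := (uniqueDiffOn_Icc hs' 0 h0).eq_deriv _ hd hd0
    rw [tangentCoord_self] at h1
    exact (g.isCausal_iff.1 hc).1 h1
  rcases lt_or_gt_of_ne hc.timePairing_ne_zero with h0 | h0
  · exact key V hV hc h0 h
  · have hcs := hV.isCausal (left_mem_Icc.2 hs) (right_mem_Icc.2 hs) hc
    have hr := hV.reverse s (a' := 0) (b' := s) (by linarith) (by linarith)
    refine key _ hr ?_ ?_ ?_
    · rw [sub_zero]; exact hcs.vscale (by norm_num)
    · rw [sub_zero, timePairing_vscale]
      by_contra hcon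
      push Not at hcon
      have h1 : g.timePairing (V s) < 0 :=
        lt_of_le_of_ne (by linarith) hcs.timePairing_ne_zero
      have := hV.timePairing_neg (right_mem_Icc.2 hs) (left_mem_Icc.2 hs) hcs h1
      linarith
    · simp only [vscale_proj, sub_zero, sub_self]
      exact h.symm

end NoLoops

section Existence

/-- Geodesics starting at interior points, or at boundary points with inward-pointing velocity,
exist for a time which is locally uniform. -/
theorem exists_geodesic_nhds (z : TangentBundle (𝓡∂ n) M)
    (h : z.proj ∉ (𝓡∂ n).boundary M ∨ 0 < tangentCoord z.proj z 0) :
    ∃ δ > 0, ∀ᶠ z' in 𝓝 z, ∃ V, g.IsGeodesicOn V (Icc 0 δ) ∧ V 0 = z' := by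
  obtain ⟨b⟩ := g.nonempty_flowBox z
  set x₀ := z.proj with hx₀
  set κ := (bundleChart x₀ : PartialEquiv (TangentBundle (𝓡∂ n) M) (Phase n)) with hκ
  have hsrc : z.proj ∈ (extChartAt (𝓡∂ n) x₀).source := mem_extChartAt_source _
  have hκc : ContinuousAt κ z := continuousAt_bundleChart hsrc
  have hc : ∃ c > 0, ∀ᶠ z' in 𝓝 z, c < (κ z').1 0 ∨ c < (κ z').2 0 := by
    have hc1 : ContinuousAt (fun z' ↦ (κ z').1 0) z :=
      (EuclideanSpace.proj (0 : Fin n) : Model n →L[ℝ] ℝ).continuous.continuousAt.comp' hκc.fst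
    have hc2 : ContinuousAt (fun z' ↦ (κ z').2 0) z :=
      (EuclideanSpace.proj (0 : Fin n) : Model n →L[ℝ] ℝ).continuous.continuousAt.comp' hκc.snd
    rcases h with h | h
    · have h0 : 0 < (κ z).1 0 := by
        refine lt_of_le_of_ne (bundleChart_nonneg _ _) fun h1 ↦ h ?_
        rw [mem_boundary_iff hsrc, h1, hκ, bundleChart_apply]
      exact ⟨_, half_pos h0, (continuousAt_const.eventually_lt hc1 (half_lt_self h0)).mono
        fun _ ↦ Or.inl⟩
    · have h0 : 0 < (κ z).2 0 := by rw [hκ, bundleChart_apply]; exact h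
      exact ⟨_, half_pos h0, (continuousAt_const.eventually_lt hc2 (half_lt_self h0)).mono
        fun _ ↦ Or.inr⟩
  obtain ⟨c, hc0, hc⟩ := hc
  set δ := min b.δ (c / (b.B + 1)) with hδ
  have hB1 : 0 < b.B + 1 := by linarith [b.B_nonneg]
  have hδ0 : 0 < δ := lt_min b.δ_pos (div_pos hc0 hB1)
  have hδb : δ ≤ b.δ := min_le_left _ _
  have hBδ : ∀ t ∈ Icc 0 δ, b.B * (t - 0) ≤ c := by
    intro t ht
    have h1 : t ≤ c / (b.B + 1) := ht.2.trans (min_le_right _ _)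
    rw [le_div_iff₀ hB1] at h1
    nlinarith [ht.1]
  refine ⟨δ, hδ0, ?_⟩
  filter_upwards [hc, b.core_mem_nhds_self] with z' hz' hcore
  obtain ⟨y, hy0, hy⟩ := b.exists_solution hcore.2
  have hsub : Icc 0 δ ⊆ Icc 0 b.δ := Icc_subset_Icc_right hδb
  have hder : ∀ t ∈ Icc 0 δ, HasDerivWithinAt y (g.extField x₀ (y t)) (Icc 0 δ) t := fun t ht ↦
    (hy t (hsub ht)).1.mono hsub
  have hlip : ∀ t ∈ Icc 0 δ, ‖y t - y 0‖ ≤ b.B * (t - 0) :=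
    norm_image_sub_le_of_norm_deriv_le_segment' hder fun t ht ↦
      b.bound _ (hy t (hsub ⟨ht.1, ht.2.le⟩)).2
  have hnn : ∀ t ∈ Icc 0 δ, 0 ≤ (y t).1 0 := by
    have hy0' : y 0 = κ z' := hy0
    rw [← hy0'] at hz'
    rcases hz' with h1 | h1
    · intro t ht
      have := (abs_le.1 ((abs_fst_zero_sub_le (y t) (y 0)).trans (hlip t ht))).1
      linarith [hBδ t ht]
    · have hmono : MonotoneOn (fun t ↦ (y t).1 0) (Icc 0 δ) := by
        refine monotoneOn_of_hasDerivWithinAt_nonneg (convex_Icc 0 δ)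
          (fun t ht ↦ (hasDerivWithinAt_fst_zero (hder t ht)).continuousWithinAt)
          (fun t ht ↦ (hasDerivWithinAt_fst_zero (hder t (interior_subset ht))).mono
            interior_subset) fun t ht ↦ ?_
        have ht := interior_subset ht
        rw [g.extField_fst]
        have := (abs_le.1 ((abs_snd_zero_sub_le (y t) (y 0)).trans (hlip t ht))).1
        linarith [hBδ t ht]
      intro t ht
      have h2 := hmono (left_mem_Icc.2 hδ0.le) ht ht.1
      have h3 : 0 ≤ (y 0).1 0 := by rw [hy0']; exact bundleChart_nonneg _ _
      exact h3.trans h2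
  refine ⟨_, b.isGeodesicOn_symm ordConnected_Icc
    (fun t ht ↦ ⟨hder t ht, (hy t (hsub ht)).2⟩) hnn, ?_⟩
  rw [hy0]
  exact (bundleChart x₀).left_inv hcore.1

/-- Causal geodesics can be extended until they reach the boundary. -/
theorem CausalBounds.exists_maximal [T2Space M] [CompactSpace M] (hg : g.CausalBounds)
    {z : TangentBundle (𝓡∂ n) M} (hz : g.IsCausal z) :
    ∃ (S : ℝ) (V : ℝ → TangentBundle (𝓡∂ n) M), 0 ≤ S ∧ g.IsGeodesicOn V (Icc 0 S) ∧ V 0 = z ∧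
      (V S).proj ∈ (𝓡∂ n).boundary M ∧
      ∀ (s : ℝ) (W : ℝ → TangentBundle (𝓡∂ n) M), g.IsGeodesicOn W (Icc 0 s) → W 0 = z →
        s ≤ S := by
  set A := {s : ℝ | 0 ≤ s ∧ ∃ V, g.IsGeodesicOn V (Icc 0 s) ∧ V 0 = z} with hA
  have h0A : (0 : ℝ) ∈ A := ⟨le_rfl, fun _ ↦ z, isGeodesicOn_singleton _ _, rfl⟩
  have hbdd : BddAbove A := by
    obtain ⟨C, hC, h⟩ := hg
    have hm : 0 < |g.timePairing z| := abs_pos.2 hz.timePairing_ne_zero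
    refine ⟨C / |g.timePairing z|, fun s hs ↦ ?_⟩
    obtain ⟨hs0, V, hV, hV0⟩ := hs
    have := (h V 0 s hs0 hV (hV0 ▸ hz)).2
    rw [hV0, sub_zero] at this
    rwa [le_div_iff₀ hm]
  obtain ⟨u, -, hu, huA⟩ := exists_seq_tendsto_sSup ⟨0, h0A⟩ hbdd
  choose V hV hV0 using fun k ↦ (huA k).2
  obtain ⟨W, hW, hW0, -, -⟩ := hg.tendsto_geodesic (V := V) (s := u) (z := z) (l := atTop)
    (Eventually.of_forall fun k ↦ (huA k).1) (Eventually.of_forall hV)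
    (Eventually.of_forall fun k ↦ (hV0 k).symm ▸ hz)
    (tendsto_const_nhds.congr fun k ↦ (hV0 k).symm) hu
  have hS0 : 0 ≤ sSup A := le_csSup hbdd h0A
  refine ⟨sSup A, W, hS0, hW, hW0, ?_, fun s U hU hU0 ↦ ?_⟩
  · by_contra hcon
    obtain ⟨δ, hδ, hev⟩ := exists_geodesic_nhds (g := g) (W (sSup A)) (Or.inl hcon)
    obtain ⟨U, hU, hU0⟩ := hev.self_of_nhds
    have hU' : g.IsGeodesicOn (fun t ↦ U (t + -sSup A)) (Icc (sSup A) (sSup A + δ)) :=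
      hU.shift (-sSup A) (by linarith) (by linarith)
    have hc := hW.concat hU' hS0 (by linarith) (by rw [add_neg_cancel, hU0])
    have : sSup A + δ ≤ sSup A := le_csSup hbdd ⟨by linarith, _, hc, by
      simp only [if_pos hS0]; exact hW0⟩
    linarith
  · rcases le_total 0 s with hs | hs
    · exact le_csSup hbdd ⟨hs, U, hU, hU0⟩
    · exact hs.trans hS0

end Existence

end TimeOrientedLorentzianMetric

namespace TimeOrientedLorentzianMetric

variable {n : ℕ} [NeZero n] {M : Type*} [TopologicalSpace M]
  [ChartedSpace (EuclideanHalfSpace n) M] [IsManifold (𝓡∂ n) ∞ M]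
  {g : TimeOrientedLorentzianMetric n M}

section Meet

variable (g) in
/-- The geodesics with initial velocities `z` and `z'` meet, with total length `t`. -/
def Meet (z : TangentBundle (𝓡∂ n) M) (t : ℝ) (z' : TangentBundle (𝓡∂ n) M) : Prop :=
  ∃ τ s V W, 0 ≤ τ ∧ 0 ≤ s ∧ g.IsGeodesicOn V (Icc 0 τ) ∧ V 0 = z ∧
    g.IsGeodesicOn W (Icc 0 s) ∧ W 0 = z' ∧ (V τ).proj = (W s).proj ∧
    τ * g.causalNorm z + s * g.causalNorm z' = t

theorem Meet.symm {z z' : TangentBundle (𝓡∂ n) M} {t : ℝ} (h : g.Meet z t z') : g.Meet z' t z := by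
  obtain ⟨τ, s, V, W, hτ, hs, hV, hV0, hW, hW0, hp, ht⟩ := h
  exact ⟨s, τ, W, V, hs, hτ, hW, hW0, hV, hV0, hp.symm, by rw [← ht, add_comm]⟩

theorem vscale_neg_one_neg_one (v : TangentBundle (𝓡∂ n) M) :
    vscale (-1) (vscale (-1) v) = v := by
  rw [vscale_vscale]; norm_num [vscale_one]

theorem meet_neg_iff {ξ η : TangentBundle (𝓡∂ n) M} {t : ℝ} :
    g.Meet ξ t (vscale (-1) η) ↔ ∃ τ s V W, g.IsBrokenGeodesic ξ η τ s V W ∧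
      τ * g.causalNorm ξ + s * g.causalNorm η = t := by
  constructor
  · rintro ⟨τ, s, V, W, hτ, hs, hV, hV0, hW, hW0, hp, ht⟩
    refine ⟨τ, s, V, fun r ↦ vscale (-1) (W (0 - r)), ⟨hτ, hs, hV, hV0,
      hW.reverse 0 (by linarith) (by linarith), ?_, ?_⟩, ?_⟩
    · simp only [sub_zero]
      rw [hW0, vscale_neg_one_neg_one]
    · rw [vscale_proj, sub_neg_eq_add, zero_add, hp]
    · rwa [causalNorm_vscale_neg_one] at ht
  · rintro ⟨τ, s, V, W, ⟨hτ, hs, hV, hV0, hW, hW0, hp⟩, ht⟩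
    refine ⟨τ, s, V, fun r ↦ vscale (-1) (W (0 - r)), hτ, hs, hV, hV0,
      hW.reverse 0 (by linarith) (by linarith), ?_, ?_, ?_⟩
    · simp only [sub_zero]
      rw [hW0]
    · rw [vscale_proj, zero_sub, hp]
    · rwa [causalNorm_vscale_neg_one]

theorem mem_brokenTimelikeLensData {ξ η : TangentBundle (𝓡∂ n) M} {t : ℝ} :
    (ξ, t, η) ∈ g.brokenTimelikeLensData ↔
      ξ ∈ boundaryTangentBundle n M ∧ η ∈ boundaryTangentBundle n M ∧
      g.IsTimelike ξ ∧ g.IsFutureDirected ξ ∧ g.IsTimelike η ∧ g.IsFutureDirected η ∧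
      g.Meet ξ t (vscale (-1) η) := by
  rw [meet_neg_iff]
  constructor
  · rintro ⟨ξ', t', η', heq, h⟩
    obtain ⟨rfl, rfl, rfl⟩ : ξ = ξ' ∧ t = t' ∧ η = η' := by simpa using heq
    exact h
  · exact fun h ↦ ⟨ξ, t, η, rfl, h⟩

theorem IsLightlike.causalNorm_eq {v : TangentBundle (𝓡∂ n) M} (h : g.IsLightlike v) :
    g.causalNorm v = 0 := by
  rw [causalNorm, h.2, neg_zero, Real.sqrt_zero]

theorem mem_timeProbeData {ξ η : TangentBundle (𝓡∂ n) M} {t : ℝ} :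
    (ξ, t, η) ∈ g.timeProbeData ↔
      ξ ∈ boundaryTangentBundle n M ∧ η ∈ boundaryTangentBundle n M ∧
      g.IsTimelike ξ ∧ g.IsFutureDirected ξ ∧ g.IsLightlike η ∧ g.IsFutureDirected η ∧
      g.Meet ξ t (vscale (-1) η) := by
  rw [meet_neg_iff]
  constructor
  · rintro ⟨ξ', t', η', heq, h1, h2, h3, h4, h5, h6, τ, s, V, W, hb, ht⟩
    obtain ⟨rfl, rfl, rfl⟩ : ξ = ξ' ∧ t = t' ∧ η = η' := by simpa using heq
    exact ⟨h1, h2, h3, h4, h5, h6, τ, s, V, W, hb, by rw [h5.causalNorm_eq, ht]; ring⟩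
  · rintro ⟨h1, h2, h3, h4, h5, h6, τ, s, V, W, hb, ht⟩
    exact ⟨ξ, t, η, rfl, h1, h2, h3, h4, h5, h6, τ, s, V, W, hb, by
      rw [h5.causalNorm_eq] at ht; linarith⟩

theorem meet_self_zero (z : TangentBundle (𝓡∂ n) M) {z' : TangentBundle (𝓡∂ n) M}
    (h : z.proj = z'.proj) : g.Meet z 0 z' :=
  ⟨0, 0, fun _ ↦ z, fun _ ↦ z', le_rfl, le_rfl, isGeodesicOn_singleton _ _, rfl,
    isGeodesicOn_singleton _ _, rfl, h, by ring⟩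

variable {ι : Type*} {l : Filter ι}

theorem CausalBounds.meet_of_tendsto [T2Space M] [CompactSpace M] [l.NeBot] (hg : g.CausalBounds)
    {Z Z' : ι → TangentBundle (𝓡∂ n) M} {t : ι → ℝ} {z z' : TangentBundle (𝓡∂ n) M} {t₀ : ℝ}
    (hZ : Tendsto Z l (𝓝 z)) (hZ' : Tendsto Z' l (𝓝 z')) (ht : Tendsto t l (𝓝 t₀))
    (hc : ∀ᶠ i in l, g.IsCausal (Z i)) (hc' : ∀ᶠ i in l, g.IsCausal (Z' i))
    (hz : z.2 ≠ 0) (hz' : z'.2 ≠ 0) (h : ∀ᶠ i in l, g.Meet (Z i) (t i) (Z' i)) :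
    g.Meet z t₀ z' := by
  have hle := Ultrafilter.of_le l
  set u := Ultrafilter.of l
  have h' : ∀ i, ∃ τ s V W, g.Meet (Z i) (t i) (Z' i) → 0 ≤ τ ∧ 0 ≤ s ∧
      g.IsGeodesicOn V (Icc 0 τ) ∧ V 0 = Z i ∧ g.IsGeodesicOn W (Icc 0 s) ∧ W 0 = Z' i ∧
      (V τ).proj = (W s).proj ∧ τ * g.causalNorm (Z i) + s * g.causalNorm (Z' i) = t i := by
    intro i
    by_cases hm : g.Meet (Z i) (t i) (Z' i)
    · obtain ⟨τ, s, V, W, hm'⟩ := hm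
      exact ⟨τ, s, V, W, fun _ ↦ hm'⟩
    · exact ⟨0, 0, fun _ ↦ Z i, fun _ ↦ Z i, fun hm' ↦ (hm hm').elim⟩
  choose τ s V W hVW using h'
  replace hVW := (h.filter_mono hle).mono fun i hi ↦ hVW i hi
  have hτ0 : ∀ᶠ i in (u : Filter ι), 0 ≤ τ i := hVW.mono fun i hi ↦ hi.1
  have hs0 : ∀ᶠ i in (u : Filter ι), 0 ≤ s i := hVW.mono fun i hi ↦ hi.2.1
  have hV : ∀ᶠ i in (u : Filter ι), g.IsGeodesicOn (V i) (Icc 0 (τ i)) :=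
    hVW.mono fun i hi ↦ hi.2.2.1
  have hW : ∀ᶠ i in (u : Filter ι), g.IsGeodesicOn (W i) (Icc 0 (s i)) :=
    hVW.mono fun i hi ↦ hi.2.2.2.2.1
  have hV0 : ∀ᶠ i in (u : Filter ι), Z i = V i 0 := hVW.mono fun i hi ↦ hi.2.2.2.1.symm
  have hW0 : ∀ᶠ i in (u : Filter ι), Z' i = W i 0 := hVW.mono fun i hi ↦ hi.2.2.2.2.2.1.symm
  have hZu := hZ.mono_left hle
  have hZu' := hZ'.mono_left hle
  have tV := hZu.congr' hV0
  have tW := hZu'.congr' hW0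
  have cV : ∀ᶠ i in (u : Filter ι), g.IsCausal (V i 0) := by
    filter_upwards [hV0, hc.filter_mono hle] with i h1 h2 using h1 ▸ h2
  have cW : ∀ᶠ i in (u : Filter ι), g.IsCausal (W i 0) := by
    filter_upwards [hW0, hc'.filter_mono hle] with i h1 h2 using h1 ▸ h2
  obtain ⟨τ₀, hτ₀, hτ⟩ := hg.exists_tendsto hτ0 hV cV tV hz
  obtain ⟨s₀, hs₀, hs⟩ := hg.exists_tendsto hs0 hW cW tW hz'
  obtain ⟨V', gV, hV'0, eV, -⟩ := hg.tendsto_geodesic hτ0 hV cV tV hτ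
  obtain ⟨W', gW, hW'0, eW, -⟩ := hg.tendsto_geodesic hs0 hW cW tW hs
  refine ⟨τ₀, s₀, V', W', hτ₀, hs₀, gV, hV'0, gW, hW'0, ?_, ?_⟩
  · have h1 := (continuous_proj.tendsto _).comp eV
    have h2 := (continuous_proj.tendsto _).comp eW
    exact tendsto_nhds_unique (h1.congr' (hVW.mono fun i hi ↦ hi.2.2.2.2.2.2.1)) h2
  · have h1 := (continuous_causalNorm (g := g).tendsto z).comp hZu
    have h2 := (continuous_causalNorm (g := g).tendsto z').comp hZu'
    exact tendsto_nhds_unique (((hτ.mul h1).add (hs.mul h2)).congr'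
      (hVW.mono fun i hi ↦ hi.2.2.2.2.2.2.2)) (ht.mono_left hle)

end Meet

section Limits

theorem lensDataLimits_subset [T2Space M] [CompactSpace M] (hg : g.CausalBounds) :
    g.lensDataLimits ⊆ g.timeProbeData := by
  rintro _ ⟨ξ, t, η, rfl, hξ, hη, hη0, hnot, u, ζ, hu, hζ, hmem⟩
  have hmem' := fun i ↦ mem_brokenTimelikeLensData.1 (hmem i)
  have hξt := (hmem' 0).2.2.1
  have hξf := (hmem' 0).2.2.2.1
  have hηc : g.IsCausal η := g.isCausal_of_tendsto hζ
    (Eventually.of_forall fun i ↦ Or.inl (hmem' i).2.2.2.2.1) hη0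
  have hηf : g.IsFutureDirected η := by
    refine lt_of_le_of_ne ?_ hηc.timePairing_ne_zero
    exact le_of_tendsto ((continuous_timePairing (g := g).tendsto η).comp hζ)
      (Eventually.of_forall fun i ↦ (hmem' i).2.2.2.2.2.1.le)
  have hξ0 : ξ.2 ≠ 0 := (g.isCausal_iff.1 (Or.inl hξt)).1
  have hmeet : g.Meet ξ t (vscale (-1) η) := by
    refine hg.meet_of_tendsto tendsto_const_nhds
      (((continuous_vscale (-1)).tendsto η).comp hζ) hu
      (Eventually.of_forall fun i ↦ Or.inl hξt) (Eventually.of_forall fun i ↦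
        IsCausal.vscale (Or.inl (hmem' i).2.2.2.2.1) (by norm_num)) hξ0 ?_
      (Eventually.of_forall fun i ↦ (hmem' i).2.2.2.2.2.2)
    exact smul_ne_zero (by norm_num) hη0
  rcases hηc with h | h
  · exact (hnot (mem_brokenTimelikeLensData.2 ⟨hξ, hη, hξt, hξf, h, hηf, hmeet⟩)).elim
  · exact mem_timeProbeData.2 ⟨hξ, hη, hξt, hξf, h, hηf, hmeet⟩

end Limits

section Tilt

variable (g) in
/-- The vector `v + ε T`, where `T` is the time orientation. -/
def tilt (ε : ℝ) (v : TangentBundle (𝓡∂ n) M) : TangentBundle (𝓡∂ n) M :=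
  ⟨v.proj, v.2 + ε • g.timeField v.proj⟩

theorem tilt_proj (ε : ℝ) (v : TangentBundle (𝓡∂ n) M) : (g.tilt ε v).proj = v.proj := rfl

theorem continuous_tilt (v : TangentBundle (𝓡∂ n) M) : Continuous fun ε ↦ g.tilt ε v := by
  refine (FiberBundle.continuous_totalSpaceMk (Model n) (TangentSpace (𝓡∂ n) (M := M))
    v.proj).comp ?_
  exact continuous_const.add (continuous_id.smul continuous_const)

theorem tilt_zero (v : TangentBundle (𝓡∂ n) M) : g.tilt 0 v = v := by
  rw [tilt, zero_smul, add_zero]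

theorem tendsto_tilt {ι : Type*} {l : Filter ι} {ε : ι → ℝ} (hε : Tendsto ε l (𝓝 0))
    (v : TangentBundle (𝓡∂ n) M) : Tendsto (fun i ↦ g.tilt (ε i) v) l (𝓝 v) := by
  have := (continuous_tilt (g := g) v).tendsto 0
  rw [tilt_zero] at this
  exact this.comp hε

theorem normSq_tilt (ε : ℝ) (v : TangentBundle (𝓡∂ n) M) : g.normSq (g.tilt ε v) =
    g.normSq v + 2 * ε * g.timePairing v +
      ε ^ 2 * g.inner v.proj (g.timeField v.proj) (g.timeField v.proj) := by
  change g.inner v.proj (v.2 + ε • g.timeField v.proj) (v.2 + ε • g.timeField v.proj) = _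
  rw [timePairing, normSq]
  simp only [map_add, map_smul, add_apply, smul_apply, smul_eq_mul]
  rw [g.symm v.proj v.2 (g.timeField v.proj)]
  ring

theorem timePairing_tilt (ε : ℝ) (v : TangentBundle (𝓡∂ n) M) : g.timePairing (g.tilt ε v) =
    g.timePairing v + ε * g.inner v.proj (g.timeField v.proj) (g.timeField v.proj) := by
  change g.inner v.proj (g.timeField v.proj) (v.2 + ε • g.timeField v.proj) = _
  rw [map_add, map_smul, smul_eq_mul, timePairing]

theorem isTimelike_tilt {ε : ℝ} {v : TangentBundle (𝓡∂ n) M} (h : g.normSq v ≤ 0)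
    (hε : ε ≠ 0) (hf : ε * g.timePairing v ≤ 0) : g.IsTimelike (g.tilt ε v) := by
  rw [IsTimelike, normSq_tilt]
  have := g.timeField_timelike v.proj
  have := pow_pos (abs_pos.2 hε) 2
  rw [sq_abs] at this
  nlinarith

theorem timePairing_tilt_neg {ε : ℝ} {v : TangentBundle (𝓡∂ n) M} (hε : 0 < ε)
    (hf : g.timePairing v ≤ 0) : g.timePairing (g.tilt ε v) < 0 := by
  rw [timePairing_tilt]
  have := g.timeField_timelike v.proj
  nlinarith

end Tilt

section Transversal

theorem deriv_nonneg_of_nonneg {f : ℝ → ℝ} {f' s : ℝ} (hs : 0 < s)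
    (h : HasDerivWithinAt f f' (Icc 0 s) 0) (h0 : f 0 = 0) (hf : ∀ t ∈ Icc 0 s, 0 ≤ f t) :
    0 ≤ f' := by
  have h1 : Tendsto (slope f 0) (𝓝[Ioc 0 s] 0) (𝓝 f') := by
    rw [hasDerivWithinAt_iff_tendsto_slope] at h
    rwa [Icc_sdiff_left] at h
  have : (𝓝[Ioc 0 s] (0 : ℝ)).NeBot := by
    rw [nhdsWithin_Ioc_eq_nhdsGT hs]; infer_instance
  refine ge_of_tendsto h1 (eventually_mem_nhdsWithin.mono fun t ht ↦ ?_)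
  rw [slope_def_field, h0, sub_zero, sub_zero]
  exact div_nonneg (hf t ⟨ht.1.le, ht.2⟩) ht.1.le

/-- A lightlike geodesic which starts at the boundary and is not contained in it points inwards. -/
theorem IsGeodesicOn.inward (hconv : g.LightlikeTangentGeodesicsStayInBoundary)
    {U : ℝ → TangentBundle (𝓡∂ n) M} {s : ℝ} (hs : 0 < s)
    (hU : g.IsGeodesicOn U (Icc 0 s)) (hl : ∀ t ∈ Icc 0 s, g.IsLightlike (U t))
    (hnb : ¬ ∀ t ∈ Icc 0 s, (U t).proj ∈ (𝓡∂ n).boundary M) :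
    (U 0).proj ∉ (𝓡∂ n).boundary M ∨ 0 < tangentCoord (U 0).proj (U 0) 0 := by
  by_cases hb : (U 0).proj ∈ (𝓡∂ n).boundary M
  · right
    have h0 := left_mem_Icc.2 hs.le
    have hsrc := mem_extChartAt_source (I := 𝓡∂ n) (U 0).proj
    refine lt_of_le_of_ne ?_ fun h ↦ hnb (hconv U _ hU hl ⟨0, h0, hb, h.symm⟩)
    have hd := hU.hasDerivWithinAt_zero h0 hsrc
    have := deriv_nonneg_of_nonneg hs hd (by
      rw [bundleChart_apply]; exact (mem_boundary_iff hsrc).1 hb) fun t _ ↦ bundleChart_nonneg _ _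
    rwa [bundleChart_apply] at this
  · exact Or.inl hb

/-- A lightlike geodesic that ends at the boundary, and is not contained in it, is a limit of
timelike geodesics which start at the same point and end at the boundary. -/
theorem exists_timelike_approximation [T2Space M] [CompactSpace M] (hg : g.CausalBounds)
    (hconv : g.LightlikeTangentGeodesicsStayInBoundary)
    {U : ℝ → TangentBundle (𝓡∂ n) M} {s : ℝ} (hs : 0 < s)
    (hU : g.IsGeodesicOn U (Icc 0 s)) (hl : g.IsLightlike (U 0)) (hf : g.timePairing (U 0) < 0)
    (hend : (U s).proj ∈ (𝓡∂ n).boundary M)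
    (hnb : ¬ ∀ t ∈ Icc 0 s, (U t).proj ∈ (𝓡∂ n).boundary M) :
    ∃ (S : ℕ → ℝ) (V : ℕ → ℝ → TangentBundle (𝓡∂ n) M),
      (∀ k, 0 ≤ S k ∧ g.IsGeodesicOn (V k) (Icc 0 (S k)) ∧ (V k 0).proj = (U 0).proj ∧
        g.IsTimelike (V k 0) ∧ g.timePairing (V k 0) < 0 ∧
        (V k (S k)).proj ∈ (𝓡∂ n).boundary M) ∧
      Tendsto S atTop (𝓝 s) ∧ Tendsto (fun k ↦ V k 0) atTop (𝓝 (U 0)) ∧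
      Tendsto (fun k ↦ V k (S k)) atTop (𝓝 (U s)) := by
  set ε : ℕ → ℝ := fun k ↦ 1 / ((k : ℝ) + 1) with hε
  have hε0 : ∀ k, 0 < ε k := fun k ↦ Nat.one_div_pos_of_nat
  have hεt : Tendsto ε atTop (𝓝 0) := tendsto_one_div_add_atTop_nhds_zero_nat
  have h0s := left_mem_Icc.2 hs.le
  have hlt : ∀ t ∈ Icc 0 s, g.IsLightlike (U t) := fun t ht ↦ hU.isLightlike h0s ht hl
  have hT : ∀ k, g.IsTimelike (g.tilt (ε k) (U 0)) := fun k ↦ isTimelike_tilt hl.2.le (hε0 k).ne'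
    (mul_nonpos_of_nonneg_of_nonpos (hε0 k).le hf.le)
  choose S V hS hV hV0 hVb hmax using fun k ↦ hg.exists_maximal (Or.inl (hT k))
  have hlim := tendsto_tilt (g := g) hεt (U 0)
  obtain ⟨δ, hδ, hev⟩ := exists_geodesic_nhds (g := g) (U 0) (hU.inward hconv hs hlt hnb)
  have hSδ : ∀ᶠ k in atTop, δ ≤ S k := (hlim.eventually hev).mono fun k ⟨W, hW, hW0⟩ ↦
    hmax k δ W hW hW0
  have key : ∀ u : Ultrafilter ℕ, (u : Filter ℕ) ≤ atTop → Tendsto S u (𝓝 s) ∧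
      Tendsto (fun k ↦ V k (S k)) u (𝓝 (U s)) := by
    intro u hu
    have hc : ∀ᶠ k in (u : Filter ℕ), g.IsCausal (V k 0) :=
      Eventually.of_forall fun k ↦ by rw [hV0]; exact Or.inl (hT k)
    have hlimu : Tendsto (fun k ↦ V k 0) u (𝓝 (U 0)) :=
      (hlim.mono_left hu).congr fun k ↦ (hV0 k).symm
    obtain ⟨σ, hσ0, hσ⟩ := hg.exists_tendsto (Eventually.of_forall hS) (Eventually.of_forall hV)
      hc hlimu hl.1
    obtain ⟨W, hW, hW0, hWe, -⟩ := hg.tendsto_geodesic (Eventually.of_forall hS)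
      (Eventually.of_forall hV) hc hlimu hσ
    have hσδ : δ ≤ σ := ge_of_tendsto hσ (hSδ.filter_mono hu)
    have hWb : (W σ).proj ∈ (𝓡∂ n).boundary M :=
      isClosed_boundary.mem_of_tendsto ((continuous_proj.tendsto _).comp hWe)
        (Eventually.of_forall hVb)
    have hσs : σ = s := by
      rcases lt_trichotomy σ s with h | h | h
      · have heq := (hU.mono (Icc_subset_Icc_right h.le) ordConnected_Icc).eq_of_initial hW hW0.symm
          σ (right_mem_Icc.2 hσ0)
        rw [← heq] at hWb
        have hσm : σ ∈ Ioo 0 s := ⟨lt_of_lt_of_le hδ hσδ, h⟩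
        exact (hnb (hconv U _ hU hlt ⟨σ, Ioo_subset_Icc_self hσm,
          hU.isTangentToBoundary hσm hWb⟩)).elim
      · exact h
      · have heq := (hW.mono (Icc_subset_Icc_right h.le) ordConnected_Icc).eq_of_initial hU hW0
        have hsm : s ∈ Ioo 0 σ := ⟨hs, h⟩
        have hWs : (W s).proj ∈ (𝓡∂ n).boundary M := by
          rw [heq s (right_mem_Icc.2 hs.le)]; exact hend
        have hWl : ∀ t ∈ Icc 0 σ, g.IsLightlike (W t) := fun t ht ↦
          hW.isLightlike (left_mem_Icc.2 hσ0) ht (hW0 ▸ hl)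
        have hWall := hconv W _ hW hWl ⟨s, Ioo_subset_Icc_self hsm,
          hW.isTangentToBoundary hsm hWs⟩
        exact (hnb fun t ht ↦ heq t ht ▸ hWall t ⟨ht.1, ht.2.trans h.le⟩).elim
    subst hσs
    refine ⟨hσ, ?_⟩
    rwa [hW.eq_of_initial hU hW0 σ (right_mem_Icc.2 hσ0)] at hWe
  refine ⟨S, V, fun k ↦ ⟨hS k, hV k, ?_, ?_, ?_, hVb k⟩,
    tendsto_iff_ultrafilter _ _ _ |>.2 fun u hu ↦ (key u hu).1, ?_,
    tendsto_iff_ultrafilter _ _ _ |>.2 fun u hu ↦ (key u hu).2⟩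
  · rw [hV0]; rfl
  · rw [hV0]; exact hT k
  · rw [hV0]; exact timePairing_tilt_neg (hε0 k) hf.le
  · exact hlim.congr fun k ↦ (hV0 k).symm

theorem properTimeProbeData_subset [T2Space M] [CompactSpace M] (hg : g.CausalBounds)
    (hconv : g.LightlikeTangentGeodesicsStayInBoundary) :
    g.properTimeProbeData ⊆ g.lensDataLimits := by
  rintro _ ⟨ξ, t, η, rfl, hD, τ, s, V, W, ⟨hτ, hs, hV, hV0, hW, hW0, hp⟩, ht, hcase⟩
  obtain ⟨hξ, hη, hξt, hξf, hηl, hηf, -⟩ := mem_timeProbeData.1 hD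
  refine ⟨ξ, t, η, rfl, hξ, hη, hηl.1, fun hL ↦ ?_, ?_⟩
  · have := (mem_brokenTimelikeLensData.1 hL).2.2.2.2.1
    exact (ne_of_lt this) hηl.2
  by_cases hcase' : s = 0
  · subst hcase'
    set ε : ℕ → ℝ := fun k ↦ 1 / ((k : ℝ) + 1) with hε
    have hε0 : ∀ k, 0 < ε k := fun k ↦ Nat.one_div_pos_of_nat
    have hεt : Tendsto ε atTop (𝓝 0) := tendsto_one_div_add_atTop_nhds_zero_nat
    refine ⟨fun _ ↦ t, fun k ↦ g.tilt (ε k) η, tendsto_const_nhds, tendsto_tilt hεt η,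
      fun k ↦ mem_brokenTimelikeLensData.2 ⟨hξ, hη, hξt, hξf, ?_, ?_, ?_⟩⟩
    · exact isTimelike_tilt hηl.2.le (hε0 k).ne'
        (mul_nonpos_of_nonneg_of_nonpos (hε0 k).le hηf.le)
    · exact timePairing_tilt_neg (hε0 k) hηf.le
    · refine ⟨τ, 0, V, fun _ ↦ vscale (-1) (g.tilt (ε k) η), hτ, le_rfl, hV, hV0,
        isGeodesicOn_singleton _ _, rfl, ?_, by rw [← ht]; ring⟩
      rw [hp, neg_zero, hW0]; rfl
  · have hs' : 0 < s := lt_of_le_of_ne hs (Ne.symm hcase')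
    obtain ⟨r, hr, hrb⟩ := hcase.resolve_left hcase'
    have hU : g.IsGeodesicOn (fun t ↦ W (t + -s)) (Icc 0 s) :=
      hW.shift (-s) (by linarith) (by linarith)
    have hms : -s ∈ Icc (-s) 0 := left_mem_Icc.2 (by linarith)
    have h0m : (0 : ℝ) ∈ Icc (-s) 0 := right_mem_Icc.2 (by linarith)
    have hWl : g.IsLightlike (W (-s)) := hW.isLightlike h0m hms (hW0 ▸ hηl)
    have hWf : g.timePairing (W (-s)) < 0 :=
      hW.timePairing_neg h0m hms (hW0 ▸ Or.inr hηl) (hW0 ▸ hηf)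
    obtain ⟨S, U, hSU, hS, hU0, hUS⟩ := exists_timelike_approximation hg hconv hs' hU
      (by rw [zero_add]; exact hWl) (by rw [zero_add]; exact hWf)
      (by rw [add_neg_cancel, hW0]; exact hη) fun hall ↦ hrb (by
        have := hall (r + s) ⟨by linarith [hr.1], by linarith [hr.2]⟩
        rwa [add_neg_cancel_right] at this)
    simp only [zero_add, add_neg_cancel, hW0] at hSU hU0 hUS
    refine ⟨fun k ↦ τ * g.causalNorm ξ + S k * g.causalNorm (U k (S k)),
      fun k ↦ U k (S k), ?_, hUS, fun k ↦ mem_brokenTimelikeLensData.2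
        ⟨hξ, (hSU k).2.2.2.2.2, hξt, hξf, ?_, ?_, ?_⟩⟩
    · have h1 := tendsto_const_nhds (x := τ * g.causalNorm ξ).add
        (hS.mul ((continuous_causalNorm (g := g).tendsto η).comp hUS))
      rw [hηl.causalNorm_eq, mul_zero, add_zero] at h1
      rw [ht] at h1 ⊢
      exact h1
    · exact (hSU k).2.1.isTimelike (left_mem_Icc.2 (hSU k).1) (right_mem_Icc.2 (hSU k).1)
        (hSU k).2.2.2.1
    · exact (hSU k).2.1.timePairing_neg (left_mem_Icc.2 (hSU k).1) (right_mem_Icc.2 (hSU k).1)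
        (Or.inl (hSU k).2.2.2.1) (hSU k).2.2.2.2.1
    · refine ⟨τ, S k, V, fun r ↦ vscale (-1) (U k (S k - r)), hτ, (hSU k).1, hV, hV0,
        (hSU k).2.1.reverse (S k) (by linarith) (by linarith), by simp only [sub_zero], ?_, ?_⟩
      · rw [vscale_proj, sub_self, (hSU k).2.2.1, hp]
      · rw [causalNorm_vscale_neg_one]

end Transversal

end TimeOrientedLorentzianMetric

theorem exists_norm_smul_sub_smul_ge {E : Type*} [NormedAddCommGroup E] [NormedSpace ℝ E] {c w : E}
    (h : ∀ a b : ℝ, a • c = b • w → a = 0 ∧ b = 0) :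
    ∃ κ > 0, ∀ a b : ℝ, κ * (|a| + |b|) ≤ ‖a • c - b • w‖ := by
  set f : ℝ × ℝ →ₗ[ℝ] E := (LinearMap.toSpanSingleton ℝ E c).comp (LinearMap.fst ℝ ℝ ℝ) -
    (LinearMap.toSpanSingleton ℝ E w).comp (LinearMap.snd ℝ ℝ ℝ) with hf
  have hfa : ∀ a b : ℝ, f (a, b) = a • c - b • w := fun a b ↦ rfl
  have hker : LinearMap.ker f = ⊥ := by
    rw [LinearMap.ker_eq_bot']
    rintro ⟨a, b⟩ hab
    rw [hfa, sub_eq_zero] at hab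
    obtain ⟨rfl, rfl⟩ := h a b hab
    rfl
  obtain ⟨K, hK, hL⟩ := f.exists_antilipschitzWith hker
  have hK' : (0 : ℝ) < K := hK
  refine ⟨(2 * K)⁻¹, by positivity, fun a b ↦ ?_⟩
  have h1 := hL.le_mul_dist (a, b) 0
  rw [map_zero, dist_zero_right, dist_zero_right, hfa] at h1
  have h2 : |a| ≤ ‖(a, b)‖ := norm_fst_le (a, b)
  have h3 : |b| ≤ ‖(a, b)‖ := norm_snd_le (a, b)
  rw [inv_mul_le_iff₀ (by positivity)]
  linarith

namespace TimeOrientedLorentzianMetric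

variable {n : ℕ} [NeZero n] {M : Type*} [TopologicalSpace M]
  [ChartedSpace (EuclideanHalfSpace n) M] [IsManifold (𝓡∂ n) ∞ M]
  {g : TimeOrientedLorentzianMetric n M}

theorem convergesAtRate_const {ι : Type*} {l : Filter ι} (θ : ι → ℝ)
    {Z : ι → TangentBundle (𝓡∂ n) M} {z : TangentBundle (𝓡∂ n) M} (h : ∀ᶠ i in l, Z i = z) :
    ConvergesAtRate l θ Z z := fun x₀ _ ↦ ⟨0, h.mono fun i hi ↦ by rw [hi, dist_self, zero_mul]⟩

theorem convergesAtRate_tilt {ι : Type*} {l : Filter ι} (θ : ι → ℝ)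
    (z : TangentBundle (𝓡∂ n) M) : ConvergesAtRate l θ (fun i ↦ g.tilt (θ i) z) z := by
  intro x₀ hx₀
  refine ⟨‖tangentCoord x₀ (⟨z.proj, g.timeField z.proj⟩ : TangentBundle (𝓡∂ n) M)‖,
    Eventually.of_forall fun i ↦ ?_⟩
  have h1 : tangentCoord x₀ (g.tilt (θ i) z) = tangentCoord x₀ z +
      θ i • tangentCoord x₀ (⟨z.proj, g.timeField z.proj⟩ : TangentBundle (𝓡∂ n) M) := by
    rw [← tangentCoord_smul x₀ _ hx₀]
    exact tangentCoord_add x₀ z.proj hx₀ z.2 _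
  rw [bundleChart_apply, bundleChart_apply, h1, tilt_proj, dist_prod_same_left, dist_eq_norm,
    add_sub_cancel_left, norm_smul, Real.norm_eq_abs, mul_comm]

/-- A timelike and a lightlike vector at the same point are linearly independent. -/
theorem smul_tangentCoord_eq {v w : TangentBundle (𝓡∂ n) M} (hv : g.IsTimelike v)
    (hw : g.IsLightlike w) (h : v.proj = w.proj) {x₀ : M}
    (hx₀ : v.proj ∈ (extChartAt (𝓡∂ n) x₀).source) {a b : ℝ}
    (hab : a • tangentCoord x₀ v = b • tangentCoord x₀ w) : a = 0 ∧ b = 0 := by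
  have hx₀' : w.proj ∈ (extChartAt (𝓡∂ n) x₀).source := h ▸ hx₀
  have h1 := g.normSq_eq_chart hx₀
  have h2 := g.normSq_eq_chart hx₀'
  rw [bundleChart_apply] at h1 h2
  simp only at h1 h2
  rw [← h, hw.2] at h2
  have h3 : a ^ 2 * g.normSq v = 0 := by
    have h4 := congrArg (fun u ↦ g.metricCoeff x₀ (extChartAt (𝓡∂ n) x₀ v.proj) u u) hab
    simp only [map_smul, smul_apply, smul_eq_mul, ← h1, ← h2] at h4
    linarith
  have ha : a = 0 := by
    rcases mul_eq_zero.1 h3 with h4 | h4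
    · exact pow_eq_zero_iff two_ne_zero |>.1 h4
    · exact absurd h4 (ne_of_lt hv)
  refine ⟨ha, ?_⟩
  subst ha
  rw [zero_smul] at hab
  rcases smul_eq_zero.1 hab.symm with h4 | h4
  · exact h4
  · exfalso
    have h5 : bundleChart x₀ (vscale 0 w) = bundleChart x₀ w := by
      rw [bundleChart_vscale 0 hx₀', bundleChart_apply, zero_smul, h4]
    have h6 := (bundleChart x₀).injOn ((mem_bundleChart_source (v := vscale 0 w)).2 hx₀')
      (mem_bundleChart_source.2 hx₀') h5
    have h7 : (vscale 0 w).2 = 0 := zero_smul ℝ _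
    rw [h6] at h7
    exact hw.1 h7

/-- If the geodesic starting with a timelike vector `z` meets all geodesics starting
with timelike vectors close to a lightlike vector `ν` at the same total length, then it meets the
base point of `ν` at this length. -/
theorem CausalBounds.exists_geodesic_of_meet_tilt [T2Space M] [CompactSpace M]
    (hg : g.CausalBounds)
    {z ν : TangentBundle (𝓡∂ n) M} {t : ℝ} (hz : g.IsTimelike z) (hν : g.IsLightlike ν)
    {ε : ℕ → ℝ} (hε : Tendsto ε atTop (𝓝 0)) (hε0 : ∀ k, ε k ≠ 0)
    (hεν : ∀ k, ε k * g.timePairing ν ≤ 0) (h : ∀ k, g.Meet z t (g.tilt (ε k) ν)) :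
    ∃ τ V, 0 ≤ τ ∧ g.IsGeodesicOn V (Icc 0 τ) ∧ V 0 = z ∧ (V τ).proj = ν.proj ∧
      τ * g.causalNorm z = t := by
  choose τ s V W hτ0 hs0 hV hV0 hW hW0 hp ht using h
  set u : Ultrafilter ℕ := Ultrafilter.of atTop
  have hu : (u : Filter ℕ) ≤ atTop := Ultrafilter.of_le _
  have hεu := hε.mono_left hu
  have hT : ∀ k, g.IsTimelike (g.tilt (ε k) ν) := fun k ↦ isTimelike_tilt hν.2.le (hε0 k) (hεν k)
  have tV : Tendsto (fun k ↦ V k 0) u (𝓝 z) := tendsto_const_nhds.congr fun k ↦ (hV0 k).symm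
  have tW : Tendsto (fun k ↦ W k 0) u (𝓝 ν) :=
    (tendsto_tilt (g := g) hεu ν).congr fun k ↦ (hW0 k).symm
  have cV : ∀ᶠ k in (u : Filter ℕ), g.IsCausal (V k 0) :=
    Eventually.of_forall fun k ↦ by rw [hV0]; exact Or.inl hz
  have cW : ∀ᶠ k in (u : Filter ℕ), g.IsCausal (W k 0) :=
    Eventually.of_forall fun k ↦ by rw [hW0]; exact Or.inl (hT k)
  have hz0 : z.2 ≠ 0 := (g.isCausal_iff.1 (Or.inl hz)).1
  obtain ⟨τ₀, hτ₀, hτ⟩ := hg.exists_tendsto (Eventually.of_forall hτ0) (Eventually.of_forall hV)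
    cV tV hz0
  obtain ⟨s₀, hs₀, hs⟩ := hg.exists_tendsto (Eventually.of_forall hs0) (Eventually.of_forall hW)
    cW tW hν.1
  obtain ⟨V', gV, hV'0, eV, rV⟩ := hg.tendsto_geodesic (Eventually.of_forall hτ0)
    (Eventually.of_forall hV) cV tV hτ
  obtain ⟨W', gW, hW'0, eW, rW⟩ := hg.tendsto_geodesic (Eventually.of_forall hs0)
    (Eventually.of_forall hW) cW tW hs
  have hpp : (V' τ₀).proj = (W' s₀).proj :=
    tendsto_nhds_unique (((continuous_proj.tendsto _).comp eV).congr hp)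
      ((continuous_proj.tendsto _).comp eW)
  have htt : τ₀ * g.causalNorm z = t := by
    have h2 := (continuous_causalNorm (g := g).tendsto ν).comp (tendsto_tilt (g := g) hεu ν)
    have h3 := tendsto_nhds_unique (((hτ.mul_const (g.causalNorm z)).add (hs.mul h2)).congr ht)
      tendsto_const_nhds
    rw [hν.causalNorm_eq] at h3
    linarith
  rcases hs₀.eq_or_lt with h0 | hs₀pos
  · subst h0
    exact ⟨τ₀, V', hτ₀, gV, hV'0, by rw [hpp, hW'0], htt⟩
  exfalso
  have rV' := rV ε (convergesAtRate_const ε (Eventually.of_forall hV0))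
  have rW' := rW ε (by
    have : (fun k ↦ W k 0) = fun k ↦ g.tilt (ε k) ν := funext hW0
    rw [this]; exact convergesAtRate_tilt ε ν)
  set q := (V' τ₀).proj with hq
  have hVt : g.IsTimelike (V' τ₀) :=
    gV.isTimelike (left_mem_Icc.2 hτ₀) (right_mem_Icc.2 hτ₀) (hV'0 ▸ hz)
  have hWl : g.IsLightlike (W' s₀) :=
    gW.isLightlike (left_mem_Icc.2 hs₀) (right_mem_Icc.2 hs₀) (hW'0 ▸ hν)
  have hqs : (V' τ₀).proj ∈ (extChartAt (𝓡∂ n) q).source := mem_extChartAt_source _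
  obtain ⟨κ, hκ, hlow⟩ := exists_norm_smul_sub_smul_ge fun a b hab ↦
    smul_tangentCoord_eq hVt hWl hpp hqs hab
  obtain ⟨C₁, hC₁, e₁⟩ := rV' q hqs (κ / 2) (by positivity)
  obtain ⟨C₂, hC₂, e₂⟩ := rW' q (hpp ▸ hqs) (κ / 2) (by positivity)
  have hr : ∀ᶠ k in (u : Filter ℕ), κ / 2 * |τ k - τ₀| ≤ (C₁ + C₂) * |ε k| := by
    filter_upwards [e₁, e₂] with k h1 h2
    have h3 := hlow (τ k - τ₀) (s k - s₀)
    rw [hp k, ← hq] at h1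
    rw [← hpp] at h2
    have h4 : ‖(τ k - τ₀) • tangentCoord q (V' τ₀) - (s k - s₀) • tangentCoord q (W' s₀)‖ ≤
        (C₂ * |ε k| + κ / 2 * |s k - s₀|) + (C₁ * |ε k| + κ / 2 * |τ k - τ₀|) := by
      refine le_trans ?_ (add_le_add h2 h1)
      refine le_trans (le_of_eq ?_) (norm_sub_le _ _)
      congr 1
      abel
    nlinarith [abs_nonneg (s k - s₀)]
  have hev : ∀ᶠ k in (u : Filter ℕ), s₀ / 2 < s k := hs.eventually (lt_mem_nhds (half_lt_self hs₀pos))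
  have hm : 0 < |g.timePairing ν| := abs_pos.2 (IsCausal.timePairing_ne_zero (Or.inr hν))
  set D := 2 / κ * ((C₁ + C₂) * g.causalNorm z) with hD
  have hnz : 0 ≤ g.causalNorm z := Real.sqrt_nonneg _
  have hD0 : 0 ≤ D := by positivity
  have hcon : ∀ᶠ k in (u : Filter ℕ), (s₀ / 2) ^ 2 * (2 * |g.timePairing ν|) ≤ D ^ 2 * |ε k| := by
    filter_upwards [hr, hev] with k h1 h2
    have hek : 0 < |ε k| := abs_pos.2 (hε0 k)
    have h3 : s k * g.causalNorm (g.tilt (ε k) ν) ≤ D * |ε k| := by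
      have h4 : s k * g.causalNorm (g.tilt (ε k) ν) = -(τ k - τ₀) * g.causalNorm z := by
        have := ht k
        linarith
      rw [h4]
      have h5 : -(τ k - τ₀) ≤ 2 / κ * ((C₁ + C₂) * |ε k|) := by
        rw [div_mul_eq_mul_div, le_div_iff₀ hκ]
        have := neg_le_abs (τ k - τ₀)
        nlinarith
      calc -(τ k - τ₀) * g.causalNorm z ≤ 2 / κ * ((C₁ + C₂) * |ε k|) * g.causalNorm z :=
            mul_le_mul_of_nonneg_right h5 hnz
        _ = D * |ε k| := by rw [hD]; ring
    have h6 : 2 * (|g.timePairing ν| * |ε k|) ≤ g.causalNorm (g.tilt (ε k) ν) ^ 2 := by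
      rw [causalNorm, Real.sq_sqrt (by linarith [show g.normSq (g.tilt (ε k) ν) < 0 from hT k]),
        normSq_tilt, hν.2]
      have h7 : |g.timePairing ν| * |ε k| = -(ε k * g.timePairing ν) := by
        rw [← abs_mul, mul_comm, abs_of_nonpos (hεν k)]
      have := g.timeField_timelike ν.proj
      have := sq_nonneg (ε k)
      nlinarith
    have hn : 0 ≤ g.causalNorm (g.tilt (ε k) ν) := Real.sqrt_nonneg _
    have h8 : (s₀ / 2 * g.causalNorm (g.tilt (ε k) ν)) ^ 2 ≤ (D * |ε k|) ^ 2 := by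
      refine pow_le_pow_left₀ (by positivity) (le_trans ?_ h3) 2
      exact mul_le_mul_of_nonneg_right h2.le hn
    have h9 : (s₀ / 2) ^ 2 * (2 * |g.timePairing ν|) * |ε k| ≤ D ^ 2 * |ε k| * |ε k| := by
      have := mul_le_mul_of_nonneg_left h6 (sq_nonneg (s₀ / 2))
      nlinarith
    exact le_of_mul_le_mul_right h9 hek
  have hlim : Tendsto (fun k ↦ D ^ 2 * |ε k|) u (𝓝 0) := by
    have := (hεu.abs.const_mul (D ^ 2))
    rwa [abs_zero, mul_zero] at this
  have := ge_of_tendsto hlim hcon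
  have : 0 < (s₀ / 2) ^ 2 * (2 * |g.timePairing ν|) := by positivity
  linarith

end TimeOrientedLorentzianMetric

namespace TimeOrientedLorentzianMetric

variable {n : ℕ} [NeZero n] {M : Type*} [TopologicalSpace M]
  [ChartedSpace (EuclideanHalfSpace n) M] [IsManifold (𝓡∂ n) ∞ M]

section TimeReverse

/-- The same metric, with the opposite time orientation. -/
def timeReverse (g : TimeOrientedLorentzianMetric n M) : TimeOrientedLorentzianMetric n M where
  inner := g.inner
  symm := g.symm
  signature := g.signature
  contMDiff := g.contMDiff
  timeField x := -g.timeField x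
  timeField_contMDiff := ContMDiff.neg_section (F := Model n) (V := TangentSpace (𝓡∂ n) (M := M))
    (s := g.timeField) g.timeField_contMDiff
  timeField_timelike x := by
    rw [map_neg (g.inner x (-g.timeField x)), g.symm, map_neg (g.inner x (g.timeField x)), neg_neg]
    exact g.timeField_timelike x

variable (g : TimeOrientedLorentzianMetric n M)

theorem timePairing_timeReverse (v : TangentBundle (𝓡∂ n) M) :
    g.timeReverse.timePairing v = -g.timePairing v := by
  change g.inner v.proj (-g.timeField v.proj) v.2 = _
  rw [map_neg, _root_.neg_apply]
  rfl

theorem timePairing_timeReverse_neg (v : TangentBundle (𝓡∂ n) M) :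
    g.timeReverse.timePairing (vscale (-1) v) = g.timePairing v := by
  rw [timePairing_timeReverse, timePairing_vscale]; ring

variable {g}

theorem CausalBounds.timeReverse (hg : g.CausalBounds) : g.timeReverse.CausalBounds := by
  obtain ⟨C, hC, h⟩ := hg
  refine ⟨C, hC, fun V a b hab hV hc ↦ ?_⟩
  simp only [timePairing_timeReverse, abs_neg]
  exact h V a b hab hV hc

variable (g) in
/-- Causal geodesics do not return to their starting point. -/
def NoCausalLoops : Prop :=
  ∀ (V : ℝ → TangentBundle (𝓡∂ n) M) (s : ℝ), 0 ≤ s → g.IsGeodesicOn V (Icc 0 s) →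
    g.IsCausal (V 0) → (V 0).proj = (V s).proj → s = 0

end TimeReverse

end TimeOrientedLorentzianMetric

open TimeOrientedLorentzianMetric

section LensMap

variable {n : ℕ} [NeZero n]
  {M₁ : Type*} [TopologicalSpace M₁] [ChartedSpace (EuclideanHalfSpace n) M₁]
  [IsManifold (𝓡∂ n) ∞ M₁]
  {M₂ : Type*} [TopologicalSpace M₂] [ChartedSpace (EuclideanHalfSpace n) M₂]
  [IsManifold (𝓡∂ n) ∞ M₂]

/-- A continuous injective fibre-preserving map of boundary vectors which is compatible with the
broken timelike lens data. -/
structure LensMap (g₁ : TimeOrientedLorentzianMetric n M₁)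
    (g₂ : TimeOrientedLorentzianMetric n M₂) where
  F : TangentBundle (𝓡∂ n) M₁ → TangentBundle (𝓡∂ n) M₂
  f : M₁ → M₂
  continuousOn_F : ContinuousOn F (boundaryTangentBundle n M₁)
  continuousOn_f : ContinuousOn f ((𝓡∂ n).boundary M₁)
  injOn_f : InjOn f ((𝓡∂ n).boundary M₁)
  proj_F : ∀ v ∈ boundaryTangentBundle n M₁, (F v).proj = f v.proj
  timelike : ∀ v ∈ boundaryTangentBundle n M₁, g₁.IsTimelike v → g₁.timePairing v < 0 →
    g₂.IsTimelike (F v) ∧ g₂.timePairing (F v) < 0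
  lightlike : ∀ v ∈ boundaryTangentBundle n M₁, g₁.IsLightlike v → g₁.timePairing v < 0 →
    g₂.IsLightlike (F v) ∧ g₂.timePairing (F v) < 0
  surj : ∀ x ∈ (𝓡∂ n).boundary M₁, ∀ w : TangentBundle (𝓡∂ n) M₂, w.proj = f x →
    g₂.IsTimelike w → g₂.timePairing w < 0 →
      ∃ v, v.proj = x ∧ g₁.IsTimelike v ∧ g₁.timePairing v < 0 ∧ F v = w
  meet : ∀ ξ ∈ boundaryTangentBundle n M₁, ∀ η ∈ boundaryTangentBundle n M₁,
    g₁.IsTimelike ξ → g₁.timePairing ξ < 0 → g₁.IsTimelike η → g₁.timePairing η < 0 →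
      ∀ t, g₁.Meet ξ t (vscale (-1) η) → g₂.Meet (F ξ) t (vscale (-1) (F η))

variable {g₁ : TimeOrientedLorentzianMetric n M₁} {g₂ : TimeOrientedLorentzianMetric n M₂}

namespace LensMap

theorem isTimelike_neg {M : Type*} [TopologicalSpace M] [ChartedSpace (EuclideanHalfSpace n) M]
    [IsManifold (𝓡∂ n) ∞ M] {g : TimeOrientedLorentzianMetric n M} {v : TangentBundle (𝓡∂ n) M}
    (h : g.IsTimelike v) : g.IsTimelike (vscale (-1) v) := by
  rw [IsTimelike, normSq_vscale]
  have : g.normSq v < 0 := h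
  linarith

theorem isLightlike_neg {M : Type*} [TopologicalSpace M] [ChartedSpace (EuclideanHalfSpace n) M]
    [IsManifold (𝓡∂ n) ∞ M] {g : TimeOrientedLorentzianMetric n M} {v : TangentBundle (𝓡∂ n) M}
    (h : g.IsLightlike v) : g.IsLightlike (vscale (-1) v) :=
  ⟨smul_ne_zero (by norm_num) h.1, by rw [normSq_vscale, h.2, mul_zero]⟩

/-- The lens map between the time-reversed manifolds. -/
def timeReverse (Φ : LensMap g₁ g₂) : LensMap g₁.timeReverse g₂.timeReverse where
  F v := vscale (-1) (Φ.F (vscale (-1) v))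
  f := Φ.f
  continuousOn_F := (continuous_vscale (-1)).comp_continuousOn
    (Φ.continuousOn_F.comp (continuous_vscale (-1)).continuousOn fun _ hv ↦ hv)
  continuousOn_f := Φ.continuousOn_f
  injOn_f := Φ.injOn_f
  proj_F v hv := Φ.proj_F (vscale (-1) v) hv
  timelike v hv ht hf := by
    rw [timePairing_timeReverse_neg]
    have h := Φ.timelike (vscale (-1) v) hv (isTimelike_neg (g := g₁) ht) (by
      rw [timePairing_timeReverse] at hf; rw [timePairing_vscale]; linarith)
    exact ⟨isTimelike_neg (g := g₂) h.1, h.2⟩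
  lightlike v hv ht hf := by
    rw [timePairing_timeReverse_neg]
    have h := Φ.lightlike (vscale (-1) v) hv (isLightlike_neg (g := g₁) ht) (by
      rw [timePairing_timeReverse] at hf; rw [timePairing_vscale]; linarith)
    exact ⟨isLightlike_neg (g := g₂) h.1, h.2⟩
  surj x hx w hw ht hf := by
    obtain ⟨v, hv, hvt, hvf, hvw⟩ := Φ.surj x hx (vscale (-1) w) hw (isTimelike_neg (g := g₂) ht)
      (by rw [timePairing_timeReverse] at hf; rw [timePairing_vscale]; linarith)
    refine ⟨vscale (-1) v, hv, isTimelike_neg (g := g₁) hvt, ?_, ?_⟩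
    · rwa [timePairing_timeReverse_neg]
    · rw [vscale_neg_one_neg_one, hvw, vscale_neg_one_neg_one]
  meet ξ hξ η hη ht hf ht' hf' t h := by
    rw [timePairing_timeReverse] at hf hf'
    have h1 : g₁.Meet (vscale (-1) η) t (vscale (-1) (vscale (-1) ξ)) := by
      rw [vscale_neg_one_neg_one]; exact h.symm
    have h2 := (Φ.meet (vscale (-1) η) hη (vscale (-1) ξ) hξ (isTimelike_neg (g := g₁) ht')
      (by rw [timePairing_vscale]; linarith) (isTimelike_neg (g := g₁) ht)
      (by rw [timePairing_vscale]; linarith) t h1).symm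
    rw [vscale_neg_one_neg_one]
    exact h2

variable [T2Space M₁] [CompactSpace M₁] [T2Space M₂] [CompactSpace M₂]

/-- Lens maps preserve the points of the boundary reached by timelike geodesics. -/
theorem reaches (Φ : LensMap g₁ g₂) (h₂ : g₂.CausalBounds) {V : ℝ → TangentBundle (𝓡∂ n) M₁}
    {τ : ℝ} (hτ : 0 ≤ τ)
    (hV : g₁.IsGeodesicOn V (Icc 0 τ)) (hb : V 0 ∈ boundaryTangentBundle n M₁)
    (ht : g₁.IsTimelike (V 0)) (hf : g₁.timePairing (V 0) < 0)
    (hp : (V τ).proj ∈ (𝓡∂ n).boundary M₁) {ν : TangentBundle (𝓡∂ n) M₂}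
    (hν : g₂.IsLightlike ν) (hνf : g₂.timePairing ν < 0) (hνp : ν.proj = Φ.f (V τ).proj) :
    ∃ τ' V', 0 ≤ τ' ∧ g₂.IsGeodesicOn V' (Icc 0 τ') ∧ V' 0 = Φ.F (V 0) ∧
      (V' τ').proj = Φ.f (V τ).proj ∧
      τ' * g₂.causalNorm (Φ.F (V 0)) = τ * g₁.causalNorm (V 0) := by
  set ε : ℕ → ℝ := fun k ↦ 1 / ((k : ℝ) + 1) with hε
  have hε0 : ∀ k, 0 < ε k := fun k ↦ Nat.one_div_pos_of_nat
  have hεt : Tendsto (fun k ↦ -ε k) atTop (𝓝 0) := by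
    have : Tendsto ε atTop (𝓝 0) := tendsto_one_div_add_atTop_nhds_zero_nat
    simpa using this.neg
  have hFt := Φ.timelike _ hb ht hf
  have hpos : ∀ k, -ε k * g₂.timePairing (vscale (-1) ν) ≤ 0 := fun k ↦ by
    rw [timePairing_vscale]; nlinarith [hε0 k]
  have hνl := isLightlike_neg hν
  have key : ∀ k, g₂.Meet (Φ.F (V 0)) (τ * g₁.causalNorm (V 0))
      (g₂.tilt (-ε k) (vscale (-1) ν)) := by
    intro k
    have h1 : g₂.IsTimelike (g₂.tilt (-ε k) (vscale (-1) ν)) :=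
      isTimelike_tilt hνl.2.le (by linarith [hε0 k]) (hpos k)
    obtain ⟨v, hvp, hvt, hvf, hFv⟩ := Φ.surj (V τ).proj hp
      (vscale (-1) (g₂.tilt (-ε k) (vscale (-1) ν))) hνp (isTimelike_neg h1) (by
        rw [timePairing_vscale, timePairing_tilt, timePairing_vscale]
        have := g₂.timeField_timelike (vscale (-1) ν).proj
        nlinarith [hε0 k])
    have h2 := Φ.meet (V 0) hb v (by rw [← hvp] at hp; exact hp) ht hf hvt hvf
      (τ * g₁.causalNorm (V 0)) ⟨τ, 0, V, fun _ ↦ vscale (-1) v, hτ, le_rfl, hV, rfl,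
        isGeodesicOn_singleton _ _, rfl, hvp.symm, by ring⟩
    rwa [hFv, vscale_neg_one_neg_one] at h2
  obtain ⟨τ', V', h1, h2, h3, h4, h5⟩ := h₂.exists_geodesic_of_meet_tilt hFt.1 hνl hεt
    (fun k ↦ (neg_neg_of_pos (hε0 k)).ne) hpos key
  exact ⟨τ', V', h1, h2, h3, h4.trans hνp, h5⟩

/-- If a lightlike geodesic can be approximated by timelike geodesics which end with vectors at the
same boundary point, then the point corresponding to its starting point lies on the geodesic
ending with the vector corresponding to its final vector. -/
theorem past_reach (Φ : LensMap g₁ g₂) (h₁ : g₁.CausalBounds) (h₂ : g₂.CausalBounds)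
    {η : TangentBundle (𝓡∂ n) M₁} (hη : η ∈ boundaryTangentBundle n M₁) (hηl : g₁.IsLightlike η)
    (hηf : g₁.timePairing η < 0) {W : ℝ → TangentBundle (𝓡∂ n) M₁} {d : ℝ} (hd : 0 ≤ d)
    (hW : g₁.IsGeodesicOn W (Icc 0 d)) (hW0 : W 0 = vscale (-1) η)
    (hp : (W d).proj ∈ (𝓡∂ n).boundary M₁)
    {B : ℕ → ℝ → TangentBundle (𝓡∂ n) M₁} (hB : ∀ k, g₁.IsGeodesicOn (B k) (Icc 0 d))
    (hBp : ∀ k, (B k 0).proj = η.proj) (hBt : ∀ k, g₁.IsTimelike (B k 0))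
    (hBf : ∀ k, 0 < g₁.timePairing (B k 0))
    (hB0 : Tendsto (fun k ↦ B k 0) atTop (𝓝 (vscale (-1) η))) {ν : TangentBundle (𝓡∂ n) M₂}
    (hν : g₂.IsLightlike ν) (hνf : g₂.timePairing ν < 0) (hνp : ν.proj = Φ.f (W d).proj) :
    ∃ σ U, 0 ≤ σ ∧ g₂.IsGeodesicOn U (Icc 0 σ) ∧ U 0 = vscale (-1) (Φ.F η) ∧
      (U σ).proj = Φ.f (W d).proj := by
  have hBc : ∀ᶠ k in atTop, g₁.IsCausal (B k 0) := Eventually.of_forall fun k ↦ Or.inl (hBt k)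
  -- end points of the approximating geodesics
  have hend : Tendsto (fun k ↦ (B k d).proj) atTop (𝓝 (W d).proj) := by
    obtain ⟨W', hW', hW'0, hW'e, -⟩ := h₁.tendsto_geodesic (Eventually.of_forall fun _ ↦ hd)
      (Eventually.of_forall hB) hBc hB0 tendsto_const_nhds
    rw [hW'.eq_of_initial hW (hW'0.trans hW0.symm) d (right_mem_Icc.2 hd)] at hW'e
    exact (continuous_proj.tendsto _).comp hW'e
  set P : M₁ → TangentBundle (𝓡∂ n) M₁ := fun x ↦ vscale (-1) ⟨x, g₁.timeField x⟩ with hPdef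
  have hPc : Continuous P := (continuous_vscale (-1)).comp g₁.timeField_contMDiff.continuous
  have hPt : ∀ x, g₁.IsTimelike (P x) := fun x ↦ isTimelike_neg (g₁.timeField_timelike x)
  have hPf : ∀ x, 0 < g₁.timePairing (P x) := fun x ↦ by
    rw [hPdef, timePairing_vscale]
    have : g₁.timePairing (⟨x, g₁.timeField x⟩ : TangentBundle (𝓡∂ n) M₁) < 0 :=
      g₁.timeField_timelike x
    linarith
  choose S Y hS hY hY0 hYb _ using fun k ↦ h₁.exists_maximal (Or.inl (hPt (B k d).proj))
  set u : Ultrafilter ℕ := Ultrafilter.of atTop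
  have hu : (u : Filter ℕ) ≤ atTop := Ultrafilter.of_le _
  have tY : Tendsto (fun k ↦ Y k 0) u (𝓝 (P (W d).proj)) :=
    (((hPc.tendsto _).comp hend).mono_left hu).congr fun k ↦ (hY0 k).symm
  have cY : ∀ᶠ k in (u : Filter ℕ), g₁.IsCausal (Y k 0) :=
    Eventually.of_forall fun k ↦ by rw [hY0]; exact Or.inl (hPt _)
  have hP0 : (P (W d).proj).2 ≠ 0 := (g₁.isCausal_iff.1 (Or.inl (hPt _))).1
  obtain ⟨S₀, hS₀, hSt⟩ := h₁.exists_tendsto (Eventually.of_forall hS) (Eventually.of_forall hY)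
    cY tY hP0
  obtain ⟨Y', hY', hY'0, hY'e, -⟩ := h₁.tendsto_geodesic (Eventually.of_forall hS)
    (Eventually.of_forall hY) cY tY hSt
  have past : ∀ {V : ℝ → TangentBundle (𝓡∂ n) M₁} {s : ℝ} {x : M₁}, 0 ≤ s →
      g₁.IsGeodesicOn V (Icc 0 s) → V 0 = P x → g₁.IsTimelike (vscale (-1) (V s)) ∧
        g₁.timePairing (vscale (-1) (V s)) < 0 := by
    intro V s x hs hV hV0
    have h0 := left_mem_Icc.2 hs
    have hs' := right_mem_Icc.2 hs
    have h1 : g₁.IsTimelike (V s) := hV.isTimelike h0 hs' (hV0 ▸ hPt x)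
    refine ⟨isTimelike_neg h1, ?_⟩
    rw [timePairing_vscale]
    rcases lt_or_gt_of_ne (IsCausal.timePairing_ne_zero (Or.inl h1)) with h2 | h2
    · have h3 := hV.timePairing_neg hs' h0 (Or.inl h1) h2
      rw [hV0] at h3
      exact absurd h3 (not_lt.2 (hPf x).le)
    · linarith
  set ξ : ℕ → TangentBundle (𝓡∂ n) M₁ := fun k ↦ vscale (-1) (Y k (S k)) with hξ
  set ξ' := vscale (-1) (Y' S₀) with hξ'
  have hξb : ∀ k, ξ k ∈ boundaryTangentBundle n M₁ := hYb
  have hξt : Tendsto ξ u (𝓝 ξ') := ((continuous_vscale (-1)).tendsto _).comp hY'e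
  have hξ'b : ξ' ∈ boundaryTangentBundle n M₁ :=
    isClosed_boundary.mem_of_tendsto ((continuous_proj.tendsto ξ').comp hξt)
      (Eventually.of_forall hYb)
  have hFξ : Tendsto (fun k ↦ Φ.F (ξ k)) u (𝓝 (Φ.F ξ')) :=
    (Φ.continuousOn_F ξ' hξ'b).tendsto.comp (tendsto_nhdsWithin_iff.2
      ⟨hξt, Eventually.of_forall hξb⟩)
  set ζ : ℕ → TangentBundle (𝓡∂ n) M₁ := fun k ↦ vscale (-1) (B k 0) with hζ
  have hζb : ∀ k, ζ k ∈ boundaryTangentBundle n M₁ := fun k ↦ by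
    change (B k 0).proj ∈ (𝓡∂ n).boundary M₁
    rw [hBp]; exact hη
  have hζt : Tendsto ζ u (𝓝 η) := by
    have := ((continuous_vscale (-1)).tendsto _).comp (hB0.mono_left hu)
    rwa [vscale_neg_one_neg_one] at this
  have hFζ : Tendsto (fun k ↦ Φ.F (ζ k)) u (𝓝 (Φ.F η)) :=
    (Φ.continuousOn_F η hη).tendsto.comp (tendsto_nhdsWithin_iff.2
      ⟨hζt, Eventually.of_forall hζb⟩)
  have hζf : ∀ k, g₁.timePairing (ζ k) < 0 := fun k ↦ by
    rw [hζ, timePairing_vscale]; linarith [hBf k]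
  set t : ℕ → ℝ := fun k ↦ S k * g₁.causalNorm (ξ k) + d * g₁.causalNorm (ζ k) with ht
  have htt : Tendsto t u (𝓝 (S₀ * g₁.causalNorm ξ')) := by
    have h1 := ((continuous_causalNorm (g := g₁)).tendsto _).comp hξt
    have h2 := ((continuous_causalNorm (g := g₁)).tendsto _).comp hζt
    have h3 := (hSt.mul h1).add (h2.const_mul d)
    rwa [hηl.causalNorm_eq, mul_zero, add_zero] at h3
  have hmeet : ∀ k, g₂.Meet (Φ.F (ξ k)) (t k) (vscale (-1) (Φ.F (ζ k))) := by
    intro k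
    have hpk := past (hS k) (hY k) (hY0 k)
    refine Φ.meet _ (hξb k) _ (hζb k) hpk.1 hpk.2 (isTimelike_neg (hBt k)) (hζf k) (t k) ?_
    refine ⟨S k, d, fun r ↦ vscale (-1) (Y k (S k - r)), B k, hS k, hd,
      (hY k).reverse (S k) (by linarith) (by linarith), by simp only [sub_zero]; rfl, hB k,
      (vscale_neg_one_neg_one _).symm, ?_, ?_⟩
    · rw [vscale_proj, sub_self, hY0]; rfl
    · rw [causalNorm_vscale_neg_one (ζ k)]
  have hp' := past hS₀ hY' hY'0
  have hFξ' := Φ.timelike ξ' hξ'b hp'.1 hp'.2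
  have hFη := Φ.lightlike η hη hηl hηf
  have hlim : g₂.Meet (Φ.F ξ') (S₀ * g₁.causalNorm ξ') (vscale (-1) (Φ.F η)) := by
    refine h₂.meet_of_tendsto hFξ (((continuous_vscale (-1)).tendsto _).comp hFζ) htt
      (Eventually.of_forall fun k ↦ ?_) (Eventually.of_forall fun k ↦ ?_)
      (g₂.isCausal_iff.1 (Or.inl hFξ'.1)).1 (isLightlike_neg hFη.1).1
      (Eventually.of_forall hmeet)
    · have hpk := past (hS k) (hY k) (hY0 k)
      exact Or.inl (Φ.timelike _ (hξb k) hpk.1 hpk.2).1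
    · exact Or.inl (isTimelike_neg (Φ.timelike _ (hζb k) (isTimelike_neg (hBt k)) (hζf k)).1)
  obtain ⟨τ, σ, V, U, hτ, hσ, hV, hV0, hU, hU0, hVU, hlen⟩ := hlim
  rw [causalNorm_vscale_neg_one, hFη.1.causalNorm_eq, mul_zero, add_zero] at hlen
  have hX : g₁.IsGeodesicOn (fun r ↦ vscale (-1) (Y' (S₀ - r))) (Icc 0 S₀) :=
    hY'.reverse S₀ (by linarith) (by linarith)
  have hXe : (vscale (-1) (Y' (S₀ - S₀))).proj = (W d).proj := by
    rw [vscale_proj, sub_self, hY'0]; rfl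
  obtain ⟨τ', V', hτ', hV', hV'0, hV'e, hlen'⟩ := Φ.reaches h₂ hS₀ hX
    (by simp only [sub_zero]; exact hξ'b) (by simp only [sub_zero]; exact hp'.1)
    (by simp only [sub_zero]; exact hp'.2) (by simp only [hXe]; exact hp) hν hνf
    (by simp only [hXe]; exact hνp)
  simp only [sub_zero, hXe, ← hξ'] at hV'0 hV'e hlen'
  have hn : 0 < g₂.causalNorm (Φ.F ξ') := by
    have : g₂.normSq (Φ.F ξ') < 0 := hFξ'.1
    exact Real.sqrt_pos.2 (by linarith)
  have hττ : τ' = τ := mul_right_cancel₀ hn.ne' (hlen'.trans hlen.symm)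
  subst hττ
  refine ⟨σ, U, hσ, hU, hU0, ?_⟩
  rw [← hVU, hV.eq_of_initial hV' (hV0.trans hV'0.symm) τ' (right_mem_Icc.2 hτ), hV'e]

end LensMap

end LensMap

namespace TimeOrientedLorentzianMetric

variable {n : ℕ} [NeZero n] {M : Type*} [TopologicalSpace M]
  [ChartedSpace (EuclideanHalfSpace n) M] [IsManifold (𝓡∂ n) ∞ M]
  {g : TimeOrientedLorentzianMetric n M}

/-- Pushing the initial velocity of a geodesic in the boundary inwards gives, for a time which only
depends on the direction of the push, geodesics of the manifold. -/
theorem FlowBox.exists_pushed_geodesic [T2Space M] {z₀ : TangentBundle (𝓡∂ n) M}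
    (b : g.FlowBox z₀)
    {W : ℝ → TangentBundle (𝓡∂ n) M} {d : ℝ} (hd : 0 ≤ d) (hdδ : d ≤ b.δ)
    (hW : g.IsGeodesicOn W (Icc 0 d)) (hcore : W 0 ∈ b.core)
    (hW0 : ∀ σ ∈ Icc 0 d, (bundleChart z₀.proj (W σ)).2 0 = 0) {u : Model n}
    (hdu : d * (b.K * ‖u‖ * Real.exp (b.K * b.δ)) ≤ u 0)
    (hu : (bundleChart z₀.proj (W 0)) + (0, u) ∈
      Metric.closedBall (bundleChart z₀.proj z₀) (b.R / 2)) :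
    ∃ B, g.IsGeodesicOn B (Icc 0 d) ∧
      B 0 = (bundleChart z₀.proj).symm (bundleChart z₀.proj (W 0) + (0, u)) := by
  set x₀ := z₀.proj
  set κ := (bundleChart x₀ : PartialEquiv (TangentBundle (𝓡∂ n) M) (Phase n)) with hκ
  obtain ⟨y, hy0, hy⟩ := b.exists_solution hu
  have hsub : Icc 0 d ⊆ Icc 0 b.δ := Icc_subset_Icc_right hdδ
  have hmem := b.geodesic_mem hdδ hW hcore
  have hder : ∀ t ∈ Icc 0 d, HasDerivWithinAt (fun t ↦ κ (W t))
      (g.extField x₀ (κ (W t))) (Icc 0 d) t := fun t ht ↦ by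
    rw [g.extField_eq (bundleChart_nonneg x₀ (W t))]
    exact hW.hasDerivWithinAt ht (mem_bundleChart_source.1 (hmem t ht).1)
  have hyd : ∀ t ∈ Icc 0 d, HasDerivWithinAt y (g.extField x₀ (y t)) (Icc 0 d) t := fun t ht ↦
    (hy t (hsub ht)).1.mono hsub
  have hnu : ‖((0, u) : Phase n)‖ = ‖u‖ := by
    rw [Prod.norm_def, norm_zero, max_eq_right (norm_nonneg u)]
  have hG : ∀ t ∈ Icc 0 d, dist (y t) (κ (W t)) ≤ ‖u‖ * Real.exp (b.K * b.δ) := by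
    intro t ht
    have := dist_le_of_trajectories_ODE_of_mem (v := fun _ ↦ g.extField x₀)
      (s := fun _ ↦ Metric.closedBall (κ z₀) b.R) (K := b.K) (f := y) (g := fun t ↦ κ (W t))
      (a := 0) (b := d) (δ := ‖u‖) (fun _ _ ↦ b.lipschitz)
      (HasDerivWithinAt.continuousOn hyd)
      (fun t ht ↦ (hyd t ⟨ht.1, ht.2.le⟩).mono_of_mem_nhdsWithin (Icc_mem_nhdsGE_of_mem ht))
      (fun t ht ↦ (hy t (hsub ⟨ht.1, ht.2.le⟩)).2)
      (HasDerivWithinAt.continuousOn hder)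
      (fun t ht ↦ (hder t ⟨ht.1, ht.2.le⟩).mono_of_mem_nhdsWithin (Icc_mem_nhdsGE_of_mem ht))
      (fun t ht ↦ (hmem t ⟨ht.1, ht.2.le⟩).2)
      (by rw [hy0, dist_eq_norm, add_sub_cancel_left, hnu]) t ht
    refine this.trans (mul_le_mul_of_nonneg_left (Real.exp_le_exp.2 ?_) (norm_nonneg _))
    rw [sub_zero]
    exact mul_le_mul_of_nonneg_left (ht.2.trans hdδ) b.K.2
  have hlip : ∀ t ∈ Icc 0 d, ‖(y t - κ (W t)) - (y 0 - κ (W 0))‖ ≤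
      b.K * (‖u‖ * Real.exp (b.K * b.δ)) * (t - 0) :=
    norm_image_sub_le_of_norm_deriv_le_segment'
      (f := fun t ↦ y t - κ (W t)) (fun t ht ↦ (hyd t ht).sub (hder t ht)) fun t ht ↦ by
        have ht' : t ∈ Icc 0 d := ⟨ht.1, ht.2.le⟩
        have h1 := b.lipschitz.dist_le_mul _ (hy t (hsub ht')).2 _ (hmem t ht').2
        rw [dist_eq_norm] at h1
        exact h1.trans (mul_le_mul_of_nonneg_left (hG t ht') b.K.2)
  have hvel : ∀ t ∈ Icc 0 d, 0 ≤ (y t).2 0 := by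
    intro t ht
    have h1 : y 0 - κ (W 0) = (0, u) := by rw [hy0, add_sub_cancel_left]
    have h2 := hlip t ht
    rw [h1] at h2
    have h3 := (abs_le.1 ((abs_snd_zero_sub_le (y t - κ (W t)) (0, u)).trans h2)).1
    have h4 : (y t - κ (W t)).2 0 = (y t).2 0 := by
      rw [Prod.snd_sub, PiLp.sub_apply, hW0 t ht, sub_zero]
    rw [h4] at h3
    have h5 : 0 ≤ b.K * ‖u‖ * Real.exp (b.K * b.δ) := by positivity
    have h6 : b.K * (‖u‖ * Real.exp (b.K * b.δ)) * (t - 0) ≤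
        d * (b.K * ‖u‖ * Real.exp (b.K * b.δ)) := by
      have := mul_le_mul_of_nonneg_right ht.2 h5
      linarith
    have h7 : ((0, u) : Phase n).2 0 = u 0 := rfl
    linarith
  have hnn : ∀ t ∈ Icc 0 d, 0 ≤ (y t).1 0 := by
    have hmono : MonotoneOn (fun t ↦ (y t).1 0) (Icc 0 d) := by
      refine monotoneOn_of_hasDerivWithinAt_nonneg (convex_Icc 0 d)
        (fun t ht ↦ (hasDerivWithinAt_fst_zero (hyd t ht)).continuousWithinAt)
        (fun t ht ↦ (hasDerivWithinAt_fst_zero (hyd t (interior_subset ht))).mono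
          interior_subset) fun t ht ↦ ?_
      rw [g.extField_fst]
      exact hvel t (interior_subset ht)
    intro t ht
    refine le_trans ?_ (hmono (left_mem_Icc.2 hd) ht ht.1)
    have h1 : (y 0).1 0 = (κ (W 0)).1 0 := by
      rw [hy0, Prod.fst_add, add_zero]
    simp only [h1]
    exact bundleChart_nonneg _ _
  refine ⟨_, b.isGeodesicOn_symm ordConnected_Icc
    (fun t ht ↦ ⟨hyd t ht, (hy t (hsub ht)).2⟩) hnn, ?_⟩
  simp only [hy0]
  rfl

/-- Near a point of a lightlike geodesic in the boundary at which there is a suitable timelike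
direction, its pieces can be approximated, backwards in time, by timelike geodesics. -/
theorem IsGeodesicOn.exists_timelike_approximation [T2Space M] {W : ℝ → TangentBundle (𝓡∂ n) M}
    {a b t₀ : ℝ} (hab : a < b) (hW : g.IsGeodesicOn W (Icc a b))
    (hb : ∀ t ∈ Icc a b, (W t).proj ∈ (𝓡∂ n).boundary M)
    (hl : ∀ t ∈ Icc a b, g.IsLightlike (W t)) (hf : ∀ t ∈ Icc a b, g.timePairing (W t) < 0)
    (ht₀ : t₀ ∈ Icc a b) {u : Model n} (hu0 : u 0 < 0)
    (huu : g.metricCoeff (W t₀).proj (extChartAt (𝓡∂ n) (W t₀).proj (W t₀).proj) u u < 0)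
    (hwu : g.metricCoeff (W t₀).proj (extChartAt (𝓡∂ n) (W t₀).proj (W t₀).proj)
      (bundleChart (W t₀).proj (W t₀)).2 u < 0) :
    ∃ A ∈ 𝓝[Icc a b] t₀, ∀ r ∈ Icc a b ∩ A, ∀ t ∈ Icc a b ∩ A, r ≤ t →
      ∃ B : ℕ → ℝ → TangentBundle (𝓡∂ n) M,
        (∀ k, g.IsGeodesicOn (B k) (Icc 0 (t - r)) ∧ (B k 0).proj = (W t).proj ∧
          g.IsTimelike (B k 0) ∧ 0 < g.timePairing (B k 0)) ∧
        Tendsto (fun k ↦ B k 0) atTop (𝓝 (vscale (-1) (W t))) := by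
  set z₀ := vscale (-1) (W t₀) with hz₀
  obtain ⟨β⟩ := g.nonempty_flowBox z₀
  set x₀ := (W t₀).proj with hx₀
  have hzx : z₀.proj = x₀ := rfl
  set κ := (bundleChart x₀ : PartialEquiv (TangentBundle (𝓡∂ n) M) (Phase n)) with hκ
  have hsrc : (W t₀).proj ∈ (extChartAt (𝓡∂ n) x₀).source := mem_extChartAt_source _
  set Q := β.K * ‖u‖ * Real.exp (β.K * β.δ) with hQ
  have hQ0 : 0 ≤ Q := by positivity
  set δ := min β.δ (-(u 0) / (Q + 1)) with hδ
  have hδ0 : 0 < δ := lt_min β.δ_pos (div_pos (by linarith) (by linarith))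
  have hWc : ContinuousWithinAt W (Icc a b) t₀ := hW.2.1 t₀ ht₀
  have hWn : Tendsto (fun t ↦ vscale (-1) (W t)) (𝓝[Icc a b] t₀) (𝓝 z₀) :=
    ((continuous_vscale (-1)).tendsto _).comp hWc
  have hp : Tendsto (fun t ↦ (W t).proj) (𝓝[Icc a b] t₀) (𝓝 x₀) :=
    (continuous_proj.tendsto _).comp hWc
  have hG : ContinuousWithinAt (fun t ↦ g.metricCoeff x₀ (extChartAt (𝓡∂ n) x₀ (W t).proj))
      (Icc a b) t₀ :=
    ((g.continuousOn_metricCoeff x₀).continuousAt (extChartAt_source_mem_nhds x₀)).tendsto.comp hp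
  have hκW : Tendsto (fun t ↦ κ (W t)) (𝓝[Icc a b] t₀) (𝓝 (κ (W t₀))) :=
    (continuousAt_bundleChart hsrc).tendsto.comp hWc
  have hκn : Tendsto (fun t ↦ κ (vscale (-1) (W t))) (𝓝[Icc a b] t₀) (𝓝 (κ z₀)) :=
    (continuousAt_bundleChart (v := z₀) hsrc).tendsto.comp hWn
  have hR := β.R_pos
  have e1 := hWn.eventually β.core_mem_nhds_self
  have e2 := hκn.eventually (Metric.ball_mem_nhds (κ z₀) (show 0 < β.R / 4 by positivity))
  have e3 : ∀ᶠ t in 𝓝[Icc a b] t₀,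
      g.metricCoeff x₀ (extChartAt (𝓡∂ n) x₀ (W t).proj) u u < 0 := by
    have : ContinuousWithinAt (fun t ↦ g.metricCoeff x₀ (extChartAt (𝓡∂ n) x₀ (W t).proj) u u)
        (Icc a b) t₀ :=
      (hG.clm_apply continuousWithinAt_const).clm_apply continuousWithinAt_const
    exact this.tendsto.eventually (gt_mem_nhds huu)
  have e4 : ∀ᶠ t in 𝓝[Icc a b] t₀,
      g.metricCoeff x₀ (extChartAt (𝓡∂ n) x₀ (W t).proj) (κ (W t)).2 u < 0 := by
    have hκ2 : ContinuousWithinAt (fun t ↦ (κ (W t)).2) (Icc a b) t₀ :=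
      (continuous_snd.tendsto _).comp hκW
    have : ContinuousWithinAt (fun t ↦
        g.metricCoeff x₀ (extChartAt (𝓡∂ n) x₀ (W t).proj) (κ (W t)).2 u) (Icc a b) t₀ :=
      (hG.clm_apply hκ2).clm_apply continuousWithinAt_const
    exact this.tendsto.eventually (gt_mem_nhds hwu)
  have e5 : ∀ᶠ t in 𝓝[Icc a b] t₀, t ∈ Ioo (t₀ - δ / 2) (t₀ + δ / 2) :=
    mem_nhdsWithin_of_mem_nhds (Ioo_mem_nhds (by linarith) (by linarith))
  refine ⟨_, e1.and (e2.and (e3.and (e4.and e5))), ?_⟩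
  rintro r ⟨hr, -, -, -, -, hrδ⟩ t ⟨ht, htc, htd, htu, htw, htδ⟩ hrt
  set d := t - r with hd
  have hd0 : 0 ≤ d := sub_nonneg.2 hrt
  have hdδ : d ≤ δ := by linarith [htδ.2, hrδ.1]
  have hrev : g.IsGeodesicOn (fun σ ↦ vscale (-1) (W (t - σ))) (Icc 0 d) :=
    hW.reverse t (by linarith [hr.1]) (by linarith [ht.2])
  have hsrct : (W t).proj ∈ (extChartAt (𝓡∂ n) x₀).source :=
    (mem_bundleChart_source (v := vscale (-1) (W t))).1 htc.1
  set p := κ (vscale (-1) (W t)) with hpdef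
  have hp1 : p = ((κ (W t)).1, (-1 : ℝ) • (κ (W t)).2) := bundleChart_vscale _ hsrct
  have hpW : (κ (W t)).1 = extChartAt (𝓡∂ n) x₀ (W t).proj := by rw [hκ, bundleChart_apply]
  have hptar : p.1 ∈ (extChartAt (𝓡∂ n) x₀).target := by
    rw [hp1, hpW]; exact (extChartAt (𝓡∂ n) x₀).map_source hsrct
  have hdQ : d * Q ≤ -(u 0) := by
    have h1 : d ≤ -(u 0) / (Q + 1) := hdδ.trans (min_le_right _ _)
    rw [le_div_iff₀ (by linarith)] at h1
    nlinarith
  set η := β.R / 4 / (‖u‖ + 1) with hη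
  have hη0 : 0 < η := by positivity
  have hηu : η * ‖u‖ ≤ β.R / 4 := by
    rw [hη, div_mul_eq_mul_div, div_le_iff₀ (by positivity)]
    nlinarith [norm_nonneg u]
  set ε : ℕ → ℝ := fun k ↦ η * (1 / ((k : ℝ) + 1)) with hε
  have hε0 : ∀ k, 0 < ε k := fun k ↦ mul_pos hη0 Nat.one_div_pos_of_nat
  have hεη : ∀ k, ε k ≤ η := fun k ↦ by
    refine mul_le_of_le_one_right hη0.le ?_
    rw [div_le_one (by positivity)]
    have : (0 : ℝ) ≤ k := Nat.cast_nonneg k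
    linarith
  have hεt : Tendsto ε atTop (𝓝 0) := by
    have := (tendsto_one_div_add_atTop_nhds_zero_nat (𝕜 := ℝ)).const_mul η
    rwa [mul_zero] at this
  have hball : ∀ k, p + (0, (-ε k) • u) ∈ Metric.closedBall (κ z₀) (β.R / 2) := by
    intro k
    have h1 : ‖((0, (-ε k) • u) : Phase n)‖ ≤ β.R / 4 := by
      rw [Prod.norm_def, norm_zero, max_eq_right (norm_nonneg _), norm_smul, norm_neg,
        Real.norm_eq_abs, abs_of_pos (hε0 k)]
      exact (mul_le_mul_of_nonneg_right (hεη k) (norm_nonneg u)).trans hηu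
    have h2 : dist p (κ z₀) < β.R / 4 := htd
    rw [Metric.mem_closedBall]
    have h3 := dist_triangle (p + (0, (-ε k) • u)) p (κ z₀)
    rw [dist_eq_norm (p + _) p, add_sub_cancel_left] at h3
    linarith
  have hex := fun k ↦ β.exists_pushed_geodesic (u := (-ε k) • u) hd0 (hdδ.trans (min_le_left _ _))
    hrev (by simp only [sub_zero]; exact htc) (fun σ hσ ↦ by
      have hσm : t - σ ∈ Icc a b := ⟨by linarith [hσ.2, hr.1], by linarith [hσ.1, ht.2]⟩
      have hmem := (β.geodesic_mem (hdδ.trans (min_le_left _ _)) hrev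
        (by simp only [sub_zero]; exact htc) σ hσ).1
      have hs : (W (t - σ)).proj ∈ (extChartAt (𝓡∂ n) x₀).source :=
        (mem_bundleChart_source (v := vscale (-1) (W (t - σ)))).1 hmem
      rw [hzx, bundleChart_vscale _ hs, PiLp.smul_apply,
        hW.snd_zero_of_boundary hab hσm hb hs, smul_zero])
    (by
      rw [norm_smul, norm_neg, Real.norm_eq_abs, abs_of_pos (hε0 k), PiLp.smul_apply, smul_eq_mul]
      have := mul_le_mul_of_nonneg_left hdQ (hε0 k).le
      rw [hQ] at this
      linarith)
    (by simp only [sub_zero]; exact hball k)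
  choose B hB hB0 using hex
  simp only [sub_zero] at hB0
  have htar : ∀ k, p + (0, (-ε k) • u) ∈ κ.target := fun k ↦ by
    rw [hκ, bundleChart_target]
    refine ⟨?_, mem_univ _⟩
    rw [Prod.fst_add, add_zero]; exact hptar
  have hB0' : ∀ k, B k 0 = κ.symm (p + (0, (-ε k) • u)) := hB0
  have hκB : ∀ k, κ (B k 0) = p + (0, (-ε k) • u) := fun k ↦ by
    rw [hB0']; exact κ.right_inv (htar k)
  have hproj : ∀ k, (B k 0).proj = (W t).proj := fun k ↦ by
    rw [hB0', bundleChart_symm_proj (by rw [Prod.fst_add, add_zero]; exact hptar), Prod.fst_add,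
      add_zero, hp1, hpW, (extChartAt (𝓡∂ n) x₀).left_inv hsrct]
  have hptarget : p ∈ κ.target := by
    rw [hκ, bundleChart_target]; exact ⟨hptar, mem_univ _⟩
  have hlim : Tendsto (fun k ↦ B k 0) atTop (𝓝 (vscale (-1) (W t))) := by
    have h1 : Tendsto (fun k ↦ p + ((0, (-ε k) • u) : Phase n)) atTop (𝓝 (p + (0, (-0 : ℝ) • u))) :=
      tendsto_const_nhds.add (tendsto_const_nhds.prodMk_nhds (hεt.neg.smul_const u))
    have h2 : p + ((0, (-0 : ℝ) • u) : Phase n) = p := by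
      rw [neg_zero, zero_smul]; exact add_zero p
    rw [h2] at h1
    have h3 := (continuousOn_bundleChart_symm x₀ p hptarget).tendsto.comp
      (tendsto_nhdsWithin_iff.2 ⟨h1, Eventually.of_forall htar⟩)
    have h4 : κ.symm p = vscale (-1) (W t) := κ.left_inv htc.1
    rw [← h4]
    exact h3.congr fun k ↦ (hB0' k).symm
  have htl : ∀ k, g.IsTimelike (B k 0) := by
    intro k
    have hs : (B k 0).proj ∈ (extChartAt (𝓡∂ n) x₀).source := by rw [hproj]; exact hsrct
    have hN : g.metricCoeff x₀ (extChartAt (𝓡∂ n) x₀ (W t).proj) (κ (W t)).2 (κ (W t)).2 = 0 := by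
      rw [← hpW, ← (hl t ht).2, g.normSq_eq_chart hsrct]
    rw [IsTimelike, g.normSq_eq_chart hs, ← hκ, hκB, hp1]
    simp only [Prod.mk_add_mk, add_zero]
    rw [hpW]
    simp only [map_add, map_smul, add_apply, smul_apply, smul_eq_mul, hN]
    rw [g.metricCoeff_symm x₀ _ u (κ (W t)).2]
    have h1 := mul_neg_of_pos_of_neg (hε0 k) htw
    have h2 := mul_neg_of_pos_of_neg (pow_pos (hε0 k) 2) htu
    nlinarith
  have htp : ∀ᶠ k in atTop, 0 < g.timePairing (B k 0) := by
    refine ((continuous_timePairing.tendsto _).comp hlim).eventually (lt_mem_nhds ?_)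
    rw [timePairing_vscale]
    linarith [hf t ht]
  obtain ⟨N, hN⟩ := eventually_atTop.1 htp
  exact ⟨fun k ↦ B (k + N), fun k ↦ ⟨hB _, hproj _, htl _, hN _ (Nat.le_add_left N k)⟩,
    hlim.comp (tendsto_add_atTop_nat N)⟩

end TimeOrientedLorentzianMetric

namespace TimeOrientedLorentzianMetric

variable {n : ℕ} [NeZero n] {M : Type*} [TopologicalSpace M]
  [ChartedSpace (EuclideanHalfSpace n) M] [IsManifold (𝓡∂ n) ∞ M]
  {g : TimeOrientedLorentzianMetric n M}

section Follows

variable (g) in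
/-- The geodesic starting with `z` has a velocity which is a positive multiple of `z'`. -/
def Follows (z z' : TangentBundle (𝓡∂ n) M) : Prop :=
  ∃ σ U c, 0 ≤ σ ∧ 0 < c ∧ g.IsGeodesicOn U (Icc 0 σ) ∧ U 0 = z ∧ U σ = vscale c z'

theorem Follows.refl (z : TangentBundle (𝓡∂ n) M) : g.Follows z z :=
  ⟨0, fun _ ↦ z, 1, le_rfl, one_pos, isGeodesicOn_singleton _ _, rfl, (vscale_one z).symm⟩

theorem Follows.trans {z z' z'' : TangentBundle (𝓡∂ n) M} (h : g.Follows z z')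
    (h' : g.Follows z' z'') : g.Follows z z'' := by
  obtain ⟨σ, U, c, hσ, hc, hU, hU0, hUσ⟩ := h
  obtain ⟨σ', U', c', hσ', hc', hU', hU'0, hU'σ⟩ := h'
  have hq : 0 ≤ σ' / c := div_nonneg hσ' hc.le
  have hs : g.IsGeodesicOn (fun t ↦ vscale c (U' (c * t + -(c * σ)))) (Icc σ (σ + σ' / c)) := by
    refine hU'.comp_affine c (-(c * σ)) ordConnected_Icc fun t ht ↦ ⟨?_, ?_⟩
    · nlinarith [ht.1]
    · have h1 : t - σ ≤ σ' / c := by linarith [ht.2]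
      rw [le_div_iff₀ hc] at h1
      change c * t + -(c * σ) ≤ σ'
      linarith
  have hcat := hU.concat hs hσ (by linarith) (by
    rw [hUσ]; simp only [add_neg_cancel, hU'0])
  refine ⟨σ + σ' / c, _, c * c', by linarith, mul_pos hc hc', hcat, ?_, ?_⟩
  · simp only [if_pos hσ, hU0]
  · have h1 : c * (σ + σ' / c) + -(c * σ) = σ' := by field_simp; ring
    by_cases h2 : σ + σ' / c ≤ σ
    · have h3 : σ' = 0 := by
        have h4 : σ' / c = 0 := le_antisymm (by linarith) hq
        exact (div_eq_zero_iff.1 h4).resolve_right hc.ne'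
      subst h3
      simp only [zero_div, add_zero, le_refl, if_true]
      rw [hUσ, ← hU'0, hU'σ, vscale_vscale]
    · simp only [if_neg h2, h1]
      rw [hU'σ, vscale_vscale]

theorem Follows.reverse {z z' : TangentBundle (𝓡∂ n) M} (h : g.Follows z z') :
    g.Follows (vscale (-1) z') (vscale (-1) z) := by
  obtain ⟨σ, U, c, hσ, hc, hU, hU0, hUσ⟩ := h
  refine ⟨c * σ, fun t ↦ vscale (-c⁻¹) (U (-c⁻¹ * t + σ)), c⁻¹, by positivity, inv_pos.2 hc,
    hU.comp_affine (-c⁻¹) σ ordConnected_Icc fun t ht ↦ ⟨?_, ?_⟩, ?_, ?_⟩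
  · have h1 : c⁻¹ * t ≤ c⁻¹ * (c * σ) := mul_le_mul_of_nonneg_left ht.2 (inv_pos.2 hc).le
    rw [inv_mul_cancel_left₀ hc.ne'] at h1
    change 0 ≤ -c⁻¹ * t + σ
    linarith
  · have := mul_nonneg (inv_pos.2 hc).le ht.1
    change -c⁻¹ * t + σ ≤ σ
    linarith
  · simp only [mul_zero, zero_add]
    rw [hUσ, vscale_vscale, neg_mul, inv_mul_cancel₀ hc.ne']
  · have : -c⁻¹ * (c * σ) + σ = 0 := by
      rw [neg_mul, inv_mul_cancel_left₀ hc.ne', neg_add_cancel]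
    simp only [this]
    rw [hU0, vscale_vscale, mul_neg_one]

end Follows

section Chords

/-- The chord of a short geodesic is, up to a small relative error, given by the initial
velocity. -/
theorem eventually_chord_le [T2Space M] {ι : Type*} {l : Filter ι}
    {V : ι → ℝ → TangentBundle (𝓡∂ n) M} {s : ι → ℝ} {z : TangentBundle (𝓡∂ n) M}
    (hs : ∀ i, 0 ≤ s i) (hV : ∀ i, g.IsGeodesicOn (V i) (Icc 0 (s i)))
    (h0 : Tendsto (fun i ↦ V i 0) l (𝓝 z)) (hs0 : Tendsto s l (𝓝 0)) {ε : ℝ} (hε : 0 < ε) :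
    ∀ᶠ i in l, ‖extChartAt (𝓡∂ n) z.proj (V i (s i)).proj -
      extChartAt (𝓡∂ n) z.proj (V i 0).proj - s i • tangentCoord z.proj z‖ ≤ ε * s i := by
  obtain ⟨b⟩ := g.nonempty_flowBox z
  set x₀ := z.proj
  set κ := (bundleChart x₀ : PartialEquiv (TangentBundle (𝓡∂ n) M) (Phase n)) with hκ
  have hκ0 : Tendsto (fun i ↦ κ (V i 0)) l (𝓝 (κ z)) :=
    (continuousAt_bundleChart (mem_extChartAt_source _)).tendsto.comp h0
  have e1 : ∀ᶠ i in l, b.B * s i + dist (κ (V i 0)) (κ z) < ε := by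
    have h1 := (hs0.const_mul b.B).add (tendsto_iff_dist_tendsto_zero.1 hκ0)
    rw [mul_zero, add_zero] at h1
    exact h1.eventually (gt_mem_nhds hε)
  filter_upwards [e1, h0.eventually b.core_mem_nhds_self, hs0.eventually (gt_mem_nhds b.δ_pos)]
    with i hi hc hδ
  have hmem := b.geodesic_mem hδ.le (hV i) hc
  have hder : ∀ t ∈ Icc 0 (s i), HasDerivWithinAt (fun t ↦ κ (V i t))
      (g.extField x₀ (κ (V i t))) (Icc 0 (s i)) t := fun t ht ↦ by
    rw [g.extField_eq (bundleChart_nonneg x₀ (V i t))]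
    exact (hV i).hasDerivWithinAt ht (mem_bundleChart_source.1 (hmem t ht).1)
  have hlip := norm_image_sub_le_of_norm_deriv_le_segment' hder fun t ht ↦
    b.bound _ (hmem t ⟨ht.1, ht.2.le⟩).2
  have hder' : ∀ t ∈ Icc 0 (s i), HasDerivWithinAt (fun t ↦ (κ (V i t)).1 - t • (κ z).2)
      ((κ (V i t)).2 - (1 : ℝ) • (κ z).2) (Icc 0 (s i)) t := fun t ht ↦
    ((ContinuousLinearMap.fst ℝ (Model n) (Model n)).hasFDerivAt.comp_hasDerivWithinAt t
      (hder t ht)).sub ((hasDerivWithinAt_id t _).smul_const _)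
  have hbound : ∀ t ∈ Ico 0 (s i), ‖(κ (V i t)).2 - (1 : ℝ) • (κ z).2‖ ≤ ε := by
    intro t ht
    rw [one_smul]
    have h1 : ‖(κ (V i t)).2 - (κ z).2‖ ≤ dist (κ (V i t)) (κ z) := by
      rw [dist_eq_norm]; exact norm_snd_le (κ (V i t) - κ z)
    have h2 := dist_triangle (κ (V i t)) (κ (V i 0)) (κ z)
    have h3 := hlip t ⟨ht.1, ht.2.le⟩
    rw [← dist_eq_norm, sub_zero] at h3
    have h4 := mul_le_mul_of_nonneg_left ht.2.le b.B_nonneg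
    linarith
  have := norm_image_sub_le_of_norm_deriv_le_segment' hder' hbound (s i)
    (right_mem_Icc.2 (hs i))
  rw [hκ, bundleChart_apply, bundleChart_apply, bundleChart_apply] at this
  simp only [zero_smul, sub_zero] at this
  rwa [sub_right_comm] at this

theorem tangentCoord_ne_zero {x₀ : M} {v : TangentBundle (𝓡∂ n) M}
    (hx₀ : v.proj ∈ (extChartAt (𝓡∂ n) x₀).source) (hv : v.2 ≠ 0) : tangentCoord x₀ v ≠ 0 := by
  intro h
  have h5 : bundleChart x₀ (vscale 0 v) = bundleChart x₀ v := by
    rw [bundleChart_vscale 0 hx₀, bundleChart_apply, zero_smul, h]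
  have h6 := (bundleChart x₀).injOn ((mem_bundleChart_source (v := vscale 0 v)).2 hx₀)
    (mem_bundleChart_source.2 hx₀) h5
  have h7 : (vscale 0 v).2 = 0 := zero_smul ℝ _
  rw [h6] at h7
  exact hv h7

theorem eq_vscale_of_smul_tangentCoord {x₀ : M} {v w : TangentBundle (𝓡∂ n) M}
    (hx₀ : v.proj ∈ (extChartAt (𝓡∂ n) x₀).source) (h : v.proj = w.proj) {c : ℝ}
    (hc : tangentCoord x₀ v = c • tangentCoord x₀ w) : v = vscale c w := by
  refine (bundleChart x₀).injOn (mem_bundleChart_source.2 hx₀)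
    ((mem_bundleChart_source (v := vscale c w)).2 (h ▸ hx₀)) ?_
  rw [bundleChart_vscale c (h ▸ hx₀), bundleChart_apply, bundleChart_apply, hc, h]

end Chords

end TimeOrientedLorentzianMetric

open TimeOrientedLorentzianMetric

namespace LensMap

variable {n : ℕ} [NeZero n]
  {M₁ : Type*} [TopologicalSpace M₁] [ChartedSpace (EuclideanHalfSpace n) M₁]
  [IsManifold (𝓡∂ n) ∞ M₁]
  {M₂ : Type*} [TopologicalSpace M₂] [ChartedSpace (EuclideanHalfSpace n) M₂]
  [IsManifold (𝓡∂ n) ∞ M₂]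
  {g₁ : TimeOrientedLorentzianMetric n M₁} {g₂ : TimeOrientedLorentzianMetric n M₂}

/-- The geodesics ending with the vectors corresponding to `W t`, for `t` in `A`, contain the points
corresponding to the base points of `W r`, for `r ≤ t` in `A`. -/
def PastReach (Φ : LensMap g₁ g₂) (W : ℝ → TangentBundle (𝓡∂ n) M₁) (A : Set ℝ) : Prop :=
  ∀ r ∈ A, ∀ t ∈ A, r ≤ t → ∃ σ U, 0 ≤ σ ∧ g₂.IsGeodesicOn U (Icc 0 σ) ∧
    U 0 = vscale (-1) (Φ.F (W t)) ∧ (U σ).proj = Φ.f (W r).proj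

variable [T2Space M₁] [CompactSpace M₁] [T2Space M₂] [CompactSpace M₂]

theorem PastReach.follows {Φ : LensMap g₁ g₂} (h₂ : g₂.CausalBounds) (hl₁ : g₁.NoCausalLoops)
    (hl₂ : g₂.NoCausalLoops) {W : ℝ → TangentBundle (𝓡∂ n) M₁} {a b : ℝ} (hab : a ≤ b)
    (hW : g₁.IsGeodesicOn W (Icc a b)) (hb : ∀ t ∈ Icc a b, (W t).proj ∈ (𝓡∂ n).boundary M₁)
    (hl : ∀ t ∈ Icc a b, g₁.IsLightlike (W t)) (hf : ∀ t ∈ Icc a b, g₁.timePairing (W t) < 0)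
    (h : Φ.PastReach W (Icc a b)) :
    g₂.Follows (vscale (-1) (Φ.F (W b))) (vscale (-1) (Φ.F (W a))) := by
  rcases hab.eq_or_lt with rfl | hab'
  · exact Follows.refl _
  have ha := left_mem_Icc.2 hab
  have hbm := right_mem_Icc.2 hab
  set r : ℕ → ℝ := fun k ↦ a + (b - a) * (1 / ((k : ℝ) + 1)) with hr
  have hra : ∀ k, a < r k := fun k ↦ by
    have : 0 < (b - a) * (1 / ((k : ℝ) + 1)) :=
      mul_pos (sub_pos.2 hab') Nat.one_div_pos_of_nat
    simp only [hr]; linarith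
  have hrb : ∀ k, r k ≤ b := fun k ↦ by
    have h1 : (1 : ℝ) / ((k : ℝ) + 1) ≤ 1 := by
      rw [div_le_one (by positivity)]
      have : (0 : ℝ) ≤ k := Nat.cast_nonneg k
      linarith
    have := mul_le_of_le_one_right (sub_nonneg.2 hab) h1
    simp only [hr]; linarith
  have hrm : ∀ k, r k ∈ Icc a b := fun k ↦ ⟨(hra k).le, hrb k⟩
  have hrt : Tendsto r atTop (𝓝 a) := by
    have := ((tendsto_one_div_add_atTop_nhds_zero_nat (𝕜 := ℝ)).const_mul (b - a)).const_add a
    rwa [mul_zero, add_zero] at this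
  have hX : ∀ t ∈ Icc a b, g₂.IsLightlike (Φ.F (W t)) ∧ g₂.timePairing (Φ.F (W t)) < 0 :=
    fun t ht ↦ Φ.lightlike _ (hb t ht) (hl t ht) (hf t ht)
  have hXn : ∀ t ∈ Icc a b, g₂.IsCausal (vscale (-1) (Φ.F (W t))) := fun t ht ↦
    Or.inr (isLightlike_neg (hX t ht).1)
  set u : Ultrafilter ℕ := Ultrafilter.of atTop
  have hu : (u : Filter ℕ) ≤ atTop := Ultrafilter.of_le _
  have hrW : Tendsto (fun k ↦ W (r k)) u (𝓝 (W a)) :=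
    ((hW.2.1 a ha).tendsto.comp (tendsto_nhdsWithin_iff.2
      ⟨hrt, Eventually.of_forall hrm⟩)).mono_left hu
  have hFW : Tendsto (fun k ↦ vscale (-1) (Φ.F (W (r k)))) u (𝓝 (vscale (-1) (Φ.F (W a)))) :=
    ((continuous_vscale (-1)).tendsto _).comp ((Φ.continuousOn_F _ (hb a ha)).tendsto.comp
      (tendsto_nhdsWithin_iff.2 ⟨hrW, Eventually.of_forall fun k ↦ hb _ (hrm k)⟩))
  set c := Φ.f (W a).proj with hc
  have hfW : Tendsto (fun k ↦ Φ.f (W (r k)).proj) u (𝓝 c) :=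
    (Φ.continuousOn_f _ (hb a ha)).tendsto.comp (tendsto_nhdsWithin_iff.2
      ⟨(continuous_proj.tendsto _).comp hrW, Eventually.of_forall fun k ↦ hb _ (hrm k)⟩)
  -- the points `f (W (r k))` on the geodesic from `-F (W b)`
  choose σ U hσ hU hU0 hUe using fun k ↦ h (r k) (hrm k) b hbm (hrb k)
  have tU : Tendsto (fun k ↦ U k 0) u (𝓝 (vscale (-1) (Φ.F (W b)))) :=
    tendsto_const_nhds.congr fun k ↦ (hU0 k).symm
  have cU : ∀ᶠ k in (u : Filter ℕ), g₂.IsCausal (U k 0) :=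
    Eventually.of_forall fun k ↦ by rw [hU0]; exact hXn b hbm
  obtain ⟨σ₀, hσ₀, hσt⟩ := h₂.exists_tendsto (Eventually.of_forall hσ) (Eventually.of_forall hU)
    cU tU (isLightlike_neg (hX b hbm).1).1
  obtain ⟨U', hU', hU'0, eU, rU⟩ := h₂.tendsto_geodesic (Eventually.of_forall hσ)
    (Eventually.of_forall hU) cU tU hσt
  have hU'c : (U' σ₀).proj = c :=
    tendsto_nhds_unique (((continuous_proj.tendsto _).comp eU).congr hUe) hfW
  have rU' := rU (fun _ ↦ 0) (convergesAtRate_const _ (Eventually.of_forall hU0))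
  -- the short geodesics from `-F (W (r k))` to `f (W a)`
  choose s Y hs hY hY0 hYe using fun k ↦ h a ha (r k) (hrm k) (hra k).le
  have tY : Tendsto (fun k ↦ Y k 0) u (𝓝 (vscale (-1) (Φ.F (W a)))) :=
    hFW.congr fun k ↦ (hY0 k).symm
  have cY : ∀ᶠ k in (u : Filter ℕ), g₂.IsCausal (Y k 0) :=
    Eventually.of_forall fun k ↦ by rw [hY0]; exact hXn _ (hrm k)
  obtain ⟨s₀, hs₀, hst⟩ := h₂.exists_tendsto (Eventually.of_forall hs) (Eventually.of_forall hY)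
    cY tY (isLightlike_neg (hX a ha).1).1
  obtain ⟨Y', hY', hY'0, eY, -⟩ := h₂.tendsto_geodesic (Eventually.of_forall hs)
    (Eventually.of_forall hY) cY tY hst
  have hpa : (vscale (-1) (Φ.F (W a))).proj = c := Φ.proj_F _ (hb a ha)
  have hs₀0 : s₀ = 0 := by
    refine hl₂ Y' s₀ hs₀ hY' (hY'0 ▸ hXn a ha) ?_
    rw [hY'0, hpa]
    refine tendsto_nhds_unique tendsto_const_nhds (((continuous_proj.tendsto _).comp eY).congr hYe)
  subst hs₀0
  have hcs : c ∈ (extChartAt (𝓡∂ n) c).source := mem_extChartAt_source _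
  set z := tangentCoord c (vscale (-1) (Φ.F (W a))) with hz
  set w := tangentCoord c (U' σ₀) with hw
  have hUcs : (U' σ₀).proj ∈ (extChartAt (𝓡∂ n) c).source := hU'c ▸ hcs
  have hzcs : (vscale (-1) (Φ.F (W a))).proj ∈ (extChartAt (𝓡∂ n) c).source := hpa ▸ hcs
  by_cases hind : ∀ x y : ℝ, x • w = y • z → x = 0 ∧ y = 0
  · exfalso
    obtain ⟨κ, hκ, hlow⟩ := exists_norm_smul_sub_smul_ge hind
    obtain ⟨C, -, e1⟩ := rU' c hUcs (κ / 2) (half_pos hκ)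
    have e2 := eventually_chord_le hs hY tY hst (half_pos hκ)
    obtain ⟨k, h1, h2⟩ := (e1.and e2).exists
    rw [hUe, hU'c, ← hw] at h1
    rw [hYe, hY0, hpa, ← hz] at h2
    have h3 : (vscale (-1) (Φ.F (W (r k)))).proj = Φ.f (W (r k)).proj := Φ.proj_F _ (hb _ (hrm k))
    rw [h3] at h2
    have h4 := hlow (σ k - σ₀) (-(s k))
    have h5 : ‖(σ k - σ₀) • w - -(s k) • z‖ ≤
        κ / 2 * s k + (C * |0| + κ / 2 * |σ k - σ₀|) := by
      refine le_trans ?_ (add_le_add h2 h1)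
      rw [← norm_neg ((σ k - σ₀) • w - -(s k) • z)]
      refine le_trans (le_of_eq ?_) (norm_add_le _ _)
      congr 1
      rw [neg_smul]
      abel
    rw [abs_neg, abs_of_nonneg (hs k)] at h4
    rw [abs_zero, mul_zero, zero_add] at h5
    have h6 : s k = 0 := by
      have := abs_nonneg (σ k - σ₀)
      have := hs k
      nlinarith
    have h7 : Φ.f (W (r k)).proj = c := by
      have h7' := hYe k
      rw [h6, hY0, h3] at h7'
      exact h7'
    have h8 := Φ.injOn_f (hb _ (hrm k)) (hb a ha) h7
    have hWk : g₁.IsGeodesicOn (fun t ↦ W (t + a)) (Icc 0 (r k - a)) :=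
      hW.shift a (by linarith) (by linarith [hrb k])
    have h9 := hl₁ _ (r k - a) (by linarith [hra k]) hWk
      (by simp only [zero_add]; exact Or.inr (hl a ha)) (by
        simp only [zero_add, sub_add_cancel]; exact h8.symm)
    linarith [hra k]
  · push Not at hind
    obtain ⟨x, y, hxy, hne⟩ := hind
    have hz0 : z ≠ 0 := tangentCoord_ne_zero hzcs (isLightlike_neg (hX a ha).1).1
    have hx : x ≠ 0 := by
      rintro rfl
      rw [zero_smul] at hxy
      exact (smul_eq_zero.1 hxy.symm).elim (hne rfl) hz0
    have hwz : w = (y / x) • z := by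
      rw [div_eq_inv_mul, mul_smul, ← hxy, smul_smul, inv_mul_cancel₀ hx, one_smul]
    have heq := eq_vscale_of_smul_tangentCoord hUcs (hU'c.trans hpa.symm) hwz
    refine ⟨σ₀, U', y / x, hσ₀, ?_, hU', hU'0, heq⟩
    -- both vectors are past-directed
    have hpos : 0 < g₂.timePairing (U' σ₀) := by
      have h0 := left_mem_Icc.2 hσ₀
      have h1 := right_mem_Icc.2 hσ₀
      have hcau := hU'.isCausal h0 h1 (hU'0 ▸ hXn b hbm)
      rcases lt_or_gt_of_ne hcau.timePairing_ne_zero with h2 | h2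
      · have h3 := hU'.timePairing_neg h1 h0 hcau h2
        rw [hU'0, timePairing_vscale] at h3
        linarith [(hX b hbm).2]
      · exact h2
    rw [heq, timePairing_vscale, timePairing_vscale] at hpos
    have := (hX a ha).2
    by_contra hcon
    push Not at hcon
    nlinarith

end LensMap

open TimeOrientedLorentzianMetric

theorem exists_transversal_timelike_direction {n : ℕ} [NeZero n] {M : Type*} [TopologicalSpace M]
    [ChartedSpace (EuclideanHalfSpace n) M] [IsManifold (𝓡∂ n) ∞ M]
    {g : TimeOrientedLorentzianMetric n M} {w : TangentBundle (𝓡∂ n) M}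
    (hf : g.timePairing w < 0) :
    ∃ u : Model n, u 0 ≠ 0 ∧
      g.metricCoeff w.proj (extChartAt (𝓡∂ n) w.proj w.proj) u u < 0 ∧
      g.metricCoeff w.proj (extChartAt (𝓡∂ n) w.proj w.proj) (bundleChart w.proj w).2 u < 0 := by
  set x₀ := w.proj with hx₀
  have hsrc : x₀ ∈ (extChartAt (𝓡∂ n) x₀).source := mem_extChartAt_source _
  set G := g.metricCoeff x₀ (extChartAt (𝓡∂ n) x₀ x₀) with hG
  set T := g.timeCoord x₀ x₀ with hT
  have h1 : G T T < 0 := by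
    have h := g.timePairing_eq_chart (x₀ := x₀) (v := ⟨x₀, g.timeField x₀⟩) hsrc
    have h' : g.timePairing (⟨x₀, g.timeField x₀⟩ : TangentBundle (𝓡∂ n) M) < 0 :=
      g.timeField_timelike x₀
    rw [h] at h'
    exact h'
  have h2 : G (bundleChart x₀ w).2 T < 0 := by
    rw [hG, metricCoeff_symm]
    rwa [g.timePairing_eq_chart (x₀ := x₀) (v := w) hsrc] at hf
  set e : Model n := EuclideanSpace.single 0 1 with he
  have he0 : e 0 = 1 := by simp [he]
  have hc : Continuous fun κ : ℝ ↦ T + κ • e := by fun_prop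
  have h3 : ∀ᶠ κ in 𝓝 (0 : ℝ), G (T + κ • e) (T + κ • e) < 0 := by
    have : Continuous fun κ : ℝ ↦ G (T + κ • e) (T + κ • e) := by fun_prop
    refine this.continuousAt.eventually (gt_mem_nhds ?_)
    simpa using h1
  have h4 : ∀ᶠ κ in 𝓝 (0 : ℝ), G (bundleChart x₀ w).2 (T + κ • e) < 0 := by
    have : Continuous fun κ : ℝ ↦ G (bundleChart x₀ w).2 (T + κ • e) := by fun_prop
    refine this.continuousAt.eventually (gt_mem_nhds ?_)
    simpa using h2
  by_cases hT0 : T 0 = 0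
  · obtain ⟨κ, ⟨h5, h6⟩, h7⟩ := (((h3.and h4).filter_mono nhdsWithin_le_nhds).and
      (self_mem_nhdsWithin : {(0 : ℝ)}ᶜ ∈ 𝓝[≠] 0)).exists
    refine ⟨T + κ • e, ?_, h5, h6⟩
    change T 0 + κ * e 0 ≠ 0
    rw [hT0, he0, zero_add, mul_one]
    exact h7
  · exact ⟨T, hT0, h1, h2⟩

namespace LensMap

variable {n : ℕ} [NeZero n]
  {M₁ : Type*} [TopologicalSpace M₁] [ChartedSpace (EuclideanHalfSpace n) M₁]
  [IsManifold (𝓡∂ n) ∞ M₁]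
  {M₂ : Type*} [TopologicalSpace M₂] [ChartedSpace (EuclideanHalfSpace n) M₂]
  [IsManifold (𝓡∂ n) ∞ M₂]
  {g₁ : TimeOrientedLorentzianMetric n M₁} {g₂ : TimeOrientedLorentzianMetric n M₂}
  [T2Space M₁] [CompactSpace M₁] [T2Space M₂] [CompactSpace M₂]

theorem exists_pastReach (Φ : LensMap g₁ g₂) (h₁ : g₁.CausalBounds) (h₂ : g₂.CausalBounds)
    {W : ℝ → TangentBundle (𝓡∂ n) M₁} {a b t₀ : ℝ} (hab : a < b)
    (hW : g₁.IsGeodesicOn W (Icc a b)) (hb : ∀ t ∈ Icc a b, (W t).proj ∈ (𝓡∂ n).boundary M₁)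
    (hl : ∀ t ∈ Icc a b, g₁.IsLightlike (W t)) (hf : ∀ t ∈ Icc a b, g₁.timePairing (W t) < 0)
    (ht₀ : t₀ ∈ Icc a b) {u : Model n} (hu0 : u 0 < 0)
    (huu : g₁.metricCoeff (W t₀).proj (extChartAt (𝓡∂ n) (W t₀).proj (W t₀).proj) u u < 0)
    (hwu : g₁.metricCoeff (W t₀).proj (extChartAt (𝓡∂ n) (W t₀).proj (W t₀).proj)
      (bundleChart (W t₀).proj (W t₀)).2 u < 0) :
    ∃ A ∈ 𝓝[Icc a b] t₀, Φ.PastReach W (Icc a b ∩ A) := by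
  obtain ⟨A, hA, h⟩ := hW.exists_timelike_approximation hab hb hl hf ht₀ hu0 huu hwu
  refine ⟨A, hA, fun r hr t ht hrt ↦ ?_⟩
  obtain ⟨B, hB, hB0⟩ := h r hr t ht hrt
  have hWr : g₁.IsGeodesicOn (fun σ ↦ vscale (-1) (W (t - σ))) (Icc 0 (t - r)) :=
    hW.reverse t (by linarith [hr.1.1]) (by linarith [ht.1.2])
  have hl' := Φ.lightlike (W r) (hb r hr.1) (hl r hr.1) (hf r hr.1)
  have hend : (vscale (-1) (W (t - (t - r)))).proj = (W r).proj := by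
    rw [vscale_proj, sub_sub_cancel]
  obtain ⟨σ, U, hσ, hU, hU0, hUe⟩ := Φ.past_reach h₁ h₂ (hb t ht.1) (hl t ht.1) (hf t ht.1)
    (sub_nonneg.2 hrt) hWr (by simp only [sub_zero]) (by simp only [hend]; exact hb r hr.1)
    (fun k ↦ (hB k).1) (fun k ↦ (hB k).2.1) (fun k ↦ (hB k).2.2.1) (fun k ↦ (hB k).2.2.2) hB0
    hl'.1 hl'.2 (by simp only [hend]; exact Φ.proj_F _ (hb r hr.1))
  exact ⟨σ, U, hσ, hU, hU0, hUe.trans (congrArg Φ.f hend)⟩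

/-- Lens maps take lightlike geodesics in the boundary to velocities, up to positive factors, of
geodesics: local version. -/
theorem exists_follows (Φ : LensMap g₁ g₂) (h₁ : g₁.CausalBounds) (h₂ : g₂.CausalBounds)
    (hl₁ : g₁.NoCausalLoops) (hl₂ : g₂.NoCausalLoops)
    {W : ℝ → TangentBundle (𝓡∂ n) M₁} {a b t₀ : ℝ} (hab : a < b)
    (hW : g₁.IsGeodesicOn W (Icc a b)) (hb : ∀ t ∈ Icc a b, (W t).proj ∈ (𝓡∂ n).boundary M₁)
    (hl : ∀ t ∈ Icc a b, g₁.IsLightlike (W t)) (hf : ∀ t ∈ Icc a b, g₁.timePairing (W t) < 0)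
    (ht₀ : t₀ ∈ Icc a b) :
    ∃ A ∈ 𝓝[Icc a b] t₀, ∀ r ∈ Icc a b, ∀ t ∈ Icc a b, r ≤ t → Icc r t ⊆ A →
      g₂.Follows (vscale (-1) (Φ.F (W t))) (vscale (-1) (Φ.F (W r))) := by
  obtain ⟨u, hu0, huu, hwu⟩ := exists_transversal_timelike_direction (hf t₀ ht₀)
  rcases lt_or_gt_of_ne hu0 with hu | hu
  · obtain ⟨A, hA, h⟩ := Φ.exists_pastReach h₁ h₂ hab hW hb hl hf ht₀ hu huu hwu
    refine ⟨A, hA, fun r hr t ht hrt hsub ↦ ?_⟩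
    have hI : Icc r t ⊆ Icc a b := Icc_subset_Icc hr.1 ht.2
    exact PastReach.follows h₂ hl₁ hl₂ hrt (hW.mono hI ordConnected_Icc) (fun s hs ↦ hb s (hI hs))
      (fun s hs ↦ hl s (hI hs)) (fun s hs ↦ hf s (hI hs))
      fun r' hr' t' ht' ↦ h r' ⟨hI hr', hsub hr'⟩ t' ⟨hI ht', hsub ht'⟩
  · set W' : ℝ → TangentBundle (𝓡∂ n) M₁ := fun t ↦ vscale (-1) (W (0 - t)) with hW'
    have hm : ∀ {t}, t ∈ Icc (-b) (-a) → 0 - t ∈ Icc a b := fun ht ↦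
      ⟨by linarith [ht.2], by linarith [ht.1]⟩
    have hWg : g₁.timeReverse.IsGeodesicOn W' (Icc (-b) (-a)) :=
      hW.reverse 0 (by linarith) (by linarith)
    have hb' : ∀ t ∈ Icc (-b) (-a), (W' t).proj ∈ (𝓡∂ n).boundary M₁ := fun t ht ↦ hb _ (hm ht)
    have hl' : ∀ t ∈ Icc (-b) (-a), g₁.timeReverse.IsLightlike (W' t) := fun t ht ↦
      isLightlike_neg (g := g₁) (hl _ (hm ht))
    have hf' : ∀ t ∈ Icc (-b) (-a), g₁.timeReverse.timePairing (W' t) < 0 := fun t ht ↦ by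
      rw [hW', timePairing_timeReverse_neg]; exact hf _ (hm ht)
    have ht₀' : -t₀ ∈ Icc (-b) (-a) := ⟨neg_le_neg ht₀.2, neg_le_neg ht₀.1⟩
    have hp : W' (-t₀) = vscale (-1) (W t₀) := by simp only [hW', sub_neg_eq_add, zero_add]
    have hsrc : (W t₀).proj ∈ (extChartAt (𝓡∂ n) (W t₀).proj).source := mem_extChartAt_source _
    obtain ⟨A, hA, h⟩ := Φ.timeReverse.exists_pastReach (u := -u) h₁.timeReverse h₂.timeReverse
      (by linarith) hWg hb' hl' hf' ht₀' (neg_neg_of_pos hu) (by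
        rw [hp]
        change g₁.metricCoeff (W t₀).proj (extChartAt (𝓡∂ n) (W t₀).proj (W t₀).proj) (-u) (-u) < 0
        simpa using huu) (by
        rw [hp, vscale_proj, bundleChart_vscale (-1) hsrc]
        change g₁.metricCoeff (W t₀).proj (extChartAt (𝓡∂ n) (W t₀).proj (W t₀).proj)
          ((-1 : ℝ) • tangentCoord (W t₀).proj (W t₀)) (-u) < 0
        rw [bundleChart_apply] at hwu
        simpa using hwu)
    have hneg : Tendsto (fun t : ℝ ↦ -t) (𝓝[Icc a b] t₀) (𝓝[Icc (-b) (-a)] (-t₀)) :=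
      tendsto_nhdsWithin_iff.2 ⟨(continuous_neg.tendsto t₀).mono_left nhdsWithin_le_nhds,
        eventually_nhdsWithin_of_forall fun t ht ↦ ⟨neg_le_neg ht.2, neg_le_neg ht.1⟩⟩
    refine ⟨_, hneg hA, fun r hr t ht hrt hsub ↦ ?_⟩
    have hI : Icc (-t) (-r) ⊆ Icc (-b) (-a) := Icc_subset_Icc (neg_le_neg ht.2) (neg_le_neg hr.1)
    have hA' : Icc (-t) (-r) ⊆ A := fun s hs ↦ by
      have : -s ∈ Icc r t := ⟨by linarith [hs.2], by linarith [hs.1]⟩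
      have := hsub this
      rwa [mem_preimage, neg_neg] at this
    have key : g₂.Follows _ _ := PastReach.follows (Φ := Φ.timeReverse) h₂.timeReverse
      (fun V s hs hV hc hp ↦ hl₁ V s hs hV hc hp) (fun V s hs hV hc hp ↦ hl₂ V s hs hV hc hp)
      (neg_le_neg hrt) (hWg.mono hI ordConnected_Icc) (fun s hs ↦ hb' s (hI hs))
      (fun s hs ↦ hl' s (hI hs)) (fun s hs ↦ hf' s (hI hs))
      fun r' hr' t' ht' ↦ h r' ⟨hI hr', hA' hr'⟩ t' ⟨hI ht', hA' ht'⟩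
    have hval : ∀ s, vscale (-1) (Φ.timeReverse.F (W' (-s))) = Φ.F (W s) := fun s ↦ by
      change vscale (-1) (vscale (-1) (Φ.F (vscale (-1) (W' (-s))))) = _
      rw [vscale_neg_one_neg_one, hW']
      simp only [sub_neg_eq_add, zero_add, vscale_neg_one_neg_one]
    rw [hval, hval] at key
    exact key.reverse

/-- Lens maps take lightlike geodesics in the boundary to velocities, up to positive factors, of
geodesics. -/
theorem follows (Φ : LensMap g₁ g₂) (h₁ : g₁.CausalBounds) (h₂ : g₂.CausalBounds)
    (hl₁ : g₁.NoCausalLoops) (hl₂ : g₂.NoCausalLoops)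
    {W : ℝ → TangentBundle (𝓡∂ n) M₁} {a b : ℝ} (hab : a < b)
    (hW : g₁.IsGeodesicOn W (Icc a b)) (hb : ∀ t ∈ Icc a b, (W t).proj ∈ (𝓡∂ n).boundary M₁)
    (hl : ∀ t ∈ Icc a b, g₁.IsLightlike (W t)) (hf : ∀ t ∈ Icc a b, g₁.timePairing (W t) < 0) :
    g₂.Follows (vscale (-1) (Φ.F (W b))) (vscale (-1) (Φ.F (W a))) := by
  choose! A hA hfol using fun t₀ (ht₀ : t₀ ∈ Icc a b) ↦
    Φ.exists_follows h₁ h₂ hl₁ hl₂ hab hW hb hl hf ht₀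
  obtain ⟨t, ht0, hmono, ⟨m, hm⟩, hsub⟩ := exists_monotone_Icc_subset_open_cover_Icc hab.le
    (c := fun i : Icc a b ↦ interior ((↑) ⁻¹' A i)) (fun _ ↦ isOpen_interior) fun i _ ↦ by
      refine mem_iUnion.2 ⟨i, mem_interior_iff_mem_nhds.2 ?_⟩
      exact preimage_coe_mem_nhds_subtype.2 (hA i i.2)
  have step : ∀ k, g₂.Follows (vscale (-1) (Φ.F (W (t k)))) (vscale (-1) (Φ.F (W a))) := by
    intro k
    induction k with
    | zero => rw [ht0]; exact Follows.refl _
    | succ k ih =>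
      obtain ⟨i, hi⟩ := hsub k
      refine Follows.trans (hfol i i.2 (t k) (t k).2 (t (k + 1)) (t (k + 1)).2
        (hmono (Nat.le_succ k)) fun s hs ↦ ?_) ih
      have hsI : s ∈ Icc a b := ⟨(t k).2.1.trans hs.1, hs.2.trans (t (k + 1)).2.2⟩
      have hs' : (⟨s, hsI⟩ : Icc a b) ∈ Icc (t k) (t (k + 1)) := hs
      exact interior_subset (s := (Subtype.val : Icc a b → ℝ) ⁻¹' A i) (hi hs')
  have := step m
  rwa [hm m le_rfl] at this

end LensMap

open TimeOrientedLorentzianMetric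

variable {n : ℕ} [NeZero n]
  {M₁ : Type*} [TopologicalSpace M₁] [ChartedSpace (EuclideanHalfSpace n) M₁]
  [IsManifold (𝓡∂ n) ∞ M₁]
  {M₂ : Type*} [TopologicalSpace M₂] [ChartedSpace (EuclideanHalfSpace n) M₂]
  [IsManifold (𝓡∂ n) ∞ M₂]
  {g₁ : TimeOrientedLorentzianMetric n M₁} {g₂ : TimeOrientedLorentzianMetric n M₂}

theorem TimeOrientedLorentzianMetric.IsStronglyCausal.noCausalLoops {M : Type*} [TopologicalSpace M] [T2Space M]
    [ChartedSpace (EuclideanHalfSpace n) M] [IsManifold (𝓡∂ n) ∞ M]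
    {g : TimeOrientedLorentzianMetric n M} (hsc : g.IsStronglyCausal) : g.NoCausalLoops :=
  fun _ _ hs hV hc h ↦ hsc.length_eq_zero hs hV hc h

theorem LensMap.meet_of_mem_timeProbeData [T2Space M₁] [CompactSpace M₁] [T2Space M₂]
    [CompactSpace M₂] (Φ : LensMap g₁ g₂) (h₁ : g₁.CausalBounds) (h₂ : g₂.CausalBounds)
    (hl₁ : g₁.NoCausalLoops) (hl₂ : g₂.NoCausalLoops)
    (hconv : g₁.LightlikeTangentGeodesicsStayInBoundary) {ξ η : TangentBundle (𝓡∂ n) M₁} {t : ℝ}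
    (h : (ξ, t, η) ∈ g₁.timeProbeData) : g₂.Meet (Φ.F ξ) t (vscale (-1) (Φ.F η)) := by
  obtain ⟨hξ, hη, hξt, hξf, hηl, hηf, hmeet⟩ := mem_timeProbeData.1 h
  obtain ⟨τ, s, V, W, hbr, ht⟩ := meet_neg_iff.1 hmeet
  rw [hηl.causalNorm_eq, mul_zero, add_zero] at ht
  have hFξ := Φ.timelike ξ hξ hξt hξf
  have hFη := Φ.lightlike η hη hηl hηf
  by_cases hcase : s = 0 ∨ ∃ r ∈ Icc (-s) 0, (W r).proj ∉ (𝓡∂ n).boundary M₁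
  · obtain ⟨ξ', t', η', heq, -, -, -, -, u, ζ, hu, hζ, hmem⟩ :=
      properTimeProbeData_subset h₁ hconv ⟨ξ, t, η, rfl, h, τ, s, V, W, hbr, ht, hcase⟩
    obtain ⟨rfl, rfl, rfl⟩ : ξ = ξ' ∧ t = t' ∧ η = η' := by simpa using heq
    have hmem' := fun i ↦ mem_brokenTimelikeLensData.1 (hmem i)
    have hFζ : Tendsto (fun i ↦ Φ.F (ζ i)) atTop (𝓝 (Φ.F η)) :=
      (Φ.continuousOn_F η hη).tendsto.comp (tendsto_nhdsWithin_iff.2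
        ⟨hζ, Eventually.of_forall fun i ↦ (hmem' i).2.1⟩)
    refine h₂.meet_of_tendsto tendsto_const_nhds (((continuous_vscale (-1)).tendsto _).comp hFζ) hu
      (Eventually.of_forall fun _ ↦ Or.inl hFξ.1) (Eventually.of_forall fun i ↦ ?_)
      (g₂.isCausal_iff.1 (Or.inl hFξ.1)).1 (LensMap.isLightlike_neg hFη.1).1
      (Eventually.of_forall fun i ↦ ?_)
    all_goals obtain ⟨-, hb, -, -, ht', hf', hm⟩ := hmem' i
    · exact Or.inl (LensMap.isTimelike_neg (Φ.timelike _ hb ht' hf').1)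
    · exact Φ.meet _ hξ _ hb hξt hξf ht' hf' _ hm
  · push Not at hcase
    obtain ⟨hs0, hWb⟩ := hcase
    obtain ⟨hτ, hs, hV, rfl, hW, rfl, hp⟩ := hbr
    have h0 : (0 : ℝ) ∈ Icc (-s) 0 := right_mem_Icc.2 (by linarith)
    have hms : -s ∈ Icc (-s) 0 := left_mem_Icc.2 (by linarith)
    have hWl : ∀ r ∈ Icc (-s) 0, g₁.IsLightlike (W r) := fun r hr ↦ hW.isLightlike h0 hr hηl
    have hWf : ∀ r ∈ Icc (-s) 0, g₁.timePairing (W r) < 0 := fun r hr ↦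
      hW.timePairing_neg h0 hr (Or.inr hηl) hηf
    have hν := Φ.lightlike _ (hWb _ hms) (hWl _ hms) (hWf _ hms)
    obtain ⟨τ', V', hτ', hV', hV'0, hV'e, hlen⟩ := Φ.reaches h₂ hτ hV hξ hξt hξf
      (hp ▸ hWb _ hms) hν.1 hν.2 (hp ▸ Φ.proj_F _ (hWb _ hms))
    obtain ⟨σ, U, c, hσ, hc, hU, hU0, hUe⟩ := Φ.follows h₁ h₂ hl₁ hl₂
      (lt_of_le_of_ne (by linarith) (by simpa using hs0)) hW hWb hWl hWf
    refine ⟨τ', σ, V', U, hτ', hσ, hV', hV'0, hU, hU0, ?_, ?_⟩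
    · rw [hV'e, hUe, hp]; exact (Φ.proj_F _ (hWb _ hms)).symm
    · rw [causalNorm_vscale_neg_one, hFη.1.causalNorm_eq, mul_zero, add_zero, hlen, ht]

namespace BoundaryBundleIso

theorem mapsTo (Φ : BoundaryBundleIso n M₁ M₂) {v : TangentBundle (𝓡∂ n) M₁}
    (hv : v ∈ boundaryTangentBundle n M₁) : Φ.total v ∈ boundaryTangentBundle n M₂ := by
  rw [← Φ.total_target]; exact Φ.total.map_source (Φ.total_source ▸ hv)

theorem symm_mapsTo (Φ : BoundaryBundleIso n M₁ M₂) {v : TangentBundle (𝓡∂ n) M₂}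
    (hv : v ∈ boundaryTangentBundle n M₂) : Φ.total.symm v ∈ boundaryTangentBundle n M₁ := by
  rw [← Φ.total_source]; exact Φ.total.map_target (Φ.total_target ▸ hv)

theorem total_symm_apply (Φ : BoundaryBundleIso n M₁ M₂) {v : TangentBundle (𝓡∂ n) M₂}
    (hv : v ∈ boundaryTangentBundle n M₂) : Φ.total (Φ.total.symm v) = v :=
  Φ.total.right_inv (Φ.total_target ▸ hv)

def symm (Φ : BoundaryBundleIso n M₁ M₂) : BoundaryBundleIso n M₂ M₁ where
  total := Φ.total.symm
  base := Φ.base.symm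
  total_source := Φ.total_target
  total_target := Φ.total_source
  base_source := Φ.base_target
  base_target := Φ.base_source
  total_smooth := Φ.total_symm_smooth
  total_symm_smooth := Φ.total_smooth
  base_smooth := Φ.base_symm_smooth
  base_symm_smooth := Φ.base_smooth
  proj_total v hv := by
    have h := Φ.proj_total _ (Φ.symm_mapsTo hv)
    rw [Φ.total_symm_apply hv] at h
    rw [h, Φ.base.left_inv (Φ.base_source ▸ Φ.symm_mapsTo hv)]

theorem Identifies.symm {Φ : BoundaryBundleIso n M₁ M₂}
    {A : Set (TangentBundle (𝓡∂ n) M₁ × ℝ × TangentBundle (𝓡∂ n) M₁)}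
    {B : Set (TangentBundle (𝓡∂ n) M₂ × ℝ × TangentBundle (𝓡∂ n) M₂)} (h : Φ.Identifies A B) :
    Φ.symm.Identifies B A := fun ξ hξ t η hη ↦ by
  have := h _ (Φ.symm_mapsTo hξ) t _ (Φ.symm_mapsTo hη)
  rw [Φ.total_symm_apply hξ, Φ.total_symm_apply hη] at this
  exact this.symm

theorem IdentifiesZeroSections.symm {Φ : BoundaryBundleIso n M₁ M₂}
    (h : Φ.IdentifiesZeroSections) : Φ.symm.IdentifiesZeroSections := fun v hv ↦ by
  have := h _ (Φ.symm_mapsTo hv)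
  rw [Φ.total_symm_apply hv] at this
  exact this.symm

theorem mem_brokenTimelikeLensData_self {M : Type*} [TopologicalSpace M]
    [ChartedSpace (EuclideanHalfSpace n) M] [IsManifold (𝓡∂ n) ∞ M]
    {g : TimeOrientedLorentzianMetric n M} {v : TangentBundle (𝓡∂ n) M}
    (hv : v ∈ boundaryTangentBundle n M) :
    (v, 0, v) ∈ g.brokenTimelikeLensData ↔ g.IsTimelike v ∧ g.timePairing v < 0 := by
  rw [mem_brokenTimelikeLensData]
  exact ⟨fun h ↦ ⟨h.2.2.1, h.2.2.2.1⟩, fun h ↦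
    ⟨hv, hv, h.1, h.2, h.1, h.2, meet_self_zero _ rfl⟩⟩

theorem timelike_iff {Φ : BoundaryBundleIso n M₁ M₂}
    (h : Φ.Identifies g₁.brokenTimelikeLensData g₂.brokenTimelikeLensData)
    {v : TangentBundle (𝓡∂ n) M₁} (hv : v ∈ boundaryTangentBundle n M₁) :
    g₁.IsTimelike v ∧ g₁.timePairing v < 0 ↔
      g₂.IsTimelike (Φ.total v) ∧ g₂.timePairing (Φ.total v) < 0 := by
  rw [← mem_brokenTimelikeLensData_self hv, ← mem_brokenTimelikeLensData_self (Φ.mapsTo hv)]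
  exact h v hv 0 v hv

/-- An isomorphism of broken timelike lens data is a lens map. -/
def lensMap (Φ : BoundaryBundleIso n M₁ M₂)
    (h : Φ.Identifies g₁.brokenTimelikeLensData g₂.brokenTimelikeLensData)
    (h0 : Φ.IdentifiesZeroSections) : LensMap g₁ g₂ where
  F := Φ.total
  f := Φ.base
  continuousOn_F := Φ.total_source ▸ Φ.total_smooth.continuousOn
  continuousOn_f := Φ.base_source ▸ Φ.base_smooth.continuousOn
  injOn_f := Φ.base_source ▸ Φ.base.injOn
  proj_F := Φ.proj_total
  timelike v hv ht hf := (timelike_iff h hv).1 ⟨ht, hf⟩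
  lightlike v hv hl hf := by
    set ε : ℕ → ℝ := fun k ↦ 1 / ((k : ℝ) + 1) with hε
    have hε0 : ∀ k, 0 < ε k := fun k ↦ Nat.one_div_pos_of_nat
    have hεt : Tendsto ε atTop (𝓝 0) := tendsto_one_div_add_atTop_nhds_zero_nat
    have hc : ContinuousOn Φ.total (boundaryTangentBundle n M₁) :=
      Φ.total_source ▸ Φ.total_smooth.continuousOn
    have hb : ∀ k, g₁.tilt (ε k) v ∈ boundaryTangentBundle n M₁ := fun _ ↦ hv
    have hlim : Tendsto (fun k ↦ Φ.total (g₁.tilt (ε k) v)) atTop (𝓝 (Φ.total v)) :=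
      (hc v hv).tendsto.comp (tendsto_nhdsWithin_iff.2
        ⟨tendsto_tilt hεt v, Eventually.of_forall hb⟩)
    have ht : ∀ k, g₂.IsTimelike (Φ.total (g₁.tilt (ε k) v)) ∧
        g₂.timePairing (Φ.total (g₁.tilt (ε k) v)) < 0 := fun k ↦ (timelike_iff h (hb k)).1
      ⟨isTimelike_tilt hl.2.le (hε0 k).ne' (mul_nonpos_of_nonneg_of_nonpos (hε0 k).le hf.le),
        timePairing_tilt_neg (hε0 k) hf.le⟩
    have hcau : g₂.IsCausal (Φ.total v) := g₂.isCausal_of_tendsto hlim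
      (Eventually.of_forall fun k ↦ Or.inl (ht k).1) fun h' ↦ hl.1 ((h0 v hv).2 h')
    have htp : g₂.timePairing (Φ.total v) < 0 := lt_of_le_of_ne
      (le_of_tendsto (((continuous_timePairing (g := g₂)).tendsto _).comp hlim)
        (Eventually.of_forall fun k ↦ (ht k).2.le)) hcau.timePairing_ne_zero
    refine ⟨hcau.resolve_left fun h' ↦ ?_, htp⟩
    have := ((timelike_iff h hv).2 ⟨h', htp⟩).1
    exact (ne_of_lt this) hl.2
  surj x hx w hw ht hf := by
    have hwb : w ∈ boundaryTangentBundle n M₂ := by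
      change w.proj ∈ (𝓡∂ n).boundary M₂
      rw [hw, ← Φ.base_target]
      exact Φ.base.map_source (Φ.base_source ▸ hx)
    have hv := Φ.symm_mapsTo hwb
    have hp := Φ.proj_total _ hv
    have h' := (timelike_iff h hv).2 (by rw [Φ.total_symm_apply hwb]; exact ⟨ht, hf⟩)
    refine ⟨Φ.total.symm w, ?_, h'.1, h'.2, Φ.total_symm_apply hwb⟩
    rw [Φ.total_symm_apply hwb, hw] at hp
    exact Φ.base.injOn (Φ.base_source ▸ hv) (Φ.base_source ▸ hx) hp.symm
  meet ξ hξ η hη ht hf ht' hf' t hm := (mem_brokenTimelikeLensData.1 ((h ξ hξ t η hη).1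
    (mem_brokenTimelikeLensData.2 ⟨hξ, hη, ht, hf, ht', hf', hm⟩))).2.2.2.2.2.2

theorem mem_timeProbeData_total [T2Space M₁] [CompactSpace M₁] [T2Space M₂] [CompactSpace M₂]
    {Φ : BoundaryBundleIso n M₁ M₂}
    (h : Φ.Identifies g₁.brokenTimelikeLensData g₂.brokenTimelikeLensData)
    (h0 : Φ.IdentifiesZeroSections) (hsc₁ : g₁.IsStronglyCausal) (hsc₂ : g₂.IsStronglyCausal)
    (hconv : g₁.LightlikeTangentGeodesicsStayInBoundary) {ξ η : TangentBundle (𝓡∂ n) M₁} {t : ℝ}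
    (hD : (ξ, t, η) ∈ g₁.timeProbeData) : (Φ.total ξ, t, Φ.total η) ∈ g₂.timeProbeData := by
  obtain ⟨hξ, hη, hξt, hξf, hηl, hηf, -⟩ := mem_timeProbeData.1 hD
  have h1 := (Φ.lensMap h h0).timelike ξ hξ hξt hξf
  have h2 := (Φ.lensMap h h0).lightlike η hη hηl hηf
  exact mem_timeProbeData.2 ⟨Φ.mapsTo hξ, Φ.mapsTo hη, h1.1, h1.2, h2.1, h2.2,
    (Φ.lensMap h h0).meet_of_mem_timeProbeData hsc₁.causalBounds hsc₂.causalBounds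
      hsc₁.noCausalLoops hsc₂.noCausalLoops hconv hD⟩

theorem identifies_timeProbeData [T2Space M₁] [CompactSpace M₁] [T2Space M₂] [CompactSpace M₂]
    {Φ : BoundaryBundleIso n M₁ M₂}
    (h : Φ.Identifies g₁.brokenTimelikeLensData g₂.brokenTimelikeLensData)
    (h0 : Φ.IdentifiesZeroSections) (hsc₁ : g₁.IsStronglyCausal) (hsc₂ : g₂.IsStronglyCausal)
    (hconv₁ : g₁.LightlikeTangentGeodesicsStayInBoundary)
    (hconv₂ : g₂.LightlikeTangentGeodesicsStayInBoundary) :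
    Φ.Identifies g₁.timeProbeData g₂.timeProbeData := fun ξ hξ t η hη ↦ by
  refine ⟨mem_timeProbeData_total h h0 hsc₁ hsc₂ hconv₁, fun hD ↦ ?_⟩
  have := mem_timeProbeData_total h.symm h0.symm hsc₂ hsc₁ hconv₂ hD
  change (Φ.total.symm (Φ.total ξ), t, Φ.total.symm (Φ.total η)) ∈ _ at this
  rwa [Φ.total.left_inv (Φ.total_source ▸ hξ), Φ.total.left_inv (Φ.total_source ▸ hη)] at this

end BoundaryBundleIso

end BrokenLens

end

theorem mainTheorem5 (n : ℕ) [NeZero n] (hn : 2 ≤ n)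
    (M₁ : Type*) [TopologicalSpace M₁] [T2Space M₁] [CompactSpace M₁]
    [ChartedSpace (EuclideanHalfSpace n) M₁] [IsManifold (𝓡∂ n) ∞ M₁]
    (M₂ : Type*) [TopologicalSpace M₂] [T2Space M₂] [CompactSpace M₂]
    [ChartedSpace (EuclideanHalfSpace n) M₂] [IsManifold (𝓡∂ n) ∞ M₂]
    (g₁ : BrokenLens.TimeOrientedLorentzianMetric n M₁)
    (g₂ : BrokenLens.TimeOrientedLorentzianMetric n M₂)
    (hsc₁ : g₁.IsStronglyCausal) (hsc₂ : g₂.IsStronglyCausal)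
    (hconv₁ : g₁.LightlikeTangentGeodesicsStayInBoundary)
    (hconv₂ : g₂.LightlikeTangentGeodesicsStayInBoundary) :
    (BrokenLens.HaveIsomorphicBrokenTimelikeLensData g₁ g₂ →
      BrokenLens.HaveIsomorphicTimeProbeData g₁ g₂) ∧
    (g₁.lensDataLimits ⊆ g₁.timeProbeData ∧ g₁.properTimeProbeData ⊆ g₁.lensDataLimits) ∧
    (g₂.lensDataLimits ⊆ g₂.timeProbeData ∧ g₂.properTimeProbeData ⊆ g₂.lensDataLimits) := by
  refine ⟨fun ⟨Φ, h, h0⟩ ↦ ⟨Φ, BrokenLens.BoundaryBundleIso.identifies_timeProbeData h h0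
    hsc₁ hsc₂ hconv₁ hconv₂⟩, ⟨?_, ?_⟩, ?_, ?_⟩
  · exact BrokenLens.TimeOrientedLorentzianMetric.lensDataLimits_subset hsc₁.causalBounds
  · exact BrokenLens.TimeOrientedLorentzianMetric.properTimeProbeData_subset hsc₁.causalBounds
      hconv₁
  · exact BrokenLens.TimeOrientedLorentzianMetric.lensDataLimits_subset hsc₂.causalBounds
  · exact BrokenLens.TimeOrientedLorentzianMetric.properTimeProbeData_subset hsc₂.causalBounds
      hconv₂
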